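/- **Free energy of the quantum GREM.** Let $n\in\mathbb N$, $n\ge 1$, $0=x_0<x_1<\dots<x_n=1$ and $a_1,\dots,a_n>0$ with $\sum_k a_k=1$, and let $A(x)=\sum_{k:\,x_k\le x}a_k$ for $x\in[0,1]$ be the corresponding distribution (step) function. For $\sigma\in\mathcal Q_N=\{-1,1\}^N$ write $\sigma=(\sigma_1,\dots,\sigma_n)$ with blocks $\sigma_k\in\{-1,1\}^{\lceil x_kN\rceil-\lceil x_{k-1}N\rceil}$. For each $N$ let $U=U_N$ be a random function on $\mathcal Q_N$ with the same law as $$\sigma\mapsto\sqrt N\left(\sqrt{a_1}\,X_{\sigma_1}+\sqrt{a_2}\,X_{\sigma_1\sigma_2}+\dots+\sqrt{a_n}\,X_{\sigma_1\sigma_2\cdots\sigma_n}\right),$$ where all the $X_{\sigma_1\cdots\sigma_k}$ are independent standard Gaussian variables. Let $\mathfrak b$ be an absolutely integrable real random variable and let $b_1,b_2,\dots$ be independent copies of $\mathfrak b$ such that, for each $N$, the sequence $(b_j)_{j\ge1}$ is independent of $U_N$. The transversal field $B=B_N$ acts on functions $\psi$ on $\mathcal Q_N$ by $(B\psi)(\sigma)=\sum_{j=1}^N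 b_j\,\psi(\sigma_1,\dots,-\sigma_j,\dots,\sigma_N)$ (here $\sigma_j=\pm1$ are the individual spins), and $U$ acts by multiplication. Let $\bar A$ be the concave hull of $A$ on $[0,1]$, i.e. the smallest concave function with $\bar A\ge A$; it is piecewise linear, and we let $0=y_0<y_1<\dots<y_m=1$ be the endpoints of its (maximal) linear segments. Put $\bar a_l=A(y_l)-A(y_{l-1})$, $L_l=y_l-y_{l-1}$, $\gamma_l=\bar a_l/L_l$ and $$\varphi^{(l)}(\beta)=\begin{cases}\tfrac12\beta^2\bar a_l+L_l\ln2&\text{if }\beta\le\sqrt{(2\ln2)\gamma_l^{-1}},\\ \beta\sqrt{(2\ln2)\,\bar a_lL_l}&\text{if }\beta>\sqrt{(2\ln2)\gamma_l^{-1}},\end{cases}\qquad 1\le l\le m.$$ Then for every $\beta\ge0$, almost surely, $$\lim_{N\to\infty}\frac1N\ln\operatorname{Tr}e^{-\beta(U-B)}=\max_{0\le K\le m}\left[\sum_{l=1}^K\varphi^{(l)}(\beta)+(1-y_K)\,\mathbb E\big[\ln(2\cosh(\beta\mathfrak b))\big]\right].$$ -/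

import Mathlib

open MeasureTheory ProbabilityTheory Filter Topology

noncomputable section

/-- The data of a GREM: points `0 = x₀ < x₁ < ⋯ < xₙ = 1` and jump heights, `a k > 0` being the
height of the jump at `x (k + 1)`, which add up to one. -/
structure GREM where
  n : ℕ
  x : Fin (n + 1) → ℝ
  a : Fin n → ℝ
  x_strictMono : StrictMono x
  x_zero : x 0 = 0
  x_last : x (Fin.last n) = 1
  a_pos : ∀ k, 0 < a k
  sum_a : ∑ k, a k = 1

/-- The Hamming cube `{-1, 1}^N` (`ℤˣ = {-1, 1}`). -/
abbrev HammingCube (N : ℕ) : Type := Fin N → ℤˣ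

namespace GREM

variable (G : GREM)

/-- The distribution function `A`: the step function with jumps `a k` at `x (k + 1)`. -/
def A (t : ℝ) : ℝ := ∑ k : Fin G.n, if G.x k.succ ≤ t then G.a k else 0

/-! ### The potential -/

/-- The number `⌈x_k N⌉` of spins in the first blocks, up to and including block `k`. -/
def prefixLength (N : ℕ) (k : Fin G.n) : ℕ := ⌈G.x k.succ * N⌉₊

/-- The configurations `σ₁σ₂⋯σ_k` of the spins in the blocks up to and including block `k`. -/
abbrev Prefix (N : ℕ) (k : Fin G.n) : Type := {i : Fin N // (i : ℕ) < G.prefixLength N k} → ℤˣ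

/-- The function `U(σ) = √N (√a₁ X_{σ₁} + √a₂ X_{σ₁σ₂} + ⋯ + √aₙ X_{σ₁σ₂⋯σₙ})` of a family `X`
of numbers, one for every `k` and every configuration `σ₁⋯σ_k`. -/
def potential (N : ℕ) (X : (Σ k : Fin G.n, G.Prefix N k) → ℝ) (σ : HammingCube N) : ℝ :=
  √(N : ℝ) * ∑ k : Fin G.n, √(G.a k) * X ⟨k, fun i => σ i⟩

/-- The law of the GREM potential on the Hamming cube: the law of `potential` when the `X` are
independent standard Gaussian variables. -/
def law (N : ℕ) : Measure (HammingCube N → ℝ) :=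
  (Measure.pi fun _ : (Σ k : Fin G.n, G.Prefix N k) => gaussianReal 0 1).map (G.potential N)

/-! ### The concave hull and its vertices -/

/-- The concave hull of `A` on `[0, 1]`: the smallest concave function that is at least `A`,
given as the pointwise infimum of all concave majorants. -/
def concaveHull (t : ℝ) : ℝ :=
  sInf {r : ℝ | ∃ g : ℝ → ℝ, ConcaveOn ℝ (Set.Icc 0 1) g ∧
    (∀ s ∈ Set.Icc (0 : ℝ) 1, G.A s ≤ g s) ∧ r = g t}

/-- The region below the graph of the concave hull. -/
def hullRegion : Set (ℝ × ℝ) := {p | p.1 ∈ Set.Icc (0 : ℝ) 1 ∧ p.2 ≤ G.concaveHull p.1}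

open Classical in
/-- The endpoints of the linear segments of the concave hull, i.e. those among `x₀, …, xₙ` at which
the graph of the concave hull has an extreme point (which includes `x₀ = 0` and `xₙ = 1`). -/
def hullVertices : Finset ℝ :=
  (Finset.univ.image G.x).filter fun t => (t, G.concaveHull t) ∈ G.hullRegion.extremePoints ℝ

/-- The number of linear segments of the concave hull. -/
def m : ℕ := G.hullVertices.card - 1

/-- The endpoints `0 = y₀ < y₁ < ⋯ < y_m = 1` of the linear segments of the concave hull, in
increasing order (the value at an index `l > m` is irrelevant). -/
def y (l : ℕ) : ℝ := (G.hullVertices.sort (· ≤ ·)).getD l 1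

/-- The increment `A(y_l) - A(y_{l-1})`, for `1 ≤ l ≤ m`. -/
def aBar (l : ℕ) : ℝ := G.A (G.y l) - G.A (G.y (l - 1))

/-- The length `y_l - y_{l-1}`, for `1 ≤ l ≤ m`. -/
def L (l : ℕ) : ℝ := G.y l - G.y (l - 1)

/-- The slope of the `l`-th linear segment of the concave hull, for `1 ≤ l ≤ m`. -/
def slope (l : ℕ) : ℝ := G.aBar l / G.L l

/-- The `l`-th classical partial pressure, for `1 ≤ l ≤ m`. -/
def partialPressure (l : ℕ) (β : ℝ) : ℝ :=
  if β ≤ √(2 * Real.log 2 * (G.slope l)⁻¹) then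
    1 / 2 * β ^ 2 * G.aBar l + G.L l * Real.log 2
  else
    β * √(2 * Real.log 2 * G.aBar l * G.L l)

/-- The limiting pressure, the number `p` being the pressure of the quantum paramagnet:
the maximum over `0 ≤ K ≤ m` of `∑_{1 ≤ l ≤ K} φ^{(l)}(β) + (1 - y_K) p`. -/
def limitPressure (β p : ℝ) : ℝ :=
  (Finset.range (G.m + 1)).sup' Finset.nonempty_range_add_one fun K =>
    ∑ l ∈ Finset.Icc 1 K, G.partialPressure l β + (1 - G.y K) * p

end GREM

/-! ### The quantum Hamiltonian -/

/-- The configuration `σ` with the `j`-th spin flipped. -/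
def flipSpin {N : ℕ} (j : Fin N) (σ : HammingCube N) : HammingCube N :=
  Function.update σ j (-σ j)

/-- The `x`-Pauli matrix at the site `j`, i.e. the matrix of `ψ ↦ ψ ∘ flipSpin j`. -/
def pauliX {N : ℕ} (j : Fin N) : Matrix (HammingCube N) (HammingCube N) ℝ :=
  Matrix.of fun σ τ => if τ = flipSpin j σ then 1 else 0

/-- The transversal field `B = ∑_j b_j s_j` with weights `b`. -/
def transversalField {N : ℕ} (b : Fin N → ℝ) : Matrix (HammingCube N) (HammingCube N) ℝ :=
  ∑ j, b j • pauliX j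

/-- The Hamiltonian `H = U - B`, where `U` acts by multiplication. -/
def hamiltonian {N : ℕ} (U : HammingCube N → ℝ) (b : Fin N → ℝ) :
    Matrix (HammingCube N) (HammingCube N) ℝ :=
  Matrix.diagonal U - transversalField b

/-- The pressure `N⁻¹ ln Tr e^{-βH}`. -/
def pressure {N : ℕ} (β : ℝ) (U : HammingCube N → ℝ) (b : Fin N → ℝ) : ℝ :=
  1 / (N : ℝ) * Real.log (NormedSpace.exp (-(β • hamiltonian U b))).trace

end

/-! ### Trace inequalities for exponentials of real symmetric matrices -/

section Trace

open Matrix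

variable {ι : Type*} [Fintype ι] [DecidableEq ι]

/-! Both bounds on `Tr e^{-βH}` hold on Gaussian events of probability at least `1 - K e^{-cN}`,
simultaneously for all fields whose averages are close to their limits. Borel-Cantelli and the
strong law of large numbers then give the almost sure limit.

Upper bound. Call a configuration deep at a level if its energy there is at most `-εN`. Flipping
different spins of a prefix changes the prefix in different ways, hence yields independent
Gaussians; so with overwhelming probability every configuration has at most a constant number `r` of
deep neighbours (`measure_many_deep_le`). A weighted AM-GM inequality then allows all flips that
touch a deep prefix to be removed at the cost `n (η ∑ |b_j| + r max |b_j| / η)` (`kinetic_le`),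
which is a small multiple of `N` because `max |b_j| = o(N)`. The remaining flips preserve the last
deep level `d` and act on the spins behind block `d`, while the levels after `d` contribute only
`O(εN)`. On each class the potential of the first `d` levels commutes with the remaining field, so
the trace is bounded by a sum over `d` of products of hyperbolic cosines and classical partition
functions (`trace_exp_le_sum_prod_cosh`). Fractional moments, with an exponent chosen for each
segment of the hull, bound the classical factor (`MomentsBounded.partition_le`). Since `A` lies
below its hull, which is linear on each segment, cutting inside a segment is no better than cutting
at one of its endpoints (`momentBound_add_le_limitPressure`).

Lower bound. Let `y_K` be an optimal vertex. The Peierls inequality is applied in the basis which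
freezes the spins before `y_K` and diagonalizes the field on the others
(`prod_cosh_mul_sum_exp_spinAverage_le_trace_exp`). In this basis the later levels enter through
averages of exponentially many independent variables and are negligible
(`measure_large_average_le`). For the frozen levels the second moment method produces the expected
number of configurations at slightly less than the dominating energies (`measure_few_low_le`); the
slack makes the entropy of every prefix strictly positive (`entropy_pos`). -/

theorem exists_orthogonal_diagonalization {K : Matrix ι ι ℝ} (hK : K.IsHermitian) :
    ∃ (V : Matrix ι ι ℝ) (e : ι → ℝ), V * Vᵀ = 1 ∧ K = Vᵀ * diagonal e * V := by
  have hU := hK.eigenvectorUnitary.2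
  refine ⟨(hK.eigenvectorUnitary : Matrix ι ι ℝ)ᵀ, hK.eigenvalues, ?_, ?_⟩
  · have := (Matrix.mem_unitaryGroup_iff').1 hU
    simpa [star_eq_conjTranspose, conjTranspose_eq_transpose_of_trivial] using this
  · have := hK.spectral_theorem
    rw [Unitary.conjStarAlgAut_apply] at this
    simpa [star_eq_conjTranspose, conjTranspose_eq_transpose_of_trivial, Function.comp_def]
      using this

theorem exp_orthogonal_conj {V : Matrix ι ι ℝ} (hV : V * Vᵀ = 1) (e : ι → ℝ) :
    NormedSpace.exp (Vᵀ * diagonal e * V) = Vᵀ * diagonal (fun i => Real.exp (e i)) * V := by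
  have hV' : Vᵀ * V = 1 := mul_eq_one_comm.1 hV
  have hinv : (Vᵀ)⁻¹ = V := inv_eq_right_inv hV'
  have := Matrix.exp_conj Vᵀ (diagonal e) (IsUnit.of_mul_eq_one V hV')
  rw [hinv, exp_diagonal] at this
  rw [this]
  congr 3
  ext i
  rw [Pi.coe_exp, Real.exp_eq_exp_ℝ]

theorem trace_orthogonal_conj {V : Matrix ι ι ℝ} (hV : V * Vᵀ = 1) (M : Matrix ι ι ℝ) :
    (Vᵀ * M * V).trace = M.trace := by
  rw [Matrix.trace_mul_comm, ← Matrix.mul_assoc, hV, Matrix.one_mul]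

theorem quadraticForm_orthogonal_conj (V : Matrix ι ι ℝ) (e φ : ι → ℝ) :
    φ ⬝ᵥ (Vᵀ * diagonal e * V) *ᵥ φ = ∑ i, (V *ᵥ φ) i ^ 2 * e i := by
  rw [← mulVec_mulVec, ← mulVec_mulVec, dotProduct_mulVec, vecMul_transpose]
  simp only [dotProduct, mulVec_diagonal]
  exact Finset.sum_congr rfl fun i _ => by ring

theorem sum_sq_orthogonal_mulVec {V : Matrix ι ι ℝ} (hV : V * Vᵀ = 1) (φ : ι → ℝ) :
    ∑ i, (V *ᵥ φ) i ^ 2 = φ ⬝ᵥ φ := by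
  have h := quadraticForm_orthogonal_conj V 1 φ
  have hV' : Vᵀ * V = 1 := mul_eq_one_comm.1 hV
  simpa [hV'] using h.symm

/-- Jensen's inequality for quadratic forms of exponentials. -/
theorem exp_sum_quadraticForm_le {δ : Type*} [Fintype δ] (K : δ → Matrix ι ι ℝ)
    (hK : ∀ d, (K d).IsHermitian) (φ : δ → ι → ℝ) (hφ : ∑ d, φ d ⬝ᵥ φ d = 1) :
    Real.exp (∑ d, φ d ⬝ᵥ K d *ᵥ φ d) ≤ ∑ d, φ d ⬝ᵥ NormedSpace.exp (K d) *ᵥ φ d := by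
  choose V e hV hVe using fun d => exists_orthogonal_diagonalization (hK d)
  have h1 : ∀ d, φ d ⬝ᵥ K d *ᵥ φ d = ∑ i, (V d *ᵥ φ d) i ^ 2 * e d i := fun d => by
    conv_lhs => rw [hVe d]
    exact quadraticForm_orthogonal_conj _ _ _
  have h2 : ∀ d, φ d ⬝ᵥ NormedSpace.exp (K d) *ᵥ φ d
      = ∑ i, (V d *ᵥ φ d) i ^ 2 * Real.exp (e d i) := fun d => by
    conv_lhs => rw [hVe d, exp_orthogonal_conj (hV d)]
    exact quadraticForm_orthogonal_conj _ _ _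
  simp only [h1, h2]
  have := convexOn_exp.map_sum_le (t := (Finset.univ : Finset (δ × ι)))
    (w := fun p => (V p.1 *ᵥ φ p.1) p.2 ^ 2) (p := fun p => e p.1 p.2)
    (fun _ _ => sq_nonneg _)
    (by rw [Fintype.sum_prod_type]; simpa only [sum_sq_orthogonal_mulVec (hV _)] using hφ)
    (fun _ _ => Set.mem_univ _)
  simpa only [Fintype.sum_prod_type, smul_eq_mul] using this

/-- Jensen's inequality at a coordinate vector bounds the entry below by an exponential. -/
theorem exp_isHermitian_diag_nonneg {K : Matrix ι ι ℝ} (hK : K.IsHermitian) (i : ι) :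
    0 ≤ NormedSpace.exp K i i := by
  have := exp_sum_quadraticForm_le (fun _ : Unit => K) (fun _ => hK)
    (fun _ => Pi.single i 1) (by simp)
  simp only [Finset.univ_unique, Finset.sum_singleton, single_dotProduct, one_mul,
    mulVec_single_one, col_apply] at this
  exact (Real.exp_pos _).le.trans this

theorem trace_exp_pos [Nonempty ι] {K : Matrix ι ι ℝ} (hK : K.IsHermitian) :
    0 < (NormedSpace.exp K).trace := by
  obtain ⟨V, e, hV, rfl⟩ := exists_orthogonal_diagonalization hK
  rw [exp_orthogonal_conj hV, trace_orthogonal_conj hV, trace_diagonal]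
  exact Finset.sum_pos (fun i _ => Real.exp_pos _) Finset.univ_nonempty

/-- The Peierls inequality, for the orthonormal basis given by the rows of `R`. -/
theorem sum_exp_le_trace_exp {K : Matrix ι ι ℝ} (hK : K.IsHermitian) {R : Matrix ι ι ℝ}
    (hR : R * Rᵀ = 1) :
    ∑ i, Real.exp (R i ⬝ᵥ K *ᵥ R i) ≤ (NormedSpace.exp K).trace := by
  have hR' : Rᵀ * R = 1 := mul_eq_one_comm.1 hR
  have h : (NormedSpace.exp K).trace = (R * NormedSpace.exp K * Rᵀ).trace := by
    rw [Matrix.trace_mul_comm, ← Matrix.mul_assoc, hR', Matrix.one_mul]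
  rw [h, Matrix.trace]
  refine Finset.sum_le_sum fun i _ => ?_
  have := exp_sum_quadraticForm_le (fun _ : Unit => K) (fun _ => hK) (fun _ => R i)
    (by simpa [Matrix.mul_apply, dotProduct] using congr_fun₂ hR i i)
  simp only [Finset.univ_unique, Finset.sum_singleton] at this
  refine this.trans_eq ?_
  rw [diag_apply, Matrix.mul_apply, dotProduct_mulVec]
  simp [dotProduct, vecMul, Matrix.mul_apply]

/-- If the quadratic form of `K` is bounded by that of a direct sum of compressions of matrices
`M d` to the coordinate subspaces `{D = d}`, then `Tr e^K ≤ ∑ Tr e^{M d}`. -/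
theorem trace_exp_le_sum_of_quadraticForm_le {δ : Type*} [Fintype δ] [DecidableEq δ]
    {K : Matrix ι ι ℝ} (hK : K.IsHermitian) (M : δ → Matrix ι ι ℝ) (hM : ∀ d, (M d).IsHermitian)
    (D : ι → δ)
    (h : ∀ φ : ι → ℝ, φ ⬝ᵥ K *ᵥ φ ≤ ∑ d, (fun i => if D i = d then φ i else 0) ⬝ᵥ
      M d *ᵥ (fun i => if D i = d then φ i else 0)) :
    (NormedSpace.exp K).trace ≤ ∑ d, (NormedSpace.exp (M d)).trace := by
  obtain ⟨V, e, hV, hVe⟩ := exists_orthogonal_diagonalization hK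
  have hV' : Vᵀ * V = 1 := mul_eq_one_comm.1 hV
  set P : δ → (ι → ℝ) → ι → ℝ := fun d φ i => if D i = d then φ i else 0 with hP
  have hrow : ∀ i, V i ⬝ᵥ V i = 1 := fun i => by
    simpa [Matrix.mul_apply, dotProduct] using congr_fun₂ hV i i
  have hei : ∀ i, e i = V i ⬝ᵥ K *ᵥ V i := fun i => by
    have h1 : V * K * Vᵀ = diagonal e := by
      rw [hVe]
      calc V * (Vᵀ * diagonal e * V) * Vᵀ = (V * Vᵀ) * diagonal e * (V * Vᵀ) := by
            simp only [Matrix.mul_assoc]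
        _ = diagonal e := by rw [hV]; simp
    have h2 := congr_fun₂ h1 i i
    rw [diagonal_apply_eq, Matrix.mul_apply] at h2
    rw [← h2, dotProduct_mulVec]
    simp [dotProduct, vecMul, Matrix.mul_apply]
  have hnorm : ∀ φ : ι → ℝ, ∑ d, P d φ ⬝ᵥ P d φ = φ ⬝ᵥ φ := fun φ => by
    simp only [dotProduct, hP]
    rw [Finset.sum_comm]
    refine Finset.sum_congr rfl fun i _ => ?_
    simp
  -- Jensen is applied to the whole family of projections of one eigenvector, whose squared norms
  -- add up to one.
  have key : ∀ i, Real.exp (e i) ≤ ∑ d, P d (V i) ⬝ᵥ NormedSpace.exp (M d) *ᵥ P d (V i) := by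
    intro i
    refine le_trans (Real.exp_le_exp.2 ((hei i).le.trans (h (V i)))) ?_
    exact exp_sum_quadraticForm_le M hM (fun d => P d (V i)) ((hnorm _).trans (hrow i))
  have htr : (NormedSpace.exp K).trace = ∑ i, Real.exp (e i) := by
    rw [hVe, exp_orthogonal_conj hV, trace_orthogonal_conj hV, trace_diagonal]
  rw [htr]
  refine (Finset.sum_le_sum fun i _ => key i).trans ?_
  rw [Finset.sum_comm]
  refine Finset.sum_le_sum fun d _ => ?_
  set E := NormedSpace.exp (M d)
  have hcol : ∀ j k, ∑ i, V i j * V i k = if j = k then 1 else 0 := fun j k => by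
    simpa [Matrix.mul_apply, Matrix.one_apply] using congr_fun₂ hV' j k
  calc ∑ i, P d (V i) ⬝ᵥ E *ᵥ P d (V i)
      = ∑ j, ∑ k, (if D j = d then if D k = d then E j k else 0 else 0) *
          ∑ i, V i j * V i k := by
        simp only [dotProduct, mulVec, hP, Finset.mul_sum]
        rw [Finset.sum_comm]
        refine Finset.sum_congr rfl fun j _ => ?_
        rw [Finset.sum_comm]
        refine Finset.sum_congr rfl fun k _ => Finset.sum_congr rfl fun i _ => ?_
        split_ifs <;> ring
    _ = ∑ j, if D j = d then E j j else 0 := by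
        refine Finset.sum_congr rfl fun j _ => ?_
        simp only [hcol, mul_ite, mul_one, mul_zero, Finset.sum_ite_eq, Finset.mem_univ, if_true]
        split_ifs <;> rfl
    -- The diagonal entries outside the block `{D = d}` are nonnegative, so they may be added.
    _ ≤ E.trace := by
        refine Finset.sum_le_sum fun j _ => ?_
        split_ifs
        · exact le_rfl
        · exact exp_isHermitian_diag_nonneg (hM d) j

end Trace

/-! ### The Hamming cube and the transversal field on a set of spins -/

section Cube

open Matrix

variable {N : ℕ}

theorem flipSpin_same (j : Fin N) (σ : HammingCube N) : flipSpin j σ j = -σ j := by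
  simp [flipSpin]

theorem flipSpin_of_ne {i j : Fin N} (h : i ≠ j) (σ : HammingCube N) : flipSpin j σ i = σ i := by
  simp [flipSpin, h]

theorem flipSpin_flipSpin (j : Fin N) (σ : HammingCube N) : flipSpin j (flipSpin j σ) = σ := by
  ext i
  by_cases h : i = j
  · subst h; simp [flipSpin_same]
  · simp [flipSpin_of_ne h]

theorem flipSpin_involutive (j : Fin N) : Function.Involutive (flipSpin j) := flipSpin_flipSpin j

theorem sum_flipSpin (j : Fin N) (f : HammingCube N → ℝ) :
    ∑ σ, f (flipSpin j σ) = ∑ σ, f σ :=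
  Equiv.sum_comp (flipSpin_involutive j).toPerm f

theorem pauliX_mulVec (j : Fin N) (φ : HammingCube N → ℝ) (σ : HammingCube N) :
    (pauliX j *ᵥ φ) σ = φ (flipSpin j σ) := by
  simp [pauliX, mulVec, dotProduct]

theorem pauliX_isHermitian (j : Fin N) : (pauliX j).IsHermitian := by
  ext σ τ
  simp only [pauliX, conjTranspose_apply, of_apply, star_trivial]
  refine if_congr ?_ rfl rfl
  constructor <;> rintro rfl <;> rw [flipSpin_flipSpin]

/-- The transversal field acting on the spins in `J` only. -/
noncomputable def fieldOn (J : Finset (Fin N)) (b : Fin N → ℝ) :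
    Matrix (HammingCube N) (HammingCube N) ℝ :=
  ∑ j ∈ J, b j • pauliX j

theorem fieldOn_mulVec (J : Finset (Fin N)) (b : Fin N → ℝ) (φ : HammingCube N → ℝ)
    (σ : HammingCube N) : (fieldOn J b *ᵥ φ) σ = ∑ j ∈ J, b j * φ (flipSpin j σ) := by
  simp [fieldOn, sum_mulVec, smul_mulVec, pauliX_mulVec, Finset.sum_apply]

theorem diagonal_add_fieldOn_isHermitian (v : HammingCube N → ℝ) (J : Finset (Fin N))
    (b : Fin N → ℝ) : (diagonal v + fieldOn J b).IsHermitian := by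
  refine (isHermitian_diagonal v).add ?_
  unfold fieldOn IsHermitian
  rw [conjTranspose_sum]
  refine Finset.sum_congr rfl fun j _ => ?_
  rw [conjTranspose_smul, (pauliX_isHermitian j).eq, star_trivial]

theorem quadraticForm_diagonal_add_fieldOn (v : HammingCube N → ℝ) (J : Finset (Fin N))
    (b : Fin N → ℝ) (φ : HammingCube N → ℝ) :
    φ ⬝ᵥ (diagonal v + fieldOn J b) *ᵥ φ =
      ∑ σ, v σ * φ σ ^ 2 + ∑ σ, ∑ j ∈ J, b j * (φ σ * φ (flipSpin j σ)) := by
  rw [add_mulVec, dotProduct_add]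
  simp only [dotProduct, mulVec_diagonal, fieldOn_mulVec, Finset.mul_sum]
  congr 1
  · exact Finset.sum_congr rfl fun σ _ => by ring
  · exact Finset.sum_congr rfl fun σ _ => Finset.sum_congr rfl fun j _ => by ring

/-! ### A basis of Walsh functions in the spins of a set -/

/-- The normalized character table of `ℤˣ`. -/
noncomputable def spinCharacter (s t : ℤˣ) : ℝ := if s = -1 ∧ t = -1 then -(√2)⁻¹ else (√2)⁻¹

theorem univ_intUnits : (Finset.univ : Finset ℤˣ) = {1, -1} := rfl

theorem one_ne_neg_one_intUnits : (1 : ℤˣ) ≠ -1 := by decide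

theorem hadamard_neg (s t : ℤˣ) : spinCharacter s (-t) = ((s : ℤ) : ℝ) * spinCharacter s t := by
  rcases Int.units_eq_one_or s with rfl | rfl <;> rcases Int.units_eq_one_or t with rfl | rfl <;>
    simp [spinCharacter]

theorem hadamard_sq (s t : ℤˣ) : spinCharacter s t ^ 2 = 1 / 2 := by
  unfold spinCharacter
  split_ifs <;> simp

theorem sum_hadamard_mul (s t : ℤˣ) :
    ∑ u, spinCharacter s u * spinCharacter t u = if s = t then 1 else 0 := by
  have h2 : (√2)⁻¹ * (√2)⁻¹ = (1 / 2 : ℝ) := by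
    rw [← mul_inv, Real.mul_self_sqrt (by norm_num)]; norm_num
  rw [univ_intUnits, Finset.sum_pair one_ne_neg_one_intUnits]
  rcases Int.units_eq_one_or s with rfl | rfl <;> rcases Int.units_eq_one_or t with rfl | rfl <;>
    simp [spinCharacter, one_ne_neg_one_intUnits.symm, h2] <;> norm_num

/-- The orthonormal basis, indexed by the cube itself, of products of Walsh functions of the spins
in `J` and indicators of the values of the other spins. -/
noncomputable def walsh (J : Finset (Fin N)) : Matrix (HammingCube N) (HammingCube N) ℝ :=
  of fun σ τ => ∏ j, if j ∈ J then spinCharacter (σ j) (τ j) else if σ j = τ j then 1 else 0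

theorem walsh_mul_transpose (J : Finset (Fin N)) : walsh J * (walsh J)ᵀ = 1 := by
  ext σ τ
  simp only [mul_apply, walsh, transpose_apply, of_apply, ← Finset.prod_mul_distrib]
  have h := (Finset.prod_univ_sum (fun _ : Fin N => (Finset.univ : Finset ℤˣ))
    (fun j u => (if j ∈ J then spinCharacter (σ j) u else if σ j = u then 1 else 0) *
      (if j ∈ J then spinCharacter (τ j) u else if τ j = u then (1 : ℝ) else 0))).symm
  rw [Fintype.piFinset_univ] at h
  rw [h]
  have h1 : ∀ j, ∑ u, ((if j ∈ J then spinCharacter (σ j) u else if σ j = u then 1 else 0) *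
      (if j ∈ J then spinCharacter (τ j) u else if τ j = u then (1 : ℝ) else 0))
      = if σ j = τ j then 1 else 0 := by
    intro j
    by_cases hj : j ∈ J
    · simpa [hj] using sum_hadamard_mul (σ j) (τ j)
    · simp only [hj, if_false, ite_mul, one_mul, zero_mul, Finset.sum_ite_eq, Finset.mem_univ,
        if_true]
      exact if_congr eq_comm rfl rfl
  simp only [h1, one_apply, Finset.prod_ite_zero, Finset.prod_const_one, funext_iff,
    Finset.mem_univ, true_implies]

/-- Each row is an eigenvector of the flips in `J`; the label `σ j` is the eigenvalue. -/
theorem walsh_flipSpin_of_mem {J : Finset (Fin N)} {j : Fin N} (hj : j ∈ J)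
    (σ τ : HammingCube N) : walsh J σ (flipSpin j τ) = ((σ j : ℤ) : ℝ) * walsh J σ τ := by
  simp only [walsh, of_apply]
  rw [← Finset.mul_prod_erase _ _ (Finset.mem_univ j), ← Finset.mul_prod_erase _ _
    (Finset.mem_univ j), ← mul_assoc]
  congr 1
  · simp [hj, flipSpin_same, hadamard_neg]
  · refine Finset.prod_congr rfl fun i hi => ?_
    rw [flipSpin_of_ne (Finset.ne_of_mem_erase hi)]

/-- Each row is supported on fixed values of the spins outside `J`, so flipping one of them gives a
disjoint support. Such flips therefore have zero expectation in the Peierls inequality. -/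
theorem walsh_mul_flipSpin_of_notMem {J : Finset (Fin N)} {j : Fin N} (hj : j ∉ J)
    (σ τ : HammingCube N) : walsh J σ τ * walsh J σ (flipSpin j τ) = 0 := by
  by_cases h : σ j = τ j
  · have : walsh J σ (flipSpin j τ) = 0 := by
      refine Finset.prod_eq_zero (Finset.mem_univ j) ?_
      rw [if_neg hj, if_neg]
      rw [flipSpin_same, h]
      exact units_ne_neg_self _
    rw [this, mul_zero]
  · have : walsh J σ τ = 0 := by
      refine Finset.prod_eq_zero (Finset.mem_univ j) ?_
      rw [if_neg hj, if_neg h]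
    rw [this, zero_mul]

/-- The squares of a row form the uniform distribution on the configurations agreeing with `σ`
outside `J`; this is why a potential has expectation `spinAverage`. -/
theorem walsh_sq (J : Finset (Fin N)) (σ τ : HammingCube N) :
    walsh J σ τ ^ 2 = if ∀ j ∉ J, σ j = τ j then ((2 : ℝ) ^ J.card)⁻¹ else 0 := by
  simp only [walsh, of_apply, ← Finset.prod_pow]
  split_ifs with h
  · have : ∀ j, (if j ∈ J then spinCharacter (σ j) (τ j) else if σ j = τ j then 1 else 0) ^ 2
        = if j ∈ J then (1 / 2 : ℝ) else 1 := by
      intro j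
      by_cases hj : j ∈ J
      · simp only [hj, if_true, hadamard_sq]
      · simp [hj, h j hj]
    simp [this]
  · push Not at h
    obtain ⟨j, hj, hne⟩ := h
    exact Finset.prod_eq_zero (Finset.mem_univ j) (by simp [hj, hne])

/-- The average of `f` over the spins in `J`. -/
noncomputable def spinAverage (J : Finset (Fin N)) (f : HammingCube N → ℝ) (σ : HammingCube N) :
    ℝ :=
  ((2 : ℝ) ^ J.card)⁻¹ * ∑ τ, if ∀ j ∉ J, σ j = τ j then f τ else 0

theorem agree_flipSpin {J : Finset (Fin N)} {j : Fin N} (hj : j ∈ J) (σ : HammingCube N) :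
    ∀ i ∉ J, σ i = flipSpin j σ i := fun i hi => by
  rw [flipSpin_of_ne]
  rintro rfl
  exact hi hj

theorem spinAverage_congr {J : Finset (Fin N)} (f : HammingCube N → ℝ) {σ τ : HammingCube N}
    (h : ∀ j ∉ J, σ j = τ j) : spinAverage J f σ = spinAverage J f τ := by
  unfold spinAverage
  congr 1
  refine Finset.sum_congr rfl fun ρ _ => if_congr ?_ rfl rfl
  exact forall₂_congr fun j hj => by rw [h j hj]

/-- Averaging over `σ` and `flipSpin j σ` leaves `f` unchanged and turns the exponential of spin `j`
into a hyperbolic cosine, one spin at a time. -/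
theorem sum_mul_exp_spin {J : Finset (Fin N)} (f : HammingCube N → ℝ) (b : Fin N → ℝ)
    (hf : ∀ j ∈ J, ∀ σ, f (flipSpin j σ) = f σ) :
    ∑ σ, f σ * Real.exp (∑ j ∈ J, b j * ((σ j : ℤ) : ℝ)) =
      (∏ j ∈ J, Real.cosh (b j)) * ∑ σ, f σ := by
  induction J using Finset.induction_on generalizing f with
  | empty => simp
  | insert j J hj ih =>
    rw [Finset.prod_insert hj]
    have hcosh : ∀ σ : HammingCube N, Real.exp (b j * ((σ j : ℤ) : ℝ)) +
        Real.exp (b j * ((flipSpin j σ j : ℤ) : ℝ)) = 2 * Real.cosh (b j) := fun σ => by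
      rw [flipSpin_same, Real.cosh_eq]
      rcases Int.units_eq_one_or (σ j) with h | h <;> simp [h] <;> ring
    have key : ∑ σ, f σ * Real.exp (∑ i ∈ insert j J, b i * ((σ i : ℤ) : ℝ)) =
        ∑ σ, (Real.cosh (b j) * f σ) * Real.exp (∑ i ∈ J, b i * ((σ i : ℤ) : ℝ)) := by
      set S := ∑ σ, f σ * Real.exp (∑ i ∈ insert j J, b i * ((σ i : ℤ) : ℝ)) with hS
      have hS' : S = ∑ σ, f σ * (Real.exp (b j * ((flipSpin j σ j : ℤ) : ℝ)) *
          Real.exp (∑ i ∈ J, b i * ((σ i : ℤ) : ℝ))) := by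
        rw [hS, ← sum_flipSpin j]
        refine Finset.sum_congr rfl fun σ _ => ?_
        rw [hf j (Finset.mem_insert_self _ _), Finset.sum_insert hj, Real.exp_add]
        congr 3
        refine Finset.sum_congr rfl fun i hi => ?_
        rw [flipSpin_of_ne]
        rintro rfl
        exact hj hi
      have hS'' : S = ∑ σ, f σ * (Real.exp (b j * ((σ j : ℤ) : ℝ)) *
          Real.exp (∑ i ∈ J, b i * ((σ i : ℤ) : ℝ))) := by
        rw [hS]
        refine Finset.sum_congr rfl fun σ _ => ?_
        rw [Finset.sum_insert hj, Real.exp_add]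
      have h2 : S + S = 2 * ∑ σ, (Real.cosh (b j) * f σ) *
          Real.exp (∑ i ∈ J, b i * ((σ i : ℤ) : ℝ)) := by
        nth_rewrite 1 [hS'']
        rw [hS', ← Finset.sum_add_distrib, Finset.mul_sum]
        refine Finset.sum_congr rfl fun σ _ => ?_
        linear_combination (f σ * Real.exp (∑ i ∈ J, b i * ((σ i : ℤ) : ℝ))) * hcosh σ
      linarith
    rw [key, ih _ fun i hi σ => by rw [hf i (Finset.mem_insert_of_mem hi)], ← Finset.mul_sum]
    ring

/-- The partition function of a potential which does not depend on the spins in `J`, in a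
transversal field which acts on the spins in `J`. -/
theorem trace_exp_diagonal_add_fieldOn {J : Finset (Fin N)} (v : HammingCube N → ℝ)
    (b : Fin N → ℝ) (hv : ∀ σ τ, (∀ j ∉ J, σ j = τ j) → v σ = v τ) :
    (NormedSpace.exp (diagonal v + fieldOn J b)).trace =
      (∏ j ∈ J, Real.cosh (b j)) * ∑ σ, Real.exp (v σ) := by
  set R := walsh J with hR
  have hRR : R * Rᵀ = 1 := walsh_mul_transpose J
  have hRR' : Rᵀ * R = 1 := mul_eq_one_comm.1 hRR
  set e : HammingCube N → ℝ := fun σ => v σ + ∑ j ∈ J, b j * ((σ j : ℤ) : ℝ) with he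
  have hRv : ∀ σ τ, R σ τ * v τ = v σ * R σ τ := by
    intro σ τ
    by_cases h : ∀ j ∉ J, σ j = τ j
    · rw [hv σ τ h, mul_comm]
    · have : R σ τ ^ 2 = 0 := by rw [hR, walsh_sq, if_neg h]
      rw [pow_eq_zero_iff two_ne_zero] at this
      simp [this]
  -- The Walsh functions diagonalize both terms: `v` is constant on the support of each row, and the
  -- row is a character in the spins of `J`.
  have hcomm : (diagonal v + fieldOn J b) * Rᵀ = Rᵀ * diagonal e := by
    ext τ σ
    have h1 : ((diagonal v + fieldOn J b) * Rᵀ) τ σ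
        = ((diagonal v + fieldOn J b) *ᵥ (R σ)) τ := rfl
    rw [h1, add_mulVec, Pi.add_apply, mulVec_diagonal, fieldOn_mulVec, mul_diagonal,
      transpose_apply, he, mul_add, Finset.mul_sum, mul_comm (v τ), hRv, mul_comm (v σ)]
    congr 1
    refine Finset.sum_congr rfl fun j hj => ?_
    rw [hR, walsh_flipSpin_of_mem hj]
    ring
  have hK : diagonal v + fieldOn J b = Rᵀ * diagonal e * R := by
    rw [← hcomm, Matrix.mul_assoc, hRR', Matrix.mul_one]
  rw [hK, exp_orthogonal_conj hRR, trace_orthogonal_conj hRR, trace_diagonal]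
  simp only [he, Real.exp_add]
  exact sum_mul_exp_spin (fun σ => Real.exp (v σ)) b fun j hj σ => by
    rw [hv (flipSpin j σ) σ fun i hi => (agree_flipSpin hj σ i hi).symm]

/-- A variational lower bound on the partition function: the spins outside `J` are frozen and the
potential is averaged over the spins in `J`. -/
theorem prod_cosh_mul_sum_exp_spinAverage_le_trace_exp (J : Finset (Fin N))
    (U : HammingCube N → ℝ) (b : Fin N → ℝ) :
    (∏ j ∈ J, Real.cosh (b j)) * ∑ σ, Real.exp (spinAverage J U σ) ≤
      (NormedSpace.exp (diagonal U + fieldOn Finset.univ b)).trace := by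
  have h := sum_exp_le_trace_exp (diagonal_add_fieldOn_isHermitian U Finset.univ b)
    (walsh_mul_transpose J)
  refine le_trans (le_of_eq ?_) h
  rw [← sum_mul_exp_spin (fun σ => Real.exp (spinAverage J U σ)) b fun j hj σ => by
    rw [spinAverage_congr U fun i hi => (agree_flipSpin hj σ i hi).symm]]
  refine Finset.sum_congr rfl fun σ _ => ?_
  rw [← Real.exp_add, quadraticForm_diagonal_add_fieldOn]
  congr 2
  · simp only [walsh_sq, spinAverage, Finset.mul_sum]
    refine Finset.sum_congr rfl fun τ _ => ?_
    split_ifs <;> ring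
  · have hnorm : ∑ τ, walsh J σ τ ^ 2 = 1 := by
      simpa [Matrix.mul_apply, sq] using congr_fun₂ (walsh_mul_transpose J) σ σ
    rw [Finset.sum_comm, ← Finset.sum_subset (Finset.subset_univ J)]
    · refine Finset.sum_congr rfl fun j hj => ?_
      simp only [walsh_flipSpin_of_mem hj]
      rw [← mul_one (b j * _), ← hnorm, Finset.mul_sum]
      exact Finset.sum_congr rfl fun τ _ => by ring
    · intro j _ hj
      exact Finset.sum_eq_zero fun τ _ => by rw [walsh_mul_flipSpin_of_notMem hj, mul_zero]

/-- The number of configurations which agree with `σ` on the spins outside `J`. -/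
theorem card_agree (J : Finset (Fin N)) (σ : HammingCube N) :
    (Finset.univ.filter fun τ : HammingCube N => ∀ j ∉ J, σ j = τ j).card = 2 ^ J.card := by
  have : (Finset.univ.filter fun τ : HammingCube N => ∀ j ∉ J, σ j = τ j) =
      Fintype.piFinset fun j => if j ∈ J then Finset.univ else {σ j} := by
    ext τ
    simp only [Finset.mem_filter, Finset.mem_univ, true_and, Fintype.mem_piFinset]
    refine forall_congr' fun j => ?_
    by_cases hj : j ∈ J
    · simp only [hj, not_true_eq_false, false_implies, if_true, Finset.mem_univ]
    · simp [hj, eq_comm]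
  rw [this, Fintype.card_piFinset]
  have h : ∀ j, (if j ∈ J then Finset.univ else {σ j} : Finset ℤˣ).card = if j ∈ J then 2 else 1 :=
    fun j => by by_cases hj : j ∈ J <;> simp [hj]
  rw [Finset.prod_congr rfl fun j _ => h j, Finset.prod_ite_mem, Finset.univ_inter,
    Finset.prod_const]

end Cube

/-! ### Removing the field at rare configurations -/

section Kinetic

open Matrix

variable {N n : ℕ}

/-- The spins with index at least `p`. -/
def sitesFrom (N p : ℕ) : Finset (Fin N) := Finset.univ.filter fun j => p ≤ (j : ℕ)

theorem mem_sitesFrom {p : ℕ} {j : Fin N} : j ∈ sitesFrom N p ↔ p ≤ (j : ℕ) := by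
  simp [sitesFrom]

theorem notMem_sitesFrom {p : ℕ} {j : Fin N} : j ∉ sitesFrom N p ↔ (j : ℕ) < p := by
  simp [sitesFrom]

open Classical in
/-- The last level at which `σ` is exceptional, and `0` if there is none. -/
noncomputable def lastLevel (E : Fin n → HammingCube N → Prop) (σ : HammingCube N) : Fin (n + 1) :=
  Finset.univ.sup fun k => if E k σ then k.succ else 0

theorem le_lastLevel {E : Fin n → HammingCube N → Prop} {σ : HammingCube N} {k : Fin n}
    (h : E k σ) : k.succ ≤ lastLevel E σ := by
  classical
  have := Finset.le_sup (f := fun k => if E k σ then k.succ else 0) (Finset.mem_univ k)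
  simpa [h, lastLevel] using this

theorem lastLevel_spec (E : Fin n → HammingCube N → Prop) (σ : HammingCube N) :
    lastLevel E σ = 0 ∨ ∃ k : Fin n, lastLevel E σ = k.succ ∧ E k σ := by
  classical
  rcases Finset.eq_empty_or_nonempty (Finset.univ : Finset (Fin n)) with h | h
  · left; simp only [lastLevel, h, Finset.sup_empty]; rfl
  · obtain ⟨k, -, hk⟩ := Finset.exists_mem_eq_sup Finset.univ h
      (fun k => if E k σ then k.succ else 0)
    by_cases hE : E k σ
    · right; exact ⟨k, by simpa [hE, lastLevel] using hk, hE⟩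
    · left; simpa [hE, lastLevel] using hk

variable {E : Fin n → HammingCube N → Prop} {p : Fin (n + 1) → ℕ}

/-- If spin `j` lies behind the exceptional prefixes of both ends of the flip, then each end
inherits the last exceptional level of the other, so the two last levels agree. Hence every removed
flip touches an exceptional prefix at one of its ends. -/
theorem exists_exceptional_of_lastLevel_ne (hp0 : p 0 = 0)
    (hE : ∀ k σ τ, (∀ j : Fin N, (j : ℕ) < p k.succ → σ j = τ j) → E k σ → E k τ)
    (σ : HammingCube N) (j : Fin N)
    (h : ¬ (lastLevel E σ = lastLevel E (flipSpin j σ) ∧ p (lastLevel E σ) ≤ (j : ℕ))) :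
    ∃ k : Fin n, (j : ℕ) < p k.succ ∧ (E k σ ∨ E k (flipSpin j σ)) := by
  have aux : ∀ ρ : HammingCube N, (j : ℕ) < p (lastLevel E ρ) →
      ∃ k : Fin n, (j : ℕ) < p k.succ ∧ E k ρ := by
    intro ρ hρ
    rcases lastLevel_spec E ρ with h0 | ⟨k, hk, hEk⟩
    · rw [h0, hp0] at hρ; omega
    · exact ⟨k, hk ▸ hρ, hEk⟩
  have aux2 : ∀ ρ : HammingCube N, p (lastLevel E ρ) ≤ (j : ℕ) →
      lastLevel E ρ ≤ lastLevel E (flipSpin j ρ) := by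
    intro ρ hρ
    rcases lastLevel_spec E ρ with h0 | ⟨k, hk, hEk⟩
    · rw [h0]; exact Fin.zero_le _
    · rw [hk]
      refine le_lastLevel (hE k ρ _ (fun i hi => ?_) hEk)
      rw [flipSpin_of_ne]
      rintro rfl
      rw [hk] at hρ
      omega
  by_cases h1 : (j : ℕ) < p (lastLevel E σ)
  · obtain ⟨k, hk, hEk⟩ := aux σ h1
    exact ⟨k, hk, Or.inl hEk⟩
  by_cases h2 : (j : ℕ) < p (lastLevel E (flipSpin j σ))
  · obtain ⟨k, hk, hEk⟩ := aux _ h2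
    exact ⟨k, hk, Or.inr hEk⟩
  refine absurd ⟨le_antisymm (aux2 σ (not_lt.1 h1)) ?_, not_lt.1 h1⟩ h
  simpa [flipSpin_flipSpin] using aux2 (flipSpin j σ) (not_lt.1 h2)

open Classical in
/-- At the cost of a small multiple of the identity, the field may be restricted to spin flips
which do not touch the blocks up to the last exceptional level. -/
theorem kinetic_le (hp0 : p 0 = 0)
    (hE : ∀ k σ τ, (∀ j : Fin N, (j : ℕ) < p k.succ → σ j = τ j) → E k σ → E k τ)
    {r : ℕ} (hr : ∀ k σ, (Finset.univ.filter fun j : Fin N =>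
      (j : ℕ) < p k.succ ∧ E k (flipSpin j σ)).card ≤ r)
    (b : Fin N → ℝ) {B : ℝ} (hB0 : 0 ≤ B) (hB : ∀ j, |b j| ≤ B) {η : ℝ} (hη : 0 < η) (φ : HammingCube N → ℝ) :
    ∑ σ, ∑ j, b j * (φ σ * φ (flipSpin j σ)) ≤
      ∑ d : Fin (n + 1), ∑ σ, ∑ j ∈ sitesFrom N (p d),
        b j * ((if lastLevel E σ = d then φ σ else 0) *
          (if lastLevel E (flipSpin j σ) = d then φ (flipSpin j σ) else 0)) +
      n * (η * ∑ j, |b j| + r * B / η) * ∑ σ, φ σ ^ 2 := by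
  set g : Fin n → Fin N → HammingCube N → ℝ := fun k j σ =>
    if (j : ℕ) < p k.succ ∧ E k σ then 1 else 0 with hg
  have hg0 : ∀ k j σ, 0 ≤ g k j σ := fun k j σ => by simp only [hg]; split_ifs <;> norm_num
  have hg1 : ∀ k j σ, g k j σ ≤ 1 := fun k j σ => by simp only [hg]; split_ifs <;> norm_num
  have restricted_eq : ∑ d : Fin (n + 1), ∑ σ, ∑ j ∈ sitesFrom N (p d),
        b j * ((if lastLevel E σ = d then φ σ else 0) *
          (if lastLevel E (flipSpin j σ) = d then φ (flipSpin j σ) else 0)) =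
      ∑ σ, ∑ j, if lastLevel E σ = lastLevel E (flipSpin j σ) ∧ p (lastLevel E σ) ≤ (j : ℕ)
        then b j * (φ σ * φ (flipSpin j σ)) else 0 := by
    rw [Finset.sum_comm]
    refine Finset.sum_congr rfl fun σ _ => ?_
    simp only [sitesFrom, Finset.sum_filter]
    rw [Finset.sum_comm]
    refine Finset.sum_congr rfl fun j _ => ?_
    rw [Finset.sum_eq_single (lastLevel E σ)]
    · simp only [if_true]
      by_cases h1 : p (lastLevel E σ) ≤ (j : ℕ) <;>
        by_cases h2 : lastLevel E σ = lastLevel E (flipSpin j σ) <;>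
        simp [h1, h2, eq_comm]
    · intro d _ hd
      simp [Ne.symm hd]
    · simp
  have split_le : ∑ σ, ∑ j, b j * (φ σ * φ (flipSpin j σ)) ≤
      ∑ σ, ∑ j, (if lastLevel E σ = lastLevel E (flipSpin j σ) ∧ p (lastLevel E σ) ≤ (j : ℕ)
        then b j * (φ σ * φ (flipSpin j σ)) else 0) +
      ∑ σ, ∑ j, ∑ k, |b j| * (|φ σ| * |φ (flipSpin j σ)|) * (g k j σ + g k j (flipSpin j σ)) := by
    rw [← Finset.sum_add_distrib]
    refine Finset.sum_le_sum fun σ _ => ?_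
    rw [← Finset.sum_add_distrib]
    refine Finset.sum_le_sum fun j _ => ?_
    have hpos : ∀ k, 0 ≤ |b j| * (|φ σ| * |φ (flipSpin j σ)|) *
        (g k j σ + g k j (flipSpin j σ)) := fun k =>
      mul_nonneg (by positivity) (add_nonneg (hg0 _ _ _) (hg0 _ _ _))
    split_ifs with h
    · linarith [Finset.sum_nonneg fun k (_ : k ∈ Finset.univ) => hpos k]
    · obtain ⟨k, hk, hEk⟩ := exists_exceptional_of_lastLevel_ne hp0 hE σ j h
      have h1 : (1 : ℝ) ≤ g k j σ + g k j (flipSpin j σ) := by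
        rcases hEk with h' | h'
        · have : g k j σ = 1 := by simp [hg, hk, h']
          linarith [hg0 k j (flipSpin j σ)]
        · have : g k j (flipSpin j σ) = 1 := by simp [hg, hk, h']
          linarith [hg0 k j σ]
      rw [zero_add]
      refine le_trans ?_ (Finset.single_le_sum (fun k _ => hpos k) (Finset.mem_univ k))
      calc b j * (φ σ * φ (flipSpin j σ)) ≤ |b j * (φ σ * φ (flipSpin j σ))| := le_abs_self _
        _ = |b j| * (|φ σ| * |φ (flipSpin j σ)|) := by rw [abs_mul, abs_mul]
        _ ≤ _ := le_mul_of_one_le_right (by positivity) h1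
  -- The flip exchanges the two ends of each edge, so it suffices to treat edges whose flipped end
  -- is exceptional.
  have exceptional_flip : ∀ k, ∑ σ, ∑ j, |b j| * (|φ σ| * |φ (flipSpin j σ)|) * g k j σ =
      ∑ σ, ∑ j, |b j| * (|φ σ| * |φ (flipSpin j σ)|) * g k j (flipSpin j σ) := by
    intro k
    rw [Finset.sum_comm, Finset.sum_comm (γ := HammingCube N)]
    refine Finset.sum_congr rfl fun j _ => ?_
    rw [← sum_flipSpin j]
    refine Finset.sum_congr rfl fun σ _ => ?_
    rw [flipSpin_flipSpin, mul_comm |φ σ|]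
  have exceptional_le : ∀ k, ∑ σ, ∑ j, |b j| * (|φ σ| * |φ (flipSpin j σ)|) *
      (g k j σ + g k j (flipSpin j σ)) ≤ (η * ∑ j, |b j| + r * B / η) * ∑ σ, φ σ ^ 2 := by
    intro k
    have e1 : ∑ σ, ∑ j, |b j| * (|φ σ| * |φ (flipSpin j σ)|) *
        (g k j σ + g k j (flipSpin j σ)) =
        ∑ σ, ∑ j, |b j| * (2 * |φ σ| * |φ (flipSpin j σ)|) * g k j (flipSpin j σ) := by
      simp only [mul_add, Finset.sum_add_distrib]
      rw [exceptional_flip k, ← Finset.sum_add_distrib]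
      refine Finset.sum_congr rfl fun σ _ => ?_
      rw [← Finset.sum_add_distrib]
      exact Finset.sum_congr rfl fun j _ => by ring
    -- The weight `η` goes to the flipped end, where the sum over all `j` gives `η ∑ |b j|`; the
    -- large weight `1 / η` goes to the end `σ`, which has at most `r` exceptional neighbours.
    have e2 : ∀ σ, ∀ j, |b j| * (2 * |φ σ| * |φ (flipSpin j σ)|) * g k j (flipSpin j σ) ≤
        η * |b j| * φ (flipSpin j σ) ^ 2 + φ σ ^ 2 * (B / η) * g k j (flipSpin j σ) := by
      intro σ j
      have am : 2 * |φ σ| * |φ (flipSpin j σ)| ≤ η * φ (flipSpin j σ) ^ 2 + φ σ ^ 2 / η := by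
        rw [← sq_abs (φ σ), ← sq_abs (φ (flipSpin j σ)), ← sub_nonneg]
        have : η * |φ (flipSpin j σ)| ^ 2 + |φ σ| ^ 2 / η - 2 * |φ σ| * |φ (flipSpin j σ)| =
            (η * |φ (flipSpin j σ)| - |φ σ|) ^ 2 / η := by field_simp; ring
        rw [this]; positivity
      calc |b j| * (2 * |φ σ| * |φ (flipSpin j σ)|) * g k j (flipSpin j σ)
          ≤ |b j| * (η * φ (flipSpin j σ) ^ 2 + φ σ ^ 2 / η) * g k j (flipSpin j σ) := by
            gcongr
        _ = η * |b j| * φ (flipSpin j σ) ^ 2 * g k j (flipSpin j σ) +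
            φ σ ^ 2 * (|b j| / η) * g k j (flipSpin j σ) := by ring
        _ ≤ _ := by
            refine add_le_add (mul_le_of_le_one_right (by positivity) (hg1 _ _ _)) ?_
            gcongr
            exact hB j
    have e3 : ∑ σ, ∑ j, η * |b j| * φ (flipSpin j σ) ^ 2 = (η * ∑ j, |b j|) * ∑ σ, φ σ ^ 2 := by
      rw [Finset.sum_comm, Finset.mul_sum (f := fun j => |b j|), Finset.sum_mul]
      refine Finset.sum_congr rfl fun j _ => ?_
      rw [← Finset.mul_sum, sum_flipSpin j fun σ => φ σ ^ 2]
    have e4 : ∑ σ, ∑ j, φ σ ^ 2 * (B / η) * g k j (flipSpin j σ) ≤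
        (r * B / η) * ∑ σ, φ σ ^ 2 := by
      rw [Finset.mul_sum]
      refine Finset.sum_le_sum fun σ _ => ?_
      rw [← Finset.mul_sum]
      have hs : ∑ j, g k j (flipSpin j σ) ≤ r := by
        simp only [hg]
        rw [← Finset.sum_filter, Finset.sum_const, nsmul_eq_mul, mul_one]
        exact_mod_cast hr k σ
      calc φ σ ^ 2 * (B / η) * ∑ j, g k j (flipSpin j σ) ≤ φ σ ^ 2 * (B / η) * r := by gcongr
        _ = _ := by ring
    rw [e1]
    refine (Finset.sum_le_sum fun σ _ => Finset.sum_le_sum fun j _ => e2 σ j).trans ?_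
    simp only [Finset.sum_add_distrib]
    rw [e3, add_mul]
    exact add_le_add le_rfl e4
  rw [restricted_eq]
  refine split_le.trans (add_le_add le_rfl ?_)
  have : ∑ σ, ∑ j, ∑ k, |b j| * (|φ σ| * |φ (flipSpin j σ)|) *
      (g k j σ + g k j (flipSpin j σ)) = ∑ k, ∑ σ, ∑ j, |b j| * (|φ σ| * |φ (flipSpin j σ)|) *
      (g k j σ + g k j (flipSpin j σ)) := by
    rw [Finset.sum_comm (γ := Fin n)]
    refine Finset.sum_congr rfl fun σ _ => ?_
    rw [Finset.sum_comm]
  rw [this]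
  refine (Finset.sum_le_sum fun k _ => exceptional_le k).trans_eq ?_
  simp [mul_assoc]

/-- Upper bound on the partition function in terms of the partial sums of the potential, in a field
which acts on the spins of the remaining blocks. -/
theorem trace_exp_le_sum_prod_cosh (hp0 : p 0 = 0)
    (hE : ∀ k σ τ, (∀ j : Fin N, (j : ℕ) < p k.succ → σ j = τ j) → E k σ → E k τ)
    {r : ℕ} (hr : ∀ k σ, (Set.ncard {j : Fin N | (j : ℕ) < p k.succ ∧ E k (flipSpin j σ)}) ≤ r)
    (b : Fin N → ℝ) {B : ℝ} (hB0 : 0 ≤ B) (hB : ∀ j, |b j| ≤ B) {η : ℝ} (hη : 0 < η)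
    (v : HammingCube N → ℝ) (w : Fin (n + 1) → HammingCube N → ℝ) {c : ℝ}
    (hw : ∀ d σ τ, (∀ j : Fin N, (j : ℕ) < p d → σ j = τ j) → w d σ = w d τ)
    (hvw : ∀ d σ, (∀ k : Fin n, d ≤ k.castSucc → ¬ E k σ) → v σ ≤ w d σ + c) :
    (NormedSpace.exp (diagonal v + fieldOn Finset.univ b)).trace ≤
      Real.exp (c + n * (η * ∑ j, |b j| + r * B / η)) *
        ∑ d, (∏ j ∈ sitesFrom N (p d), Real.cosh (b j)) * ∑ σ, Real.exp (w d σ) := by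
  classical
  set C := n * (η * ∑ j, |b j| + r * B / η) with hC
  have hr' : ∀ k σ, (Finset.univ.filter fun j : Fin N =>
      (j : ℕ) < p k.succ ∧ E k (flipSpin j σ)).card ≤ r := fun k σ => by
    rw [← Set.ncard_coe_finset]
    simpa using hr k σ
  have h := trace_exp_le_sum_of_quadraticForm_le
    (diagonal_add_fieldOn_isHermitian v Finset.univ b)
    (fun d => diagonal (fun σ => w d σ + (c + C)) + fieldOn (sitesFrom N (p d)) b)
    (fun d => diagonal_add_fieldOn_isHermitian _ _ _) (lastLevel E) ?_
  · refine h.trans_eq ?_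
    rw [Finset.mul_sum]
    refine Finset.sum_congr rfl fun d _ => ?_
    rw [trace_exp_diagonal_add_fieldOn _ _ fun σ τ hστ => by
      rw [hw d σ τ fun j hj => hστ j (notMem_sitesFrom.2 hj)]]
    simp only [Real.exp_add, ← Finset.sum_mul]
    ring
  · intro φ
    simp only [quadraticForm_diagonal_add_fieldOn, Finset.sum_add_distrib]
    have h1 := kinetic_le hp0 hE hr' b hB0 hB hη φ
    have h2 : ∑ σ, v σ * φ σ ^ 2 + C * ∑ σ, φ σ ^ 2 ≤
        ∑ d, ∑ σ, (w d σ + (c + C)) * (if lastLevel E σ = d then φ σ else 0) ^ 2 := by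
      rw [Finset.sum_comm, Finset.mul_sum, ← Finset.sum_add_distrib]
      refine Finset.sum_le_sum fun σ _ => ?_
      simp only [ite_pow, mul_ite, ne_eq, OfNat.ofNat_ne_zero, not_false_eq_true, zero_pow,
        mul_zero, Finset.sum_ite_eq, Finset.mem_univ, if_true]
      -- No level beyond the last exceptional one is exceptional, so the comparison of `v` with `w
      -- d` is available exactly for `d = lastLevel E σ`.
      have h3 := hvw (lastLevel E σ) σ fun k hk hEk =>
        absurd (hk.trans_lt k.castSucc_lt_succ) (not_lt.2 (le_lastLevel hEk))
      nlinarith [mul_le_mul_of_nonneg_right h3 (sq_nonneg (φ σ))]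
    linarith

end Kinetic

/-! ### The concave hull of a step function -/

theorem convexComb_lt {s t a b c : ℝ} (hs : 0 < s) (ht : 0 < t) (hst : s + t = 1) (ha : a < c)
    (hb : b ≤ c) : s * a + t * b < c := by
  calc s * a + t * b < s * c + t * c :=
        add_lt_add_of_lt_of_le (mul_lt_mul_of_pos_left ha hs) (mul_le_mul_of_nonneg_left hb ht.le)
    _ = c := by rw [← add_mul, hst, one_mul]

namespace GREM

variable (G : GREM)

/-- The first `d` levels. -/
def levels (d : Fin (G.n + 1)) : Finset (Fin G.n) := Finset.univ.filter fun k => k.castSucc < d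

variable {G}

theorem mem_levels {d : Fin (G.n + 1)} {k : Fin G.n} : k ∈ G.levels d ↔ k.castSucc < d := by
  simp [levels]

theorem mem_levels_iff_succ_le {d : Fin (G.n + 1)} {k : Fin G.n} :
    k ∈ G.levels d ↔ k.succ ≤ d := by
  rw [mem_levels, Fin.castSucc_lt_iff_succ_le]

theorem levels_zero : G.levels 0 = ∅ := by
  ext k; simp [mem_levels]

theorem levels_succ (k : Fin G.n) : G.levels k.succ = insert k (G.levels k.castSucc) := by
  ext i
  simp only [mem_levels, Finset.mem_insert, Fin.lt_def, Fin.ext_iff, Fin.val_castSucc, Fin.val_succ]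
  omega

theorem notMem_levels_castSucc (k : Fin G.n) : k ∉ G.levels k.castSucc := by
  simp [mem_levels]

theorem sum_levels_succ (k : Fin G.n) (f : Fin G.n → ℝ) :
    ∑ i ∈ G.levels k.succ, f i = f k + ∑ i ∈ G.levels k.castSucc, f i := by
  rw [levels_succ, Finset.sum_insert (notMem_levels_castSucc k)]

theorem levels_last : G.levels (Fin.last G.n) = Finset.univ := by
  ext k; simp [mem_levels, Fin.castSucc_lt_last]

variable (G)

theorem x_castSucc_lt_succ (k : Fin G.n) : G.x k.castSucc < G.x k.succ :=
  G.x_strictMono k.castSucc_lt_succ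

theorem x_mem_Icc (d : Fin (G.n + 1)) : G.x d ∈ Set.Icc (0 : ℝ) 1 :=
  ⟨G.x_zero ▸ G.x_strictMono.monotone (Fin.zero_le d),
    G.x_last ▸ G.x_strictMono.monotone (Fin.le_last d)⟩

theorem A_x (d : Fin (G.n + 1)) : G.A (G.x d) = ∑ k ∈ G.levels d, G.a k := by
  rw [A, levels, Finset.sum_filter]
  refine Finset.sum_congr rfl fun k _ => if_congr ?_ rfl rfl
  rw [G.x_strictMono.le_iff_le, Fin.castSucc_lt_iff_succ_le]

theorem A_mono : Monotone G.A := fun s t hst => by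
  refine Finset.sum_le_sum fun k _ => ?_
  have := (G.a_pos k).le
  split_ifs with h1 h2
  · exact le_rfl
  · exact absurd (h1.trans hst) h2
  · exact this
  · exact le_rfl

theorem A_one : G.A 1 = 1 := by
  have h := G.A_x (Fin.last G.n)
  rwa [G.x_last, levels_last, G.sum_a] at h

theorem A_zero : G.A 0 = 0 := by
  have h := G.A_x 0
  rwa [G.x_zero, levels_zero, Finset.sum_empty] at h

theorem A_x_strictMono : StrictMono fun d => G.A (G.x d) := by
  rw [Fin.strictMono_iff_lt_succ]
  intro k
  simp only [A_x, sum_levels_succ]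
  linarith [G.a_pos k]

theorem exists_A_eq {t : ℝ} (ht : 0 ≤ t) : ∃ d, G.x d ≤ t ∧ G.A t = G.A (G.x d) := by
  obtain ⟨d, hd, hmax⟩ := (Finset.univ.filter fun d => G.x d ≤ t).exists_max_image id
    ⟨0, by simpa [G.x_zero] using ht⟩
  simp only [Finset.mem_filter, Finset.mem_univ, true_and, id] at hd hmax
  refine ⟨d, hd, Finset.sum_congr rfl fun k _ => if_congr ?_ rfl rfl⟩
  exact ⟨fun h => G.x_strictMono.monotone (hmax _ h), fun h => h.trans hd⟩

theorem concaveHull_le {g : ℝ → ℝ} (hg : ConcaveOn ℝ (Set.Icc 0 1) g)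
    (hA : ∀ s ∈ Set.Icc (0 : ℝ) 1, G.A s ≤ g s) {t : ℝ} (ht : t ∈ Set.Icc (0 : ℝ) 1) :
    G.concaveHull t ≤ g t :=
  csInf_le ⟨G.A t, by rintro r ⟨g, -, h, rfl⟩; exact h t ht⟩ ⟨g, hg, hA, rfl⟩

theorem A_le_one {t : ℝ} (ht : t ∈ Set.Icc (0 : ℝ) 1) : G.A t ≤ 1 :=
  (G.A_mono ht.2).trans_eq G.A_one

theorem le_concaveHull {t c : ℝ} (h : ∀ g : ℝ → ℝ, ConcaveOn ℝ (Set.Icc 0 1) g →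
    (∀ s ∈ Set.Icc (0 : ℝ) 1, G.A s ≤ g s) → c ≤ g t) : c ≤ G.concaveHull t :=
  le_csInf ⟨1, fun _ => 1, concaveOn_const _ (convex_Icc _ _), fun s hs => G.A_le_one hs, rfl⟩
    (by rintro r ⟨g, hg, hA, rfl⟩; exact h g hg hA)

theorem A_le_concaveHull {t : ℝ} (ht : t ∈ Set.Icc (0 : ℝ) 1) : G.A t ≤ G.concaveHull t :=
  G.le_concaveHull fun _ _ hA => hA t ht

theorem concaveOn_concaveHull : ConcaveOn ℝ (Set.Icc 0 1) G.concaveHull := by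
  refine ⟨convex_Icc _ _, fun s hs t ht p q hp hq hpq => G.le_concaveHull fun g hg hA => ?_⟩
  refine le_trans ?_ (hg.2 hs ht hp hq hpq)
  exact add_le_add (smul_le_smul_of_nonneg_left (G.concaveHull_le hg hA hs) hp)
    (smul_le_smul_of_nonneg_left (G.concaveHull_le hg hA ht) hq)

theorem concaveOn_affine (c s : ℝ) : ConcaveOn ℝ (Set.Icc (0 : ℝ) 1) fun t => c + s * t := by
  refine ⟨convex_Icc _ _, fun u _ v _ p q _ _ hpq => le_of_eq ?_⟩
  simp only [smul_eq_mul]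
  linear_combination c * hpq

/-- A nondecreasing affine function which dominates `A` at the points `x d` dominates the hull. -/
theorem concaveHull_le_affine {c s : ℝ} (hs : 0 ≤ s) (h : ∀ d, G.A (G.x d) ≤ c + s * G.x d)
    {t : ℝ} (ht : t ∈ Set.Icc (0 : ℝ) 1) : G.concaveHull t ≤ c + s * t := by
  refine G.concaveHull_le (concaveOn_affine c s) (fun u hu => ?_) ht
  obtain ⟨d, hd, hA⟩ := G.exists_A_eq hu.1
  rw [hA]
  exact (h d).trans (by gcongr)

theorem concaveHull_one : G.concaveHull 1 = 1 := by
  refine le_antisymm ?_ ?_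
  · exact G.concaveHull_le (concaveOn_const 1 (convex_Icc _ _)) (fun s hs => G.A_le_one hs)
      ⟨zero_le_one, le_rfl⟩
  · exact G.A_one.symm.trans_le (G.A_le_concaveHull ⟨zero_le_one, le_rfl⟩)

theorem concaveHull_le_one {t : ℝ} (ht : t ∈ Set.Icc (0 : ℝ) 1) : G.concaveHull t ≤ 1 :=
  G.concaveHull_le (concaveOn_const 1 (convex_Icc _ _)) (fun _ hs => G.A_le_one hs) ht

theorem n_pos : 0 < G.n := by
  rcases Nat.eq_zero_or_pos G.n with h | h
  · have h0 : (0 : Fin (G.n + 1)) = Fin.last G.n := Fin.ext (by simp [h])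
    have := G.x_zero.symm.trans (h0 ▸ G.x_last)
    norm_num at this
  · exact h

theorem concaveHull_zero : G.concaveHull 0 = 0 := by
  refine le_antisymm ?_ ?_
  · set k : Fin G.n := ⟨0, G.n_pos⟩
    have hk0 : k.castSucc = 0 := rfl
    have hpos : 0 < G.x k.succ := by
      have := G.x_castSucc_lt_succ k
      rwa [hk0, G.x_zero] at this
    -- The line through the origin with slope `1 / x₁` dominates `A`, which vanishes before `x₁` and
    -- never exceeds one.
    have := G.concaveHull_le_affine (c := 0) (s := (G.x k.succ)⁻¹) (inv_pos.2 hpos).le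
      (fun d => ?_) (t := 0) ⟨le_rfl, zero_le_one⟩
    · simpa using this
    · rcases eq_or_ne d 0 with rfl | hd
      · simp [G.x_zero, G.A_zero]
      · have hle : k.succ ≤ d := by
          rw [Fin.le_def, Fin.val_succ]
          have : (d : ℕ) ≠ 0 := fun h => hd (Fin.ext h)
          simp only [k]; omega
        refine (G.A_le_one (G.x_mem_Icc d)).trans ?_
        rw [zero_add, inv_mul_eq_div, one_le_div hpos]
        exact G.x_strictMono.monotone hle
  · exact G.A_zero.symm.trans_le (G.A_le_concaveHull ⟨le_rfl, zero_le_one⟩)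

/-- A concave function with its maximum at the right endpoint has nonnegative slopes. -/
theorem concaveHull_mono {s t : ℝ} (hs : s ∈ Set.Icc (0 : ℝ) 1) (ht : t ∈ Set.Icc (0 : ℝ) 1)
    (hst : s ≤ t) : G.concaveHull s ≤ G.concaveHull t := by
  rcases hst.eq_or_lt with rfl | hst
  · exact le_rfl
  rcases ht.2.eq_or_lt with rfl | ht1
  · rw [concaveHull_one]; exact G.concaveHull_le_one hs
  · have h := G.concaveOn_concaveHull.slope_anti_adjacent hs ⟨zero_le_one, le_rfl⟩ hst ht1
    rw [G.concaveHull_one] at h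
    have h1 : 0 ≤ (1 - G.concaveHull t) / (1 - t) :=
      div_nonneg (by linarith [G.concaveHull_le_one ht]) (by linarith)
    have h2 := mul_nonneg (h1.trans h) (sub_pos.2 hst).le
    rw [div_mul_cancel₀ _ (sub_pos.2 hst).ne'] at h2
    linarith

/-- The slope of the concave hull between `x k` and `x (k + 1)`. -/
noncomputable def hullSlope (k : Fin G.n) : ℝ :=
  (G.concaveHull (G.x k.succ) - G.concaveHull (G.x k.castSucc)) / (G.x k.succ - G.x k.castSucc)

theorem hullSlope_nonneg (k : Fin G.n) : 0 ≤ G.hullSlope k :=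
  div_nonneg (sub_nonneg.2 (G.concaveHull_mono (G.x_mem_Icc _) (G.x_mem_Icc _)
    (G.x_castSucc_lt_succ k).le)) (sub_pos.2 (G.x_castSucc_lt_succ k)).le

theorem concaveHull_succ (k : Fin G.n) : G.concaveHull (G.x k.succ) =
    G.concaveHull (G.x k.castSucc) + G.hullSlope k * (G.x k.succ - G.x k.castSucc) := by
  rw [hullSlope, div_mul_cancel₀ _ (sub_pos.2 (G.x_castSucc_lt_succ k)).ne']; ring

/-- The hull lies below the lines through its values at neighbouring points `x k`. -/
theorem concaveHull_le_line (k : Fin G.n) {t : ℝ} (ht : t ∈ Set.Icc (0 : ℝ) 1) :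
    G.concaveHull t ≤
      G.concaveHull (G.x k.castSucc) + G.hullSlope k * (t - G.x k.castSucc) := by
  have h := G.concaveHull_le_affine
    (c := G.concaveHull (G.x k.castSucc) - G.hullSlope k * G.x k.castSucc)
    (G.hullSlope_nonneg k) (fun d => ?_) ht
  · linarith
  · refine (G.A_le_concaveHull (G.x_mem_Icc d)).trans ?_
    have hlt := G.x_castSucc_lt_succ k
    rcases lt_trichotomy d k.castSucc with hd | rfl | hd
    · have hd' := G.x_strictMono hd
      have h1 := G.concaveOn_concaveHull.slope_anti_adjacent (G.x_mem_Icc d)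
        (G.x_mem_Icc k.succ) hd' hlt
      change G.hullSlope k ≤ _ at h1
      rw [le_div_iff₀ (sub_pos.2 hd')] at h1
      linarith
    · exact le_of_eq (by ring)
    · rcases (Fin.castSucc_lt_iff_succ_le.1 hd).eq_or_lt with rfl | hd'
      · rw [concaveHull_succ]; exact le_of_eq (by ring)
      · have hd' := G.x_strictMono hd'
        have h1 := G.concaveOn_concaveHull.slope_anti_adjacent (G.x_mem_Icc k.castSucc)
          (G.x_mem_Icc d) hlt hd'
        change _ ≤ G.hullSlope k at h1
        rw [div_le_iff₀ (sub_pos.2 hd'), concaveHull_succ] at h1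
        linarith

/-- A nonvertical segment in the region through the point of the graph over `x d` has ends on
opposite sides of `x d`, and raising these ends to the graph can only help. On a vertical segment a
point of the graph is the highest, so it is not interior. -/
theorem mem_hullVertices {d : Fin (G.n + 1)}
    (h : ∀ p ∈ Set.Icc (0 : ℝ) 1, ∀ q ∈ Set.Icc (0 : ℝ) 1, p < G.x d → G.x d < q →
      ∀ s t : ℝ, 0 < s → 0 < t → s + t = 1 → s * p + t * q = G.x d →
        s * G.concaveHull p + t * G.concaveHull q < G.concaveHull (G.x d)) :
    G.x d ∈ G.hullVertices := by
  classical
  rw [hullVertices, Finset.mem_filter, mem_extremePoints_iff_left]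
  refine ⟨Finset.mem_image_of_mem _ (Finset.mem_univ d), ⟨G.x_mem_Icc d, le_rfl⟩, ?_⟩
  rintro ⟨p, u⟩ ⟨hp, hu⟩ ⟨q, v⟩ ⟨hq, hv⟩ ⟨s, t, hs, ht, hst, heq⟩
  simp only [Prod.smul_mk, Prod.mk_add_mk, smul_eq_mul, Prod.mk.injEq] at heq hp hu hq hv ⊢
  obtain ⟨h1, h2⟩ := heq
  have hle : s * u + t * v ≤ s * G.concaveHull p + t * G.concaveHull q := by gcongr
  rcases lt_trichotomy p (G.x d) with hlt | rfl | hlt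
  · have hq' : G.x d < q := by
      by_contra hcon
      exact absurd h1 (convexComb_lt hs ht hst hlt (not_lt.1 hcon)).ne
    exact absurd (h p hp q hq hlt hq' s t hs ht hst h1) (by linarith)
  · have hq' : q = G.x d := by
      have : t * q = t * G.x d := by linear_combination h1 - G.x d * hst
      exact mul_left_cancel₀ ht.ne' this
    rw [hq'] at hv
    refine ⟨rfl, le_antisymm hu ?_⟩
    by_contra hcon
    exact absurd h2 (convexComb_lt hs ht hst (not_le.1 hcon) hv).ne
  · have hq' : q < G.x d := by
      by_contra hcon
      have := convexComb_lt (a := -p) (b := -q) hs ht hst (neg_lt_neg hlt)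
        (neg_le_neg (not_lt.1 hcon))
      linarith
    exact absurd (h q hq p hp hq' hlt t s ht hs (by linarith) (by linarith)) (by linarith)

/-- The hull lies below both adjacent lines; since their slopes differ, chords across the kink stay
strictly below it. -/
theorem x_mem_hullVertices_of_slope_lt {i j : Fin G.n} (hij : i.succ = j.castSucc)
    (h : G.hullSlope j < G.hullSlope i) : G.x i.succ ∈ G.hullVertices := by
  refine G.mem_hullVertices fun p hp q hq hpx hxq s t hs ht hst heq => ?_
  have h1 := G.concaveHull_le_line i hp
  have h2 := G.concaveHull_le_line j hq
  rw [← hij] at h2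
  have h3 := G.concaveHull_succ i
  have h1' : G.concaveHull p ≤ G.concaveHull (G.x i.succ) + G.hullSlope i * (p - G.x i.succ) := by
    linarith
  have h4 : s * (p - G.x i.succ) + t * (q - G.x i.succ) = 0 := by
    linear_combination heq - G.x i.succ * hst
  calc s * G.concaveHull p + t * G.concaveHull q
      ≤ s * (G.concaveHull (G.x i.succ) + G.hullSlope i * (p - G.x i.succ)) +
        t * (G.concaveHull (G.x i.succ) + G.hullSlope j * (q - G.x i.succ)) := by gcongr
    _ = G.concaveHull (G.x i.succ) + (G.hullSlope i - G.hullSlope j) *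
        (s * (p - G.x i.succ)) := by
      linear_combination G.concaveHull (G.x i.succ) * hst + G.hullSlope j * h4
    _ < G.concaveHull (G.x i.succ) := by
      have : s * (p - G.x i.succ) < 0 := mul_neg_of_pos_of_neg hs (by linarith)
      nlinarith

theorem zero_mem_hullVertices : 0 ∈ G.hullVertices := by
  rw [← G.x_zero]
  exact G.mem_hullVertices fun p hp q _ hpx => absurd hp.1 (by rw [G.x_zero] at hpx; linarith)

theorem one_mem_hullVertices : 1 ∈ G.hullVertices := by
  rw [← G.x_last]
  exact G.mem_hullVertices fun p _ q hq _ hxq => absurd hq.2 (by rw [G.x_last] at hxq; linarith)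

theorem exists_x_eq_of_mem_hullVertices {t : ℝ} (ht : t ∈ G.hullVertices) : ∃ d, G.x d = t := by
  classical
  rw [hullVertices, Finset.mem_filter, Finset.mem_image] at ht
  obtain ⟨d, -, hd⟩ := ht.1
  exact ⟨d, hd⟩

/-- At an interior extreme point the hull lies strictly above the chord between the neighbouring
points `x`. If it were also strictly above `A`, a line parallel to this chord would dominate `A` at
all points `x d` and still pass below the hull, contradicting minimality. -/
theorem concaveHull_eq_A_of_mem_hullVertices {t : ℝ} (ht : t ∈ G.hullVertices) :
    G.concaveHull t = G.A t := by
  classical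
  obtain ⟨d, rfl⟩ := G.exists_x_eq_of_mem_hullVertices ht
  refine le_antisymm ?_ (G.A_le_concaveHull (G.x_mem_Icc d))
  rcases Fin.eq_zero_or_eq_succ d with rfl | ⟨i, rfl⟩
  · rw [G.x_zero, G.concaveHull_zero, G.A_zero]
  rcases Fin.eq_castSucc_or_eq_last i.succ with ⟨j, hij⟩ | hlast
  swap
  · rw [hlast, G.x_last, G.concaveHull_one, G.A_one]
  by_contra hcon
  rw [not_le] at hcon
  set u := G.x i.castSucc with hu
  set w := G.x i.succ with hw
  set z := G.x j.succ with hz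
  have huw : u < w := G.x_castSucc_lt_succ i
  have hwz : w < z := by rw [hw, hij]; exact G.x_castSucc_lt_succ j
  have hU := G.x_mem_Icc i.castSucc
  have hW := G.x_mem_Icc i.succ
  have hZ := G.x_mem_Icc j.succ
  set s := (G.concaveHull z - G.concaveHull u) / (z - u) with hs
  have hzu : 0 < z - u := by linarith
  have hs' : s * (z - u) = G.concaveHull z - G.concaveHull u := div_mul_cancel₀ _ hzu.ne'
  have hchord : G.concaveHull u + s * (w - u) < G.concaveHull w := by
    by_contra hcon2
    rw [not_lt] at hcon2
    rw [hullVertices, Finset.mem_filter, mem_extremePoints_iff_left] at ht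
    have hconc := G.concaveOn_concaveHull.slope_anti_adjacent hU hZ huw hwz
    rw [div_le_div_iff₀ (by linarith) (by linarith)] at hconc
    have heq : G.concaveHull w = G.concaveHull u + s * (w - u) := by
      refine le_antisymm hcon2 ?_
      have : (G.concaveHull u + s * (w - u) - G.concaveHull w) * (z - u) ≤ 0 := by
        have e : (G.concaveHull u + s * (w - u) - G.concaveHull w) * (z - u) =
          (G.concaveHull u - G.concaveHull w) * (z - u) +
            (G.concaveHull z - G.concaveHull u) * (w - u) := by
          rw [← hs']; ring
        rw [e]; linarith
      nlinarith
    have := ht.2.2 (u, G.concaveHull u) ⟨hU, le_rfl⟩ (z, G.concaveHull z) ⟨hZ, le_rfl⟩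
      ⟨(z - w) / (z - u), (w - u) / (z - u), div_pos (by linarith) hzu, div_pos (by linarith) hzu,
        by field_simp; ring, ?_⟩
    · simp only [Prod.mk.injEq] at this
      linarith [this.1]
    · simp only [Prod.smul_mk, Prod.mk_add_mk, smul_eq_mul, Prod.mk.injEq]
      constructor
      · field_simp; ring
      · rw [heq, hs]; field_simp; ring
  -- The height `v` is the least at which a line of slope `s` dominates both `A` at `w` and the
  -- chord; domination at the other points follows because `s` lies between the adjacent hull
  -- slopes.
  set v := max (G.A w) (G.concaveHull u + s * (w - u)) with hv
  have hvlt : v < G.concaveHull w := max_lt hcon hchord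
  have hs0 : 0 ≤ s := div_nonneg (sub_nonneg.2 (G.concaveHull_mono hU hZ (by linarith))) hzu.le
  have hsi : s ≤ G.hullSlope i := by
    have := G.concaveHull_succ i
    rw [← hu, ← hw] at this
    nlinarith
  have hsj : G.hullSlope j ≤ s := by
    have := G.concaveHull_succ j
    rw [← hij, ← hw, ← hz] at this
    nlinarith
  have hvc : G.concaveHull u + s * (w - u) ≤ v := le_max_right _ _
  have := G.concaveHull_le_affine (c := v - s * w) hs0 (fun d => ?_) hW
  · rw [← hw] at this; linarith
  · rcases lt_trichotomy d i.succ with hd | rfl | hd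
    · have hdi : G.x d ≤ u := G.x_strictMono.monotone (Fin.le_castSucc_iff.2 hd)
      have h1 := G.concaveHull_le_line i (G.x_mem_Icc d)
      rw [← hu] at h1
      have h2 := G.A_le_concaveHull (G.x_mem_Icc d)
      nlinarith
    · rw [← hw]
      linarith [le_max_left (G.A w) (G.concaveHull u + s * (w - u))]
    · rw [hij] at hd
      have hdj : z ≤ G.x d := G.x_strictMono.monotone (Fin.castSucc_lt_iff_succ_le.1 hd)
      have h1 := G.concaveHull_le_line j (G.x_mem_Icc d)
      have h3 := G.concaveHull_succ j
      rw [← hij, ← hw] at h1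
      rw [← hij, ← hw, ← hz] at h3
      have h2 := G.A_le_concaveHull (G.x_mem_Icc d)
      nlinarith

end GREM

namespace GREM

variable (G : GREM)

/-! ### The vertices of the concave hull -/

theorem card_hullVertices : G.hullVertices.card = G.m + 1 := by
  have : 0 < G.hullVertices.card := Finset.card_pos.2 ⟨0, G.zero_mem_hullVertices⟩
  rw [m]; omega

theorem length_sort_hullVertices : (G.hullVertices.sort (· ≤ ·)).length = G.m + 1 := by
  rw [Finset.length_sort, card_hullVertices]

theorem y_eq_getElem {l : ℕ} (hl : l ≤ G.m) :
    G.y l = (G.hullVertices.sort (· ≤ ·))[l]'(by rw [length_sort_hullVertices]; omega) :=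
  List.getD_eq_getElem _ _ _

theorem y_mem {l : ℕ} (hl : l ≤ G.m) : G.y l ∈ G.hullVertices := by
  rw [y_eq_getElem G hl, ← Finset.mem_sort (· ≤ ·)]
  exact List.getElem_mem _

theorem y_lt_iff {k l : ℕ} (hk : k ≤ G.m) (hl : l ≤ G.m) : G.y k < G.y l ↔ k < l := by
  rw [y_eq_getElem G hk, y_eq_getElem G hl]
  exact (Finset.sortedLT_sort _).getElem_lt_getElem_iff

theorem y_le_iff {k l : ℕ} (hk : k ≤ G.m) (hl : l ≤ G.m) : G.y k ≤ G.y l ↔ k ≤ l := by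
  rw [← not_lt, y_lt_iff G hl hk, not_lt]

theorem exists_y_eq {t : ℝ} (ht : t ∈ G.hullVertices) : ∃ l ≤ G.m, G.y l = t := by
  rw [← Finset.mem_sort (· ≤ ·)] at ht
  obtain ⟨l, hl, rfl⟩ := List.getElem_of_mem ht
  rw [length_sort_hullVertices] at hl
  exact ⟨l, by omega, y_eq_getElem G (by omega)⟩

theorem exists_x_eq_y {l : ℕ} (hl : l ≤ G.m) : ∃ d, G.x d = G.y l :=
  G.exists_x_eq_of_mem_hullVertices (G.y_mem hl)

theorem y_mem_Icc {l : ℕ} (hl : l ≤ G.m) : G.y l ∈ Set.Icc (0 : ℝ) 1 := by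
  obtain ⟨d, hd⟩ := G.exists_x_eq_y hl
  exact hd ▸ G.x_mem_Icc d

theorem y_zero : G.y 0 = 0 := by
  obtain ⟨l, hl, h⟩ := G.exists_y_eq G.zero_mem_hullVertices
  refine le_antisymm ?_ (G.y_mem_Icc (Nat.zero_le _)).1
  rw [← h, y_le_iff G (Nat.zero_le _) hl]
  exact Nat.zero_le _

theorem y_m : G.y G.m = 1 := by
  obtain ⟨l, hl, h⟩ := G.exists_y_eq G.one_mem_hullVertices
  refine le_antisymm (G.y_mem_Icc le_rfl).2 ?_
  rw [← h, y_le_iff G hl le_rfl]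
  exact hl

theorem L_pos {l : ℕ} (hl : l < G.m) : 0 < G.L (l + 1) := by
  rw [L, Nat.add_sub_cancel, sub_pos, y_lt_iff G hl.le hl]
  exact Nat.lt_succ_self l

theorem aBar_pos {l : ℕ} (hl : l < G.m) : 0 < G.aBar (l + 1) := by
  obtain ⟨p, hp⟩ := G.exists_x_eq_y hl.le
  obtain ⟨q, hq⟩ := G.exists_x_eq_y (l := l + 1) hl
  have h : G.x p < G.x q := by rw [hp, hq, y_lt_iff G hl.le hl]; exact Nat.lt_succ_self l
  rw [aBar, Nat.add_sub_cancel, sub_pos, ← hp, ← hq]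
  exact G.A_x_strictMono (G.x_strictMono.lt_iff_lt.1 h)

theorem slope_pos {l : ℕ} (hl : l < G.m) : 0 < G.slope (l + 1) :=
  div_pos (G.aBar_pos hl) (G.L_pos hl)

theorem slope_mul_L {l : ℕ} (hl : l < G.m) : G.slope (l + 1) * G.L (l + 1) = G.aBar (l + 1) :=
  div_mul_cancel₀ _ (G.L_pos hl).ne'

theorem slope_eq_hull {l : ℕ} (hl : l < G.m) : G.slope (l + 1) =
    (G.concaveHull (G.y (l + 1)) - G.concaveHull (G.y l)) / (G.y (l + 1) - G.y l) := by
  rw [slope, aBar, L, Nat.add_sub_cancel, G.concaveHull_eq_A_of_mem_hullVertices (G.y_mem hl),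
    G.concaveHull_eq_A_of_mem_hullVertices (G.y_mem hl.le)]

theorem slope_antitone {k l : ℕ} (hkl : k ≤ l) (hl : l < G.m) :
    G.slope (l + 1) ≤ G.slope (k + 1) := by
  induction l, hkl using Nat.le_induction with
  | base => exact le_rfl
  | succ l hkl ih =>
    refine le_trans ?_ (ih (by omega))
    rw [slope_eq_hull G hl, slope_eq_hull G (by omega)]
    refine G.concaveOn_concaveHull.slope_anti_adjacent (G.y_mem_Icc (by omega))
      (G.y_mem_Icc (by omega)) ?_ ?_
    · rw [y_lt_iff G (by omega) (by omega)]; omega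
    · rw [y_lt_iff G (by omega) (by omega)]; omega

theorem hullSlope_succ_le {i j : Fin G.n} (hij : i.succ = j.castSucc) :
    G.hullSlope j ≤ G.hullSlope i := by
  have h1 := G.concaveHull_le_line i (G.x_mem_Icc j.succ)
  have h2 := G.concaveHull_succ i
  have h3 := G.concaveHull_succ j
  have h4 := G.x_castSucc_lt_succ j
  rw [← hij] at h3 h4
  nlinarith

/-- Between consecutive vertices the hull is linear at the points `x d`. -/
theorem concaveHull_x_eq {l : ℕ} (hl : l < G.m) {d : Fin (G.n + 1)} (h1 : G.y l ≤ G.x d)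
    (h2 : G.x d ≤ G.y (l + 1)) :
    G.concaveHull (G.x d) = G.concaveHull (G.y l) + G.slope (l + 1) * (G.x d - G.y l) := by
  obtain ⟨p, hp⟩ := G.exists_x_eq_y hl.le
  obtain ⟨q, hq⟩ := G.exists_x_eq_y (l := l + 1) hl
  have hpq : p < q := by
    rw [← G.x_strictMono.lt_iff_lt, hp, hq, y_lt_iff G hl.le hl]; exact Nat.lt_succ_self l
  have hpn : (p : ℕ) < G.n := by have := q.2; have : (p : ℕ) < q := hpq; omega
  set P : Fin G.n := ⟨p, hpn⟩ with hP
  have hPp : P.castSucc = p := rfl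
  -- A strict drop of the slope would create a vertex strictly between the consecutive vertices `y
  -- l` and `y (l + 1)`.
  have hslope : ∀ k : ℕ, ∀ hk : k < G.n, (p : ℕ) ≤ k → k < q →
      G.hullSlope ⟨k, hk⟩ = G.hullSlope P := by
    intro k hk hpk
    induction k, hpk using Nat.le_induction with
    | base => intro _; rfl
    | succ k hpk ih =>
      intro hkq
      rw [← ih (by omega) (by omega)]
      refine le_antisymm (G.hullSlope_succ_le rfl) ?_
      by_contra hcon
      have hmem := G.x_mem_hullVertices_of_slope_lt (i := ⟨k, by omega⟩) (j := ⟨k + 1, hk⟩) rfl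
        (not_le.1 hcon)
      obtain ⟨j, hj, hjeq⟩ := G.exists_y_eq hmem
      have h3 : G.y l < G.y j := by
        rw [hjeq, ← hp, G.x_strictMono.lt_iff_lt, Fin.lt_def]; simp only [Fin.val_succ]; omega
      have h4 : G.y j < G.y (l + 1) := by
        rw [hjeq, ← hq, G.x_strictMono.lt_iff_lt, Fin.lt_def]; simpa using hkq
      rw [y_lt_iff G hl.le hj] at h3
      rw [y_lt_iff G hj hl] at h4
      omega
  have hlin : ∀ k : ℕ, ∀ hk : k < G.n + 1, (p : ℕ) ≤ k → k ≤ q →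
      G.concaveHull (G.x ⟨k, hk⟩) = G.concaveHull (G.x p) + G.hullSlope P * (G.x ⟨k, hk⟩ - G.x p) := by
    intro k hk hpk
    induction k, hpk using Nat.le_induction with
    | base => intro _; simp
    | succ k hpk ih =>
      intro hkq
      have h3 := G.concaveHull_succ ⟨k, by omega⟩
      rw [hslope k (by omega) hpk (by omega)] at h3
      have h4 := ih (by omega) (by omega)
      simp only [Fin.succ_mk, Fin.castSucc_mk] at h3
      rw [h3, h4]
      ring
  rw [← hp] at h1 ⊢
  rw [← hq] at h2
  have hslp : G.slope (l + 1) = G.hullSlope P := by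
    rw [slope_eq_hull G hl, ← hp, ← hq, hlin q q.2 hpq.le le_rfl]
    have : G.x q - G.x p ≠ 0 := (sub_pos.2 (G.x_strictMono hpq)).ne'
    field_simp
    ring
  rw [hslp]
  exact hlin d d.2 (G.x_strictMono.le_iff_le.1 h1) (G.x_strictMono.le_iff_le.1 h2)

theorem A_sub_le_slope_mul {l : ℕ} (hl : l < G.m) {d : Fin (G.n + 1)} (h1 : G.y l ≤ G.x d)
    (h2 : G.x d ≤ G.y (l + 1)) :
    G.A (G.x d) - G.A (G.y l) ≤ G.slope (l + 1) * (G.x d - G.y l) := by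
  have h3 := G.concaveHull_x_eq hl h1 h2
  have h4 := G.A_le_concaveHull (G.x_mem_Icc d)
  rw [G.concaveHull_eq_A_of_mem_hullVertices (G.y_mem hl.le)] at h3
  linarith

theorem exists_segment {t : ℝ} (h0 : 0 ≤ t) (h1 : t < 1) :
    ∃ l < G.m, G.y l ≤ t ∧ t < G.y (l + 1) := by
  have hex : ∃ l, t < G.y l := ⟨G.m, by rwa [y_m]⟩
  classical
  have hspec := Nat.find_spec hex
  have hm : Nat.find hex ≤ G.m := Nat.find_min' hex (by rwa [y_m])
  obtain ⟨l, hl⟩ : ∃ l, Nat.find hex = l + 1 := by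
    refine Nat.exists_eq_succ_of_ne_zero fun h => ?_
    rw [h, y_zero] at hspec
    linarith
  refine ⟨l, by omega, not_lt.1 (Nat.find_min hex (by omega)), hl ▸ hspec⟩

theorem exists_segment_level (k : Fin G.n) :
    ∃ l < G.m, G.y l ≤ G.x k.castSucc ∧ G.x k.succ ≤ G.y (l + 1) := by
  obtain ⟨l, hl, h1, h2⟩ := G.exists_segment (G.x_mem_Icc k.castSucc).1
    ((G.x_castSucc_lt_succ k).trans_le (G.x_mem_Icc _).2)
  refine ⟨l, hl, h1, ?_⟩
  obtain ⟨q, hq⟩ := G.exists_x_eq_y (l := l + 1) hl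
  rw [← hq, G.x_strictMono.lt_iff_lt] at h2
  rw [← hq, G.x_strictMono.le_iff_le]
  exact Fin.castSucc_lt_iff_succ_le.1 h2

/-- The segment `l + 1` of the hull to which the level `k` belongs is numbered by `l`. -/
noncomputable def segment (k : Fin G.n) : ℕ := (G.exists_segment_level k).choose

theorem segment_lt (k : Fin G.n) : G.segment k < G.m := (G.exists_segment_level k).choose_spec.1

theorem y_segment_le (k : Fin G.n) : G.y (G.segment k) ≤ G.x k.castSucc :=
  (G.exists_segment_level k).choose_spec.2.1

theorem le_y_segment (k : Fin G.n) : G.x k.succ ≤ G.y (G.segment k + 1) :=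
  (G.exists_segment_level k).choose_spec.2.2

theorem segment_eq {k : Fin G.n} {l : ℕ} (hl : l < G.m) (h1 : G.y l ≤ G.x k.castSucc)
    (h2 : G.x k.succ ≤ G.y (l + 1)) : G.segment k = l := by
  have h := G.x_castSucc_lt_succ k
  have h3 := (h1.trans_lt h).trans_le (G.le_y_segment k)
  have h4 := ((G.y_segment_le k).trans_lt h).trans_le h2
  rw [y_lt_iff G hl.le (G.segment_lt k)] at h3
  rw [y_lt_iff G (G.segment_lt k).le hl] at h4
  omega

theorem segment_mono {j k : Fin G.n} (hjk : j ≤ k) : G.segment j ≤ G.segment k := by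
  have h1 : G.x j.castSucc ≤ G.x k.castSucc := G.x_strictMono.monotone hjk
  have h2 := (((G.y_segment_le j).trans h1).trans_lt (G.x_castSucc_lt_succ k)).trans_le
    (G.le_y_segment k)
  rw [y_lt_iff G (G.segment_lt j).le (G.segment_lt k)] at h2
  omega

/-- The length of a block. -/
def blockLength (k : Fin G.n) : ℝ := G.x k.succ - G.x k.castSucc

/-- Sums over levels of quantities which depend on the level through its segment only. -/
theorem sum_levels_segment (c e : ℕ → ℝ) (d : Fin (G.n + 1)) : ∀ l < G.m, G.y l ≤ G.x d →
    G.x d ≤ G.y (l + 1) →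
    ∑ k ∈ G.levels d, (G.blockLength k * c (G.segment k) + G.a k * e (G.segment k)) =
      ∑ i ∈ Finset.range l, (G.L (i + 1) * c i + G.aBar (i + 1) * e i) +
        ((G.x d - G.y l) * c l + (G.A (G.x d) - G.A (G.y l)) * e l) := by
  induction d using Fin.induction with
  | zero =>
    intro l hl h1 _
    rw [G.x_zero, ← G.y_zero, y_le_iff G hl.le (Nat.zero_le _)] at h1
    obtain rfl : l = 0 := by omega
    simp [levels_zero, G.x_zero, G.y_zero]
  | succ k ih =>
    intro l hl h1 h2
    have hA : G.A (G.x k.succ) = G.a k + G.A (G.x k.castSucc) := by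
      rw [A_x, A_x, sum_levels_succ]
    rw [sum_levels_succ]
    rcases le_or_gt (G.y l) (G.x k.castSucc) with h3 | h3
    · rw [ih l hl h3 ((G.x_castSucc_lt_succ k).le.trans h2), G.segment_eq hl h3 h2, hA,
        blockLength]
      ring
    -- Here `x k.succ` is the vertex `y l` itself: the level `k` still belongs to the previous
    -- segment, which it completes, and the remainder in segment `l` is zero.
    · obtain ⟨q, hq⟩ := G.exists_x_eq_y hl.le
      have hqk : q = k.succ := by
        rw [← hq, G.x_strictMono.lt_iff_lt, Fin.castSucc_lt_iff_succ_le] at h3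
        rw [← hq, G.x_strictMono.le_iff_le] at h1
        exact le_antisymm h1 h3
      subst hqk
      obtain ⟨l, rfl⟩ : ∃ l', l = l' + 1 := by
        refine Nat.exists_eq_succ_of_ne_zero fun h => ?_
        rw [h, y_zero] at h3
        linarith [(G.x_mem_Icc k.castSucc).1]
      have h4 : G.y l ≤ G.x k.castSucc := by
        obtain ⟨p, hp⟩ := G.exists_x_eq_y (l := l) (by omega)
        have : G.y l < G.y (l + 1) := by
          rw [y_lt_iff G (by omega) (by omega)]; exact Nat.lt_succ_self l
        rw [← hp, ← hq, G.x_strictMono.lt_iff_lt] at this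
        rw [← hp]
        exact G.x_strictMono.monotone (Fin.le_castSucc_iff.2 this)
      rw [ih l (by omega) h4 h3.le, G.segment_eq (by omega) h4 hq.le, Finset.sum_range_succ,
        blockLength, ← hq, hA, L, aBar, Nat.add_sub_cancel, ← hq, hA]
      ring

theorem sum_levels_segment_of_eq_y (c e : ℕ → ℝ) {d : Fin (G.n + 1)} {K : ℕ} (hK : K ≤ G.m)
    (h : G.x d = G.y K) :
    ∑ k ∈ G.levels d, (G.blockLength k * c (G.segment k) + G.a k * e (G.segment k)) =
      ∑ i ∈ Finset.range K, (G.L (i + 1) * c i + G.aBar (i + 1) * e i) := by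
  rcases K.eq_zero_or_pos with rfl | hpos
  · rw [y_zero, ← G.x_zero] at h
    rw [G.x_strictMono.injective h, levels_zero]
    simp
  · obtain ⟨l, rfl⟩ := Nat.exists_eq_succ_of_ne_zero hpos.ne'
    have : G.y l ≤ G.y (l + 1) := by rw [y_le_iff G (by omega) hK]; omega
    rw [G.sum_levels_segment c e d l hK (h ▸ this) h.le, Finset.sum_range_succ, h]
    simp [L, aBar]

end GREM

namespace GREM

variable (G : GREM)

/-! ### The limiting pressure -/

/-- The critical inverse temperature of the segment `l + 1` of the hull. -/
noncomputable def criticalBeta (l : ℕ) : ℝ := √(2 * Real.log 2 * (G.slope (l + 1))⁻¹)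

/-- The exponent of the fractional moments which are optimal in the segment `l + 1`. -/
noncomputable def tilt (β : ℝ) (l : ℕ) : ℝ :=
  if β ≤ G.criticalBeta l then 1 else G.criticalBeta l / β

/-- The specific energy, per unit of variance, which dominates in the segment `l + 1`. -/
noncomputable def energyRate (β : ℝ) (l : ℕ) : ℝ := min β (G.criticalBeta l)

theorem criticalBeta_pos {l : ℕ} (hl : l < G.m) : 0 < G.criticalBeta l :=
  Real.sqrt_pos.2 (mul_pos (mul_pos two_pos (Real.log_pos one_lt_two))
    (inv_pos.2 (G.slope_pos hl)))

theorem criticalBeta_sq {l : ℕ} (hl : l < G.m) :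
    G.criticalBeta l ^ 2 * G.slope (l + 1) = 2 * Real.log 2 := by
  have h := G.slope_pos hl
  have h2 := Real.log_pos one_lt_two
  rw [criticalBeta, Real.sq_sqrt (by positivity), inv_mul_cancel_right₀ h.ne']

theorem criticalBeta_sq_mul_aBar {l : ℕ} (hl : l < G.m) :
    G.criticalBeta l ^ 2 * G.aBar (l + 1) = 2 * Real.log 2 * G.L (l + 1) := by
  rw [← G.slope_mul_L hl, ← mul_assoc, G.criticalBeta_sq hl]

theorem criticalBeta_mono {k l : ℕ} (hkl : k ≤ l) (hl : l < G.m) :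
    G.criticalBeta k ≤ G.criticalBeta l := by
  refine Real.sqrt_le_sqrt ?_
  have := inv_anti₀ (G.slope_pos hl) (G.slope_antitone hkl hl)
  have h2 := Real.log_pos one_lt_two
  gcongr

theorem tilt_pos {β : ℝ} {l : ℕ} (hl : l < G.m) : 0 < G.tilt β l := by
  unfold tilt
  split_ifs with h
  · exact one_pos
  · exact div_pos (G.criticalBeta_pos hl) ((G.criticalBeta_pos hl).trans (not_le.1 h))

theorem tilt_le_one {β : ℝ} {l : ℕ} (hl : l < G.m) : G.tilt β l ≤ 1 := by
  unfold tilt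
  split_ifs with h
  · exact le_rfl
  · exact div_le_one_of_le₀ (not_le.1 h).le ((G.criticalBeta_pos hl).trans (not_le.1 h)).le

/-- Slopes decrease along the hull, so critical inverse temperatures increase. This order makes the
inverse exponents nonincreasing in the level, as summation by parts requires. -/
theorem tilt_mono {β : ℝ} {k l : ℕ} (hkl : k ≤ l) (hl : l < G.m) : G.tilt β k ≤ G.tilt β l := by
  have h1 := G.criticalBeta_mono hkl hl
  by_cases h : β ≤ G.criticalBeta l
  · rw [tilt.eq_def G β l, if_pos h]
    exact G.tilt_le_one (by omega)
  · have h2 : ¬ β ≤ G.criticalBeta k := fun h3 => h (h3.trans h1)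
    have h3 := (G.criticalBeta_pos hl).trans (not_le.1 h)
    rw [tilt, tilt, if_neg h, if_neg h2]
    gcongr

theorem partialPressure_eq_criticalBeta {β : ℝ} {l : ℕ} (hl : l < G.m)
    (h : ¬ β ≤ G.criticalBeta l) :
    G.partialPressure (l + 1) β = β * (G.criticalBeta l * G.aBar (l + 1)) := by
  have h1 := G.aBar_pos hl
  have h2 := G.criticalBeta_pos hl
  rw [partialPressure, if_neg (show ¬ β ≤ √_ from h)]
  congr 1
  rw [Real.sqrt_eq_iff_mul_self_eq_of_pos (by positivity)]
  linear_combination G.aBar (l + 1) * G.criticalBeta_sq_mul_aBar hl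

/-- For an exponent `t` in `(0, 1]` the moment bound per segment is `L ln 2 / t + t β² ā / 2`. Its
minimizer is `1` at high temperature and the ratio of the critical to the actual inverse temperature
otherwise. -/
theorem partialPressure_eq_tilt {β : ℝ} {l : ℕ} (hl : l < G.m) :
    G.L (l + 1) * (Real.log 2 / G.tilt β l) + G.aBar (l + 1) * (G.tilt β l * β ^ 2 / 2) =
      G.partialPressure (l + 1) β := by
  by_cases h : β ≤ G.criticalBeta l
  · rw [partialPressure, tilt, if_pos h, if_pos (show β ≤ √_ from h)]
    ring
  · have h2 := G.criticalBeta_pos hl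
    have h3 := h2.trans (not_le.1 h)
    rw [G.partialPressure_eq_criticalBeta hl h, tilt, if_neg h]
    field_simp
    linear_combination -G.criticalBeta_sq_mul_aBar hl

/-- The dual description: entropy `L ln 2 - ā r² / 2` plus energy `β ā r`, maximized over the rates
`r` of nonnegative entropy, that is, up to the critical one. -/
theorem partialPressure_eq_energyRate {β : ℝ} {l : ℕ} (hl : l < G.m) :
    G.L (l + 1) * Real.log 2 +
      G.aBar (l + 1) * (β * G.energyRate β l - G.energyRate β l ^ 2 / 2) =
      G.partialPressure (l + 1) β := by
  by_cases h : β ≤ G.criticalBeta l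
  · rw [partialPressure, energyRate, min_eq_left h, if_pos (show β ≤ √_ from h)]
    ring
  · rw [G.partialPressure_eq_criticalBeta hl h, energyRate, min_eq_right (not_le.1 h).le]
    linear_combination -(1 / 2) * G.criticalBeta_sq_mul_aBar hl

theorem energyRate_nonneg {β : ℝ} (hβ : 0 ≤ β) (l : ℕ) : 0 ≤ G.energyRate β l :=
  le_min hβ (Real.sqrt_nonneg _)

theorem energyRate_sq_mul_slope_le {β : ℝ} (hβ : 0 ≤ β) {l : ℕ} (hl : l < G.m) :
    G.energyRate β l ^ 2 * G.slope (l + 1) ≤ 2 * Real.log 2 := by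
  rw [← G.criticalBeta_sq hl]
  have := (G.slope_pos hl).le
  have := G.energyRate_nonneg hβ l
  gcongr
  exact min_le_right _ _

theorem sum_Icc_partialPressure (K : ℕ) (β : ℝ) : ∑ l ∈ Finset.Icc 1 K, G.partialPressure l β =
    ∑ i ∈ Finset.range K, G.partialPressure (i + 1) β := by
  induction K with
  | zero => simp
  | succ K ih => rw [Finset.sum_Icc_succ_top (by omega), Finset.sum_range_succ, ih]

theorem le_limitPressure (β p : ℝ) {K : ℕ} (hK : K ≤ G.m) :
    ∑ i ∈ Finset.range K, G.partialPressure (i + 1) β + (1 - G.y K) * p ≤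
      G.limitPressure β p := by
  rw [← sum_Icc_partialPressure]
  exact Finset.le_sup' (fun K => ∑ l ∈ Finset.Icc 1 K, G.partialPressure l β + (1 - G.y K) * p)
    (Finset.mem_range.2 (Nat.lt_succ_of_le hK))

theorem exists_limitPressure_eq (β p : ℝ) : ∃ K ≤ G.m, G.limitPressure β p =
    ∑ i ∈ Finset.range K, G.partialPressure (i + 1) β + (1 - G.y K) * p := by
  obtain ⟨K, hK, h⟩ := Finset.exists_mem_eq_sup' (Finset.nonempty_range_add_one (n := G.m))
    fun K => ∑ l ∈ Finset.Icc 1 K, G.partialPressure l β + (1 - G.y K) * p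
  refine ⟨K, by simpa [Nat.lt_succ_iff] using hK, ?_⟩
  rw [← sum_Icc_partialPressure]
  exact h

/-- The upper bound for the classical pressure of the first `d` levels obtained from fractional
moments. -/
noncomputable def momentBound (β : ℝ) (d : Fin (G.n + 1)) : ℝ :=
  ∑ k ∈ G.levels d, (G.blockLength k * (Real.log 2 / G.tilt β (G.segment k)) +
    G.a k * (G.tilt β (G.segment k) * β ^ 2 / 2))

/-- Inside a segment `A` lies below the line joining its vertices, so the left side is at most the
linear interpolation, with weight `θ`, of its values at the two vertices, and these enter the
maximum. -/
theorem momentBound_add_le_limitPressure (β p : ℝ) (d : Fin (G.n + 1)) :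
    G.momentBound β d + (1 - G.x d) * p ≤ G.limitPressure β p := by
  have hsum : ∀ K ≤ G.m, ∑ i ∈ Finset.range K, (G.L (i + 1) * (Real.log 2 / G.tilt β i) +
      G.aBar (i + 1) * (G.tilt β i * β ^ 2 / 2)) =
      ∑ i ∈ Finset.range K, G.partialPressure (i + 1) β := fun K hK =>
    Finset.sum_congr rfl fun i hi =>
      G.partialPressure_eq_tilt ((Finset.mem_range.1 hi).trans_le hK)
  rcases (G.x_mem_Icc d).2.eq_or_lt with h1 | h1
  · rw [momentBound, G.sum_levels_segment_of_eq_y (fun l => Real.log 2 / G.tilt β l)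
      (fun l => G.tilt β l * β ^ 2 / 2) le_rfl (h1.trans G.y_m.symm), hsum _ le_rfl, h1.trans G.y_m.symm]
    exact G.le_limitPressure β p le_rfl
  · obtain ⟨l, hl, h2, h3⟩ := G.exists_segment (G.x_mem_Icc d).1 h1
    rw [momentBound, G.sum_levels_segment (fun l => Real.log 2 / G.tilt β l)
      (fun l => G.tilt β l * β ^ 2 / 2) d l hl h2 h3.le, hsum l hl.le]
    have hL := G.L_pos hl
    have hP0 := G.le_limitPressure β p hl.le
    have hP1 := G.le_limitPressure β p (K := l + 1) hl
    rw [Finset.sum_range_succ] at hP1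
    have hLy : G.y (l + 1) = G.y l + G.L (l + 1) := by rw [L, Nat.add_sub_cancel]; ring
    rw [hLy] at hP1
    set S := ∑ i ∈ Finset.range l, G.partialPressure (i + 1) β
    set θ := (G.x d - G.y l) / G.L (l + 1) with hθ
    have hθL : θ * G.L (l + 1) = G.x d - G.y l := div_mul_cancel₀ _ hL.ne'
    have hθ0 : 0 ≤ θ := div_nonneg (by linarith) hL.le
    have hθ1 : θ ≤ 1 := by rw [hθ, div_le_one hL]; linarith
    have hseg : (G.x d - G.y l) * (Real.log 2 / G.tilt β l) +
        (G.A (G.x d) - G.A (G.y l)) * (G.tilt β l * β ^ 2 / 2) ≤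
        θ * G.partialPressure (l + 1) β := by
      have htilt := G.tilt_pos (β := β) hl
      have h4 : 0 ≤ G.tilt β l * β ^ 2 / 2 := by positivity
      have h5 := mul_le_mul_of_nonneg_right (G.A_sub_le_slope_mul hl h2 h3.le) h4
      rw [← G.partialPressure_eq_tilt hl, ← G.slope_mul_L hl]
      calc _ ≤ (G.x d - G.y l) * (Real.log 2 / G.tilt β l) +
          G.slope (l + 1) * (G.x d - G.y l) * (G.tilt β l * β ^ 2 / 2) := by linarith
        _ = _ := by rw [← hθL]; ring
    calc _ ≤ S + θ * G.partialPressure (l + 1) β + (1 - G.x d) * p := by linarith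
      _ = (1 - θ) * (S + (1 - G.y l) * p) +
          θ * (S + G.partialPressure (l + 1) β + (1 - (G.y l + G.L (l + 1))) * p) := by
        linear_combination p * hθL
      _ ≤ (1 - θ) * G.limitPressure β p + θ * G.limitPressure β p :=
        add_le_add (mul_le_mul_of_nonneg_left hP0 (by linarith))
          (mul_le_mul_of_nonneg_left hP1 hθ0)
      _ = G.limitPressure β p := by ring

/-- The exponential rate of the number of configurations whose energies in the first `d` levels
are `ρ` times the dominating ones is positive. -/
theorem entropy_pos {β ρ : ℝ} (hβ : 0 ≤ β) (hρ0 : 0 ≤ ρ) (hρ1 : ρ < 1) {d : Fin (G.n + 1)}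
    (hd : d ≠ 0) : 0 < ∑ k ∈ G.levels d, (G.blockLength k * Real.log 2 -
      G.a k * ((ρ * G.energyRate β (G.segment k)) ^ 2 / 2)) := by
  have hlog := Real.log_pos one_lt_two
  have hx : 0 < G.x d := by
    rw [← G.x_zero]; exact G.x_strictMono (Fin.pos_of_ne_zero hd)
  set e : ℕ → ℝ := fun l => -((ρ * G.energyRate β l) ^ 2 / 2) with he
  have heq : ∑ k ∈ G.levels d, (G.blockLength k * Real.log 2 -
      G.a k * ((ρ * G.energyRate β (G.segment k)) ^ 2 / 2)) =
      ∑ k ∈ G.levels d, (G.blockLength k * Real.log 2 + G.a k * e (G.segment k)) :=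
    Finset.sum_congr rfl fun k _ => by simp only [he]; ring
  have hρ2 : ρ ^ 2 < 1 := by nlinarith
  -- The energy rate does not exceed the critical one, so lowering it by the factor `ρ` leaves the
  -- fraction `1 - ρ ^ 2` of the entropy per unit length.
  have key : ∀ l < G.m, -(ρ ^ 2 * Real.log 2) ≤ G.slope (l + 1) * e l := fun l hl => by
    have := G.energyRate_sq_mul_slope_le hβ hl
    simp only [he]
    nlinarith [sq_nonneg ρ]
  have hseg : ∀ l < G.m, (1 - ρ ^ 2) * Real.log 2 * G.L (l + 1) ≤
      G.L (l + 1) * Real.log 2 + G.aBar (l + 1) * e l := fun l hl => by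
    rw [← G.slope_mul_L hl]
    nlinarith [key l hl, G.L_pos hl]
  have hsumL : ∀ K, ∑ i ∈ Finset.range K, G.L (i + 1) = G.y K := fun K => by
    simp only [L, Nat.add_sub_cancel]
    rw [Finset.sum_range_sub, y_zero, sub_zero]
  have hsum : ∀ K ≤ G.m, (1 - ρ ^ 2) * Real.log 2 * G.y K ≤
      ∑ i ∈ Finset.range K, (G.L (i + 1) * Real.log 2 + G.aBar (i + 1) * e i) := fun K hK => by
    rw [← hsumL, Finset.mul_sum]
    exact Finset.sum_le_sum fun i hi => hseg i ((Finset.mem_range.1 hi).trans_le hK)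
  rw [heq]
  have hfac : 0 < (1 - ρ ^ 2) * Real.log 2 := mul_pos (by linarith) hlog
  refine (mul_pos hfac hx).trans_le ?_
  rcases (G.x_mem_Icc d).2.eq_or_lt with h1 | h1
  · rw [G.sum_levels_segment_of_eq_y (fun _ => Real.log 2) e le_rfl (h1.trans G.y_m.symm),
      h1.trans G.y_m.symm]
    exact hsum _ le_rfl
  · obtain ⟨l, hl, h2, h3⟩ := G.exists_segment (G.x_mem_Icc d).1 h1
    rw [G.sum_levels_segment (fun _ => Real.log 2) e d l hl h2 h3.le]
    have h4 := hsum l hl.le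
    have h5 := G.A_sub_le_slope_mul hl h2 h3.le
    have h6 : e l ≤ 0 := by simp only [he]; nlinarith [sq_nonneg (ρ * G.energyRate β l)]
    nlinarith [mul_le_mul_of_nonpos_right h5 h6, key l hl]

/-- The contribution of the configurations whose energies are `ρ` times the dominating ones. -/
theorem sum_levels_energyRate_ge {β ρ : ℝ} (hβ : 0 ≤ β) (hρ0 : 0 ≤ ρ) (hρ1 : ρ ≤ 1)
    {d : Fin (G.n + 1)} {K : ℕ} (hK : K ≤ G.m) (h : G.x d = G.y K) :
    ∑ i ∈ Finset.range K, G.partialPressure (i + 1) β - (1 - ρ) * β ^ 2 ≤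
      ∑ k ∈ G.levels d, (G.blockLength k * Real.log 2 +
        G.a k * (β * (ρ * G.energyRate β (G.segment k)) -
          (ρ * G.energyRate β (G.segment k)) ^ 2 / 2)) := by
  have h1 : ∑ i ∈ Finset.range K, G.partialPressure (i + 1) β =
      ∑ k ∈ G.levels d, (G.blockLength k * Real.log 2 + G.a k *
        (β * G.energyRate β (G.segment k) - G.energyRate β (G.segment k) ^ 2 / 2)) := by
    rw [G.sum_levels_segment_of_eq_y (fun _ => Real.log 2)
      (fun l => β * G.energyRate β l - G.energyRate β l ^ 2 / 2) hK h]
    exact Finset.sum_congr rfl fun i hi =>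
      (G.partialPressure_eq_energyRate ((Finset.mem_range.1 hi).trans_le hK)).symm
  -- Replacing the rate `r ≤ β` by `ρ r` costs each level at most `a k (1 - ρ) β²`, and the jump
  -- heights add up to at most one.
  have h2 : ∑ k ∈ G.levels d, G.a k * ((1 - ρ) * β ^ 2) ≤ (1 - ρ) * β ^ 2 := by
    rw [← Finset.sum_mul, ← A_x]
    have := G.A_le_one (G.x_mem_Icc d)
    have h3 : 0 ≤ (1 - ρ) * β ^ 2 := mul_nonneg (by linarith) (sq_nonneg _)
    nlinarith
  rw [h1, sub_le_iff_le_add]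
  refine le_trans ?_ (add_le_add le_rfl h2)
  rw [← Finset.sum_add_distrib]
  refine Finset.sum_le_sum fun k _ => ?_
  have ha := (G.a_pos k).le
  set r := G.energyRate β (G.segment k)
  have hr0 : 0 ≤ r := G.energyRate_nonneg hβ _
  have hrβ : r ≤ β := min_le_left _ _
  have h4 : (1 - ρ) * (β * r) ≤ (1 - ρ) * β ^ 2 :=
    mul_le_mul_of_nonneg_left (by nlinarith) (by linarith)
  have h5 : (ρ * r) ^ 2 ≤ r ^ 2 := by
    rw [mul_pow]; exact mul_le_of_le_one_left (sq_nonneg _) (by nlinarith)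
  have h6 : β * r - r ^ 2 / 2 ≤ (β * (ρ * r) - (ρ * r) ^ 2 / 2) + (1 - ρ) * β ^ 2 := by
    nlinarith
  nlinarith [mul_le_mul_of_nonneg_left h6 ha]

end GREM

/-! ### Families of independent standard Gaussian variables -/

section Gaussian

variable {ι : Type*} [Fintype ι]

/-- The joint law of independent standard Gaussian variables. -/
noncomputable def stdGaussianPi (ι : Type*) [Fintype ι] : Measure (ι → ℝ) :=
  Measure.pi fun _ => gaussianReal 0 1

instance : IsProbabilityMeasure (stdGaussianPi ι) := by
  unfold stdGaussianPi; infer_instance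

theorem stdGaussianPi_real_cylinder [DecidableEq ι] (F : Finset ι) (S : ι → Set ℝ) :
    (stdGaussianPi ι).real {X | ∀ c ∈ F, X c ∈ S c} = ∏ c ∈ F, (gaussianReal 0 1).real (S c) := by
  have h : {X : ι → ℝ | ∀ c ∈ F, X c ∈ S c} =
      Set.univ.pi fun c => if c ∈ F then S c else Set.univ := by
    ext X
    simp only [Set.mem_ofPred_eq, Set.mem_pi, Set.mem_univ, true_implies]
    refine forall_congr' fun c => ?_
    by_cases hc : c ∈ F <;> simp [hc]
  rw [measureReal_def, stdGaussianPi, h, Measure.pi_pi, ENNReal.toReal_prod]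
  have h2 : ∀ c, (gaussianReal 0 1 (if c ∈ F then S c else Set.univ)).toReal =
      if c ∈ F then (gaussianReal 0 1).real (S c) else 1 := fun c => by
    by_cases hc : c ∈ F <;> simp [hc, measureReal_def]
  simp only [h2, Finset.prod_ite_mem, Finset.univ_inter]

theorem integrable_exp_linear (v : ι → ℝ) :
    Integrable (fun X : ι → ℝ => Real.exp (∑ c, v c * X c)) (stdGaussianPi ι) := by
  simp only [Real.exp_sum]
  exact Integrable.fintype_prod (f := fun c t => Real.exp (v c * t))
    fun c => integrable_exp_mul_gaussianReal (v c)

theorem integral_exp_linear (v : ι → ℝ) :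
    ∫ X, Real.exp (∑ c, v c * X c) ∂(stdGaussianPi ι) = Real.exp (∑ c, v c ^ 2 / 2) := by
  simp only [Real.exp_sum]
  rw [stdGaussianPi, integral_fintype_prod_eq_prod (f := fun c t => Real.exp (v c * t))]
  refine Finset.prod_congr rfl fun c _ => ?_
  have := congr_fun (mgf_id_gaussianReal (μ := 0) (v := 1)) (v c)
  simpa [mgf] using this

/-- The exponential Chebyshev inequality for linear functionals. -/
theorem stdGaussianPi_real_le_linear (v : ι → ℝ) (t : ℝ) :
    (stdGaussianPi ι).real {X | t ≤ ∑ c, v c * X c} ≤ Real.exp (∑ c, v c ^ 2 / 2 - t) := by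
  have h := measure_ge_le_exp_mul_mgf (μ := stdGaussianPi ι) (X := fun X => ∑ c, v c * X c) t
    zero_le_one (by simpa using integrable_exp_linear v)
  simpa [mgf, integral_exp_linear, ← Real.exp_add, add_comm, sub_eq_add_neg] using h

theorem gaussianReal_real_Iic_le {t : ℝ} (ht : 0 ≤ t) :
    (gaussianReal 0 1).real (Set.Iic (-t)) ≤ Real.exp (-(t ^ 2 / 2)) := by
  have h := measure_le_le_exp_mul_mgf (μ := gaussianReal 0 1) (X := id) (t := -t) (-t)
    (by linarith) (integrable_exp_mul_gaussianReal (-t))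
  rw [congr_fun mgf_id_gaussianReal, ← Real.exp_add] at h
  refine h.trans_eq ?_
  congr 1
  simp
  ring

/-- The mass of the unit interval `[-t - 1, -t]` already suffices, with the density bounded below by
its value at the far end. -/
theorem le_gaussianReal_real_Iic {t : ℝ} (ht : 0 ≤ t) :
    (√(2 * Real.pi))⁻¹ * Real.exp (-((t + 1) ^ 2 / 2)) ≤
      (gaussianReal 0 1).real (Set.Iic (-t)) := by
  set c := (√(2 * Real.pi))⁻¹ * Real.exp (-((t + 1) ^ 2 / 2)) with hc
  have hc0 : 0 ≤ c := by positivity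
  have h1 : ENNReal.ofReal c ≤ gaussianReal 0 1 (Set.Icc (-t - 1) (-t)) := by
    rw [gaussianReal_apply 0 one_ne_zero]
    calc ENNReal.ofReal c = ENNReal.ofReal c * volume (Set.Icc (-t - 1) (-t)) := by
          rw [Real.volume_Icc]; simp
      _ = ∫⁻ _ in Set.Icc (-t - 1) (-t), ENNReal.ofReal c := by rw [setLIntegral_const]
      _ ≤ _ := by
          refine setLIntegral_mono (measurable_gaussianPDF 0 1) fun x hx => ?_
          rw [gaussianPDF]
          refine ENNReal.ofReal_le_ofReal ?_
          rw [hc, gaussianPDFReal]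
          simp only [NNReal.coe_one, mul_one, sub_zero]
          gcongr
          rw [neg_div, neg_le_neg_iff]
          have h3 : x ^ 2 ≤ (t + 1) ^ 2 := by
            rw [sq_le_sq]
            rw [abs_of_nonneg (by linarith : 0 ≤ t + 1), abs_le]
            constructor <;> linarith [hx.1, hx.2]
          linarith
  have h2 := h1.trans (measure_mono (Set.Icc_subset_Iic_self))
  rw [measureReal_def]
  rwa [ENNReal.ofReal_le_iff_le_toReal (measure_ne_top _ _)] at h2

/-- Gaussian tails at the scale `√N`, up to subexponential factors. -/
theorem eventually_le_gaussianReal_real_Iic {c ε : ℝ} (hc : 0 ≤ c) (hε : 0 < ε) :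
    ∀ᶠ N : ℕ in atTop, Real.exp (-((c ^ 2 / 2 + ε) * N)) ≤
      (gaussianReal 0 1).real (Set.Iic (-(c * √(N : ℝ)))) := by
  have hsqrt : Tendsto (fun N : ℕ => √(N : ℝ)) atTop atTop :=
    Real.tendsto_sqrt_atTop.comp tendsto_natCast_atTop_atTop
  -- Expanding `(c √N + 1)² / 2` leaves terms of order `√N` and `1`; together with the normalization
  -- they are at most `K √N ≤ ε N`.
  set K := Real.log (√(2 * Real.pi)) + 1 / 2 + c with hK
  have hev := hsqrt.eventually_ge_atTop (max 1 (|K| / ε))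
  filter_upwards [hev] with N hN
  have hN1 : 1 ≤ √(N : ℝ) := (le_max_left _ _).trans hN
  have hN2 : |K| ≤ ε * √(N : ℝ) := by
    have := (le_max_right _ _).trans hN
    rw [div_le_iff₀ hε] at this
    linarith
  refine le_trans ?_ (le_gaussianReal_real_Iic (mul_nonneg hc (Real.sqrt_nonneg _)))
  have hpi : 0 < √(2 * Real.pi) := Real.sqrt_pos.2 (by positivity)
  have h1 : (√(2 * Real.pi))⁻¹ = Real.exp (-Real.log (√(2 * Real.pi))) := by
    rw [Real.exp_neg, Real.exp_log hpi]
  rw [h1, ← Real.exp_add, Real.exp_le_exp]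
  have hsq : √(N : ℝ) ^ 2 = N := Real.sq_sqrt (Nat.cast_nonneg _)
  have hlog : Real.log (√(2 * Real.pi)) + 1 / 2 + c ≤ ε * √(N : ℝ) := (le_abs_self _).trans hN2
  have hlog0 : 0 ≤ Real.log (√(2 * Real.pi)) :=
    Real.log_nonneg (Real.one_le_sqrt.2 (by linarith [Real.pi_gt_three]))
  have hlin : (c ^ 2 / 2 + ε) * N = (c ^ 2 / 2 + ε) * √(N : ℝ) ^ 2 := by rw [hsq]
  rw [hlin]
  nlinarith [mul_le_mul_of_nonneg_right hlog (Real.sqrt_nonneg (N : ℝ)),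
    mul_le_mul_of_nonneg_left hN1 hlog0]

end Gaussian

/-! ### The second moment method -/

/-- Chebyshev's inequality: the hypothesis bounds the variance of the count by `δ w²`, and a
deviation of `w / 2` accounts for the factor four. -/
theorem second_moment_bound {Ω ι : Type*} [Fintype ι] [MeasurableSpace Ω] {μ : Measure Ω}
    [IsProbabilityMeasure μ] {E : ι → Set Ω} (hE : ∀ i, MeasurableSet (E i)) {w δ : ℝ}
    (hw : 0 < w) (hw1 : ∑ i, μ.real (E i) = w)
    (hw2 : ∑ i, ∑ j, μ.real (E i ∩ E j) ≤ w ^ 2 * (1 + δ)) :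
    μ.real {x | ∑ i, (E i).indicator 1 x < w / 2} ≤ 4 * δ := by
  set W : Ω → ℝ := fun x => ∑ i, (E i).indicator 1 x with hW
  have hint : ∀ i, Integrable ((E i).indicator (1 : Ω → ℝ)) μ := fun i =>
    (integrable_const (1 : ℝ)).indicator (hE i)
  have hint2 : ∀ i j, Integrable ((E i ∩ E j).indicator (1 : Ω → ℝ)) μ := fun i j =>
    (integrable_const (1 : ℝ)).indicator ((hE i).inter (hE j))
  have hsq : ∀ x, (W x - w) ^ 2 =
      (∑ i, ∑ j, (E i ∩ E j).indicator (1 : Ω → ℝ) x) - 2 * w * ∑ i, (E i).indicator 1 x +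
        w ^ 2 := fun x => by
    simp only [Set.inter_indicator_one, Pi.mul_apply, ← Finset.mul_sum, ← Finset.sum_mul, hW]
    ring
  have hI1 : Integrable (fun x => ∑ i, ∑ j, (E i ∩ E j).indicator (1 : Ω → ℝ) x) μ :=
    integrable_finsetSum _ fun i _ => integrable_finsetSum _ fun j _ => hint2 i j
  have hI2 : Integrable (fun x => 2 * w * ∑ i, (E i).indicator (1 : Ω → ℝ) x) μ :=
    (integrable_finsetSum _ fun i _ => hint i).const_mul _
  have hI : Integrable (fun x => (W x - w) ^ 2) μ := by
    simp only [hsq]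
    exact (hI1.sub hI2).add (integrable_const _)
  have hval : ∫ x, (W x - w) ^ 2 ∂μ ≤ δ * w ^ 2 := by
    have hI12 : Integrable (fun x => (∑ i, ∑ j, (E i ∩ E j).indicator (1 : Ω → ℝ) x) -
        2 * w * ∑ i, (E i).indicator (1 : Ω → ℝ) x) μ := hI1.sub hI2
    simp only [hsq]
    rw [integral_add hI12 (integrable_const _), integral_sub hI1 hI2,
      integral_const_mul, integral_finsetSum _ fun i _ => hint i,
      integral_finsetSum _ fun i _ => integrable_finsetSum _ fun j _ => hint2 i j]
    have e1 : ∀ i, ∫ x, ∑ j, (E i ∩ E j).indicator (1 : Ω → ℝ) x ∂μ =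
        ∑ j, μ.real (E i ∩ E j) := fun i => by
      rw [integral_finsetSum _ fun j _ => hint2 i j]
      exact Finset.sum_congr rfl fun j _ => integral_indicator_one ((hE i).inter (hE j))
    have e2 : ∀ i, ∫ x, (E i).indicator (1 : Ω → ℝ) x ∂μ = μ.real (E i) := fun i =>
      integral_indicator_one (hE i)
    simp only [e1, e2, hw1, integral_const, probReal_univ, one_smul]
    nlinarith
  have hmark := mul_meas_ge_le_integral_of_nonneg
    (Eventually.of_forall fun x => sq_nonneg (W x - w)) hI ((w / 2) ^ 2)
  have hmono : μ.real {x | W x < w / 2} ≤ μ.real {x | (w / 2) ^ 2 ≤ (W x - w) ^ 2} := by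
    refine measureReal_mono fun x hx => ?_
    simp only [Set.mem_ofPred_eq] at hx ⊢
    nlinarith
  have h4 : (w / 2) ^ 2 * μ.real {x | W x < w / 2} ≤ (w / 2) ^ 2 * (4 * δ) := by
    have := mul_le_mul_of_nonneg_left hmono (sq_nonneg (w / 2))
    linarith
  exact le_of_mul_le_mul_left h4 (by positivity)

namespace GREM

variable (G : GREM) (N : ℕ)

/-! ### The Gaussian variables of the GREM -/

/-- The number of spins in the first `d` blocks. -/
noncomputable def cut (d : Fin (G.n + 1)) : ℕ := ⌈G.x d * N⌉₊

theorem cut_zero : G.cut N 0 = 0 := by simp [cut, G.x_zero]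

theorem cut_mono : Monotone (G.cut N) := fun c d hcd => by
  unfold cut
  have := G.x_strictMono.monotone hcd
  gcongr

theorem cut_le (d : Fin (G.n + 1)) : G.cut N d ≤ N := by
  rw [cut, Nat.ceil_le]
  exact mul_le_of_le_one_left (Nat.cast_nonneg _) (G.x_mem_Icc d).2

theorem le_cut (d : Fin (G.n + 1)) : G.x d * N ≤ G.cut N d := Nat.le_ceil _

theorem cut_le_add_one (d : Fin (G.n + 1)) : (G.cut N d : ℝ) ≤ G.x d * N + 1 :=
  (Nat.ceil_lt_add_one (mul_nonneg (G.x_mem_Icc d).1 (Nat.cast_nonneg _))).le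

theorem card_sitesFrom_add (p : ℕ) (hp : p ≤ N) : (sitesFrom N p).card + p = N := by
  have h : (sitesFrom N p)ᶜ.card = p := by
    have : (sitesFrom N p)ᶜ = Finset.univ.filter fun j : Fin N => (j : ℕ) < p := by
      ext j; simp [sitesFrom]
    rw [this, Fin.card_filter_val_lt, min_eq_right hp]
  have := Finset.card_add_card_compl (sitesFrom N p)
  rw [h, Fintype.card_fin] at this
  exact this

variable {N}

/-- The index of the Gaussian variable which `σ` sees at the level `k`. -/
def node (k : Fin G.n) (σ : HammingCube N) : Σ k : Fin G.n, G.Prefix N k := ⟨k, fun i => σ i⟩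

variable {G}

theorem node_eq_node_iff {k : Fin G.n} {σ τ : HammingCube N} :
    G.node k σ = G.node k τ ↔ ∀ j : Fin N, (j : ℕ) < G.cut N k.succ → σ j = τ j := by
  simp only [node, Sigma.mk.injEq, heq_eq_eq, true_and, funext_iff, Subtype.forall]
  rfl

theorem eq_of_node_eq_node {k l : Fin G.n} {σ τ : HammingCube N} (h : G.node k σ = G.node l τ) :
    k = l := congr_arg Sigma.fst h

theorem node_eq_node_of_le {k l : Fin G.n} (hkl : k ≤ l) {σ τ : HammingCube N}
    (h : G.node l σ = G.node l τ) : G.node k σ = G.node k τ := by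
  rw [node_eq_node_iff] at h ⊢
  exact fun j hj => h j (hj.trans_le (G.cut_mono N (Fin.succ_le_succ_iff.2 hkl)))

variable (G)

/-- The part of the potential which belongs to a set of levels. -/
noncomputable def potentialOn (S : Finset (Fin G.n)) (X : (Σ k : Fin G.n, G.Prefix N k) → ℝ)
    (σ : HammingCube N) : ℝ :=
  √(N : ℝ) * ∑ k ∈ S, √(G.a k) * X (G.node k σ)

theorem potentialOn_univ (X : (Σ k : Fin G.n, G.Prefix N k) → ℝ) :
    G.potentialOn Finset.univ X = G.potential N X := rfl

theorem potentialOn_add_compl (S : Finset (Fin G.n)) (X : (Σ k : Fin G.n, G.Prefix N k) → ℝ)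
    (σ : HammingCube N) :
    G.potentialOn S X σ + G.potentialOn Sᶜ X σ = G.potential N X σ := by
  rw [← potentialOn_univ, potentialOn, potentialOn, potentialOn, ← mul_add,
    Finset.sum_add_sum_compl]

theorem potentialOn_levels_congr {d : Fin (G.n + 1)} (X : (Σ k : Fin G.n, G.Prefix N k) → ℝ)
    {σ τ : HammingCube N} (h : ∀ j : Fin N, (j : ℕ) < G.cut N d → σ j = τ j) :
    G.potentialOn (G.levels d) X σ = G.potentialOn (G.levels d) X τ := by
  unfold potentialOn
  congr 1
  refine Finset.sum_congr rfl fun k hk => ?_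
  rw [node_eq_node_iff.2 fun j hj =>
    h j (hj.trans_le (G.cut_mono N (mem_levels_iff_succ_le.1 hk)))]

theorem a_le_one (k : Fin G.n) : G.a k ≤ 1 := by
  rw [← G.sum_a]
  exact Finset.single_le_sum (fun i _ => (G.a_pos i).le) (Finset.mem_univ k)

/-! ### Exceptionally low energies are rare -/

/-- The energy of `σ` at the level `k` is extensive and negative. -/
def IsDeep (ε : ℝ) (X : (Σ k : Fin G.n, G.Prefix N k) → ℝ) (k : Fin G.n) (σ : HammingCube N) :
    Prop :=
  √(N : ℝ) * (√(G.a k) * X (G.node k σ)) ≤ -(ε * N)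

variable {G}

theorem IsDeep.le {ε : ℝ} (hε : 0 < ε) {X : (Σ k : Fin G.n, G.Prefix N k) → ℝ} {k : Fin G.n}
    {σ : HammingCube N} (hN : 0 < N) (h : G.IsDeep ε X k σ) :
    X (G.node k σ) ∈ Set.Iic (-(ε * √(N : ℝ))) := by
  rw [Set.mem_Iic]
  have hs : 0 < √(N : ℝ) := Real.sqrt_pos.2 (Nat.cast_pos.2 hN)
  have ha : 0 < √(G.a k) := Real.sqrt_pos.2 (G.a_pos k)
  have ha1 : √(G.a k) ≤ 1 := Real.sqrt_le_one.2 (G.a_le_one k)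
  have hsq : √(N : ℝ) * √(N : ℝ) = N := Real.mul_self_sqrt (Nat.cast_nonneg _)
  have h1 : √(G.a k) * X (G.node k σ) ≤ -(ε * √(N : ℝ)) := by
    refine le_of_mul_le_mul_left (h.trans_eq ?_) hs
    linear_combination ε * hsq
  have h2 : X (G.node k σ) ≤ 0 := by
    by_contra hcon
    have := mul_pos ha (not_le.1 hcon)
    nlinarith [mul_pos hε hs]
  nlinarith

variable (G)

/-- With high probability, every configuration has few neighbours of exceptionally low energy. -/
theorem measure_many_deep_le {ε : ℝ} (hε : 0 < ε) (hN : 0 < N) (r : ℕ) :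
    (stdGaussianPi (Σ k : Fin G.n, G.Prefix N k)).real
      {X | ¬ ∀ k σ, Set.ncard {j : Fin N | (j : ℕ) < G.cut N k.succ ∧
        G.IsDeep ε X k (flipSpin j σ)} ≤ r} ≤
      G.n * (2 ^ N * 2 ^ N) * Real.exp (-((ε * √(N : ℝ)) ^ 2 / 2)) ^ (r + 1) := by
  classical
  set q := Real.exp (-((ε * √(N : ℝ)) ^ 2 / 2)) with hq
  -- The union bound runs over a level, a centre and a set of `r + 1` spins, of which there are at
  -- most `n · 2 ^ N · 2 ^ N` triples.
  set S : Fin G.n × HammingCube N × Finset (Fin N) →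
      Set ((Σ k : Fin G.n, G.Prefix N k) → ℝ) := fun t =>
    {X | (t.2.2.card = r + 1 ∧ ∀ j ∈ t.2.2, (j : ℕ) < G.cut N t.1.succ) ∧
      ∀ j ∈ t.2.2, X (G.node t.1 (flipSpin j t.2.1)) ∈ Set.Iic (-(ε * √(N : ℝ)))} with hS
  have hsub : {X | ¬ ∀ k σ, Set.ncard {j : Fin N | (j : ℕ) < G.cut N k.succ ∧
      G.IsDeep ε X k (flipSpin j σ)} ≤ r} ⊆ ⋃ t, S t := by
    intro X hX
    simp only [Set.mem_ofPred_eq, not_forall, not_le] at hX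
    obtain ⟨k, σ, hX⟩ := hX
    set D := (Finset.univ.filter fun j : Fin N => (j : ℕ) < G.cut N k.succ ∧
      G.IsDeep ε X k (flipSpin j σ)) with hD
    have hcard : r + 1 ≤ D.card := by
      rw [← Set.ncard_coe_finset, hD]
      simpa using hX
    obtain ⟨J, hJD, hJ⟩ := Finset.exists_subset_card_eq hcard
    refine Set.mem_iUnion.2 ⟨(k, σ, J), ⟨hJ, fun j hj => ?_⟩, fun j hj => ?_⟩
    · exact (Finset.mem_filter.1 (hJD hj)).2.1
    · exact (Finset.mem_filter.1 (hJD hj)).2.2.le hε hN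
  have hmeas : ∀ t, (stdGaussianPi (Σ k : Fin G.n, G.Prefix N k)).real (S t) ≤ q ^ (r + 1) := by
    rintro ⟨k, σ, J⟩
    by_cases hJ : J.card = r + 1 ∧ ∀ j ∈ J, (j : ℕ) < G.cut N k.succ
    · have hinj : Set.InjOn (fun j => G.node k (flipSpin j σ)) J := by
        intro i hi j hj hij
        by_contra hne
        have := node_eq_node_iff.1 hij i (hJ.2 i hi)
        rw [flipSpin_same, flipSpin_of_ne hne] at this
        exact units_ne_neg_self (σ i) this.symm
      have heq : S (k, σ, J) = {X | ∀ c ∈ J.image (fun j => G.node k (flipSpin j σ)),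
          X c ∈ Set.Iic (-(ε * √(N : ℝ)))} := by
        ext X
        simp only [hS, Set.mem_ofPred_eq, Finset.forall_mem_image]
        exact ⟨fun h => h.2, fun h => ⟨hJ, h⟩⟩
      rw [heq, stdGaussianPi_real_cylinder _ fun _ => Set.Iic (-(ε * √(N : ℝ))),
        Finset.prod_const, Finset.card_image_of_injOn hinj, hJ.1]
      exact pow_le_pow_left₀ measureReal_nonneg
        (gaussianReal_real_Iic_le (mul_nonneg hε.le (Real.sqrt_nonneg _))) _
    · have heq : S (k, σ, J) = ∅ := by
        ext X
        simp only [hS, Set.mem_ofPred_eq, Set.mem_empty_iff_false, iff_false]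
        exact fun h => hJ h.1
      rw [heq, measureReal_empty]
      positivity
  calc _ ≤ (stdGaussianPi (Σ k : Fin G.n, G.Prefix N k)).real (⋃ t, S t) :=
        measureReal_mono hsub
    _ ≤ ∑ t, (stdGaussianPi (Σ k : Fin G.n, G.Prefix N k)).real (S t) :=
        measureReal_iUnion_fintype_le _
    _ ≤ ∑ _t : Fin G.n × HammingCube N × Finset (Fin N), q ^ (r + 1) :=
        Finset.sum_le_sum fun t _ => hmeas t
    _ = _ := by
        rw [Finset.sum_const, nsmul_eq_mul, Finset.card_univ, Fintype.card_prod,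
          Fintype.card_prod, Fintype.card_finset, Fintype.card_fin, Fintype.card_fun,
          Fintype.card_fin, Fintype.card_units_int]
        push_cast
        rfl

/-! ### Exponential moments of the energies -/

/-- The coefficients of the linear functional `∑_{k ∈ S} w k X_{σ₁⋯σ_k}`. -/
noncomputable def pathCoeff (S : Finset (Fin G.n)) (w : Fin G.n → ℝ) (σ : HammingCube N)
    (c : Σ k : Fin G.n, G.Prefix N k) : ℝ :=
  open Classical in if c.1 ∈ S ∧ c = G.node c.1 σ then w c.1 else 0

/-- A general `f` vanishing at zero coefficients covers both the linear functional itself and its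
variance. -/
theorem sum_pathCoeff (S : Finset (Fin G.n)) (w : Fin G.n → ℝ) (σ : HammingCube N)
    (f : ℝ → (Σ k : Fin G.n, G.Prefix N k) → ℝ) (hf : ∀ c, f 0 c = 0) :
    ∑ c, f (G.pathCoeff S w σ c) c = ∑ k ∈ S, f (w k) (G.node k σ) := by
  classical
  rw [Fintype.sum_sigma, ← Finset.sum_subset (Finset.subset_univ S)]
  · refine Finset.sum_congr rfl fun k hk => ?_
    rw [Finset.sum_eq_single (fun i => σ i : G.Prefix N k)]
    · rw [pathCoeff, if_pos ⟨hk, rfl⟩]; rfl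
    · intro p _ hp
      rw [pathCoeff, if_neg, hf]
      rintro ⟨-, h⟩
      exact hp (by simpa [node] using h)
    · simp
  · intro k _ hk
    refine Finset.sum_eq_zero fun p _ => ?_
    rw [pathCoeff, if_neg (fun h => hk h.1), hf]

theorem sum_exp_path_integrable (S : Finset (Fin G.n)) (w : Fin G.n → ℝ) :
    Integrable (fun X => ∑ σ : HammingCube N, Real.exp (∑ k ∈ S, w k * X (G.node k σ)))
      (stdGaussianPi (Σ k : Fin G.n, G.Prefix N k)) := by
  refine integrable_finsetSum _ fun σ _ => ?_
  have := integrable_exp_linear (G.pathCoeff S w σ)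
  refine this.congr (Eventually.of_forall fun X => ?_)
  simp only
  rw [G.sum_pathCoeff S w σ (fun t c => t * X c) fun c => zero_mul _]

theorem integral_sum_exp_path (S : Finset (Fin G.n)) (w : Fin G.n → ℝ) :
    ∫ X, ∑ σ : HammingCube N, Real.exp (∑ k ∈ S, w k * X (G.node k σ))
      ∂(stdGaussianPi (Σ k : Fin G.n, G.Prefix N k)) =
      2 ^ N * Real.exp (∑ k ∈ S, w k ^ 2 / 2) := by
  have h : ∀ σ : HammingCube N, (fun X : (Σ k : Fin G.n, G.Prefix N k) → ℝ =>
      Real.exp (∑ k ∈ S, w k * X (G.node k σ))) =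
      fun X => Real.exp (∑ c, G.pathCoeff S w σ c * X c) := fun σ => by
    funext X
    rw [G.sum_pathCoeff S w σ (fun t c => t * X c) fun c => zero_mul _]
  rw [integral_finsetSum _ fun σ _ => by rw [h σ]; exact integrable_exp_linear _]
  have h2 : ∀ σ : HammingCube N, ∫ X, Real.exp (∑ k ∈ S, w k * X (G.node k σ))
      ∂(stdGaussianPi (Σ k : Fin G.n, G.Prefix N k)) = Real.exp (∑ k ∈ S, w k ^ 2 / 2) :=
    fun σ => by
      rw [h σ, integral_exp_linear,
        G.sum_pathCoeff S w σ (fun t _ => t ^ 2 / 2) fun c => by norm_num]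
  simp only [h2, Finset.sum_const, nsmul_eq_mul, Finset.card_univ, Fintype.card_fun,
    Fintype.card_fin, Fintype.card_units_int]
  push_cast
  rfl

theorem measure_sum_exp_path_gt_le (S : Finset (Fin G.n)) (w : Fin G.n → ℝ) (t : ℝ) :
    (stdGaussianPi (Σ k : Fin G.n, G.Prefix N k)).real
      {X | 2 ^ N * Real.exp (∑ k ∈ S, w k ^ 2 / 2 + t) <
        ∑ σ : HammingCube N, Real.exp (∑ k ∈ S, w k * X (G.node k σ))} ≤ Real.exp (-t) := by
  set m := 2 ^ N * Real.exp (∑ k ∈ S, w k ^ 2 / 2 + t) with hm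
  have hm0 : 0 < m := by positivity
  have h := mul_meas_ge_le_integral_of_nonneg
    (Eventually.of_forall fun X => Finset.sum_nonneg fun σ _ => (Real.exp_pos _).le)
    (G.sum_exp_path_integrable (N := N) S w) m
  rw [integral_sum_exp_path] at h
  have hmono : (stdGaussianPi (Σ k : Fin G.n, G.Prefix N k)).real
      {X | m < ∑ σ : HammingCube N, Real.exp (∑ k ∈ S, w k * X (G.node k σ))} ≤
      (stdGaussianPi (Σ k : Fin G.n, G.Prefix N k)).real
      {X | m ≤ ∑ σ : HammingCube N, Real.exp (∑ k ∈ S, w k * X (G.node k σ))} :=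
    measureReal_mono (Set.ofPred_subset_ofPred.2 fun X hX => le_of_lt hX)
  refine hmono.trans (le_of_mul_le_mul_left (h.trans_eq ?_) hm0)
  rw [hm, mul_assoc, ← Real.exp_add]
  congr 2
  ring

end GREM

namespace GREM

variable (G : GREM) {N : ℕ}

/-! ### The number of configurations of prescribed low energy -/

/-- The event that the variables which `σ` sees in the first `d` levels lie below thresholds. -/
def lowEvent (d : Fin (G.n + 1)) (s : Fin G.n → ℝ) (σ : HammingCube N) :
    Set ((Σ k : Fin G.n, G.Prefix N k) → ℝ) :=
  {X | ∀ k ∈ G.levels d, X (G.node k σ) ≤ s k}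

/-- The probability that a standard Gaussian variable lies below `t`. -/
noncomputable def gaussianTail (t : ℝ) : ℝ := (gaussianReal 0 1).real (Set.Iic t)

variable {G}

theorem node_injective_level (σ : HammingCube N) : Function.Injective fun k => G.node k σ :=
  fun _ _ h => eq_of_node_eq_node h

theorem lowEvent_inter_eq [DecidableEq (Σ k : Fin G.n, G.Prefix N k)] (d : Fin (G.n + 1))
    (s : Fin G.n → ℝ) (σ τ : HammingCube N) :
    G.lowEvent d s σ ∩ G.lowEvent d s τ =
      {X | ∀ c ∈ (G.levels d).image (fun k => G.node k σ) ∪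
        (G.levels d).image (fun k => G.node k τ), X c ∈ Set.Iic (s c.1)} := by
  ext X
  simp only [lowEvent, Set.mem_inter_iff, Set.mem_ofPred_eq, Finset.forall_mem_union,
    Finset.forall_mem_image, Set.mem_Iic]
  rfl

theorem measurableSet_lowEvent (d : Fin (G.n + 1)) (s : Fin G.n → ℝ) (σ : HammingCube N) :
    MeasurableSet (G.lowEvent d s σ) := by
  have : G.lowEvent d s σ = ⋂ k ∈ G.levels d, {X | X (G.node k σ) ≤ s k} := by
    ext X; simp [lowEvent]
  rw [this]
  exact Finset.measurableSet_biInter _ fun k _ =>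
    measurableSet_le (measurable_pi_apply _) measurable_const

theorem measure_lowEvent (d : Fin (G.n + 1)) (s : Fin G.n → ℝ) (σ : HammingCube N) :
    (stdGaussianPi (Σ k : Fin G.n, G.Prefix N k)).real (G.lowEvent d s σ) =
      ∏ k ∈ G.levels d, gaussianTail (s k) := by
  classical
  rw [← Set.inter_self (G.lowEvent d s σ), lowEvent_inter_eq, Finset.union_self,
    stdGaussianPi_real_cylinder _ (fun c : Σ k : Fin G.n, G.Prefix N k => Set.Iic (s c.1)),
    Finset.prod_image fun k _ l _ h => node_injective_level σ h]
  rfl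

/-- By the tree structure the variables common to `σ` and `τ` are those of an initial run of levels.
The joint probability is the product of the two probabilities divided by that of the common part;
bounding the reciprocal by a sum over all common levels prepares for counting pairs level by level.
-/
theorem measure_lowEvent_inter_le (d : Fin (G.n + 1)) {s : Fin G.n → ℝ}
    (hs : ∀ k, 0 < gaussianTail (s k)) (σ τ : HammingCube N) [DecidableEq (Σ k : Fin G.n, G.Prefix N k)] :
    (stdGaussianPi (Σ k : Fin G.n, G.Prefix N k)).real (G.lowEvent d s σ ∩ G.lowEvent d s τ) ≤
      (∏ k ∈ G.levels d, gaussianTail (s k)) ^ 2 *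
        (1 + ∑ k ∈ G.levels d, if G.node k σ = G.node k τ then
          (∏ i ∈ G.levels k.succ, gaussianTail (s i))⁻¹ else 0) := by
  set P := ∏ k ∈ G.levels d, gaussianTail (s k)
  set C := (G.levels d).filter fun k => G.node k σ = G.node k τ with hC
  have hinter : (G.levels d).image (fun k => G.node k σ) ∩
      (G.levels d).image (fun k => G.node k τ) = C.image fun k => G.node k σ := by
    ext c
    simp only [Finset.mem_inter, Finset.mem_image, hC, Finset.mem_filter]
    constructor
    · rintro ⟨⟨k, hk, rfl⟩, ⟨l, hl, h⟩⟩
      obtain rfl := eq_of_node_eq_node h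
      exact ⟨l, ⟨hk, h.symm⟩, rfl⟩
    · rintro ⟨k, ⟨hk, h⟩, rfl⟩
      exact ⟨⟨k, hk, rfl⟩, ⟨k, hk, h.symm⟩⟩
  have hCpos : 0 < ∏ k ∈ C, gaussianTail (s k) := Finset.prod_pos fun k _ => hs k
  have hprod : (stdGaussianPi (Σ k : Fin G.n, G.Prefix N k)).real
      (G.lowEvent d s σ ∩ G.lowEvent d s τ) * ∏ k ∈ C, gaussianTail (s k) = P ^ 2 := by
    have h := Finset.prod_union_inter (s₁ := (G.levels d).image fun k => G.node k σ)
      (s₂ := (G.levels d).image fun k => G.node k τ) (f := fun c => gaussianTail (s c.1))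
    rw [hinter, Finset.prod_image fun k _ l _ h => node_injective_level σ h,
      Finset.prod_image fun k _ l _ h => node_injective_level σ h,
      Finset.prod_image fun k _ l _ h => node_injective_level τ h] at h
    rw [lowEvent_inter_eq, stdGaussianPi_real_cylinder _ (fun c : Σ k : Fin G.n, G.Prefix N k => Set.Iic (s c.1)), sq]
    exact h
  rw [eq_div_of_mul_eq hCpos.ne' hprod, div_eq_mul_inv]
  refine mul_le_mul_of_nonneg_left ?_ (sq_nonneg _)
  have hnonneg : ∀ k ∈ G.levels d, 0 ≤ if G.node k σ = G.node k τ then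
      (∏ i ∈ G.levels k.succ, gaussianTail (s i))⁻¹ else 0 := fun k _ => by
    split_ifs
    · exact inv_nonneg.2 (Finset.prod_nonneg fun i _ => (hs i).le)
    · exact le_rfl
  rcases C.eq_empty_or_nonempty with hempty | hne
  · rw [hempty, Finset.prod_empty, inv_one]
    linarith [Finset.sum_nonneg hnonneg]
  · obtain ⟨k, hk, hmax⟩ := C.exists_max_image id hne
    have hk' := Finset.mem_filter.1 hk
    have hCk : C = G.levels k.succ := by
      ext i
      rw [mem_levels_iff_succ_le, Fin.succ_le_succ_iff]
      refine ⟨fun hi => hmax i hi, fun hi => ?_⟩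
      refine Finset.mem_filter.2 ⟨?_, node_eq_node_of_le hi hk'.2⟩
      rw [mem_levels_iff_succ_le]
      exact (Fin.succ_le_succ_iff.2 hi).trans (mem_levels_iff_succ_le.1 hk'.1)
    have h := Finset.single_le_sum hnonneg hk'.1
    rw [if_pos hk'.2, ← hCk] at h
    linarith

theorem card_node_eq [DecidableEq (Σ k : Fin G.n, G.Prefix N k)] (k : Fin G.n)
    (σ : HammingCube N) :
    (Finset.univ.filter fun τ : HammingCube N => G.node k σ = G.node k τ).card =
      2 ^ (sitesFrom N (G.cut N k.succ)).card := by
  rw [← card_agree _ σ]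
  congr 1
  ext τ
  simp [node_eq_node_iff, mem_sitesFrom]

theorem card_hammingCube : Fintype.card (HammingCube N) = 2 ^ N := by
  rw [Fintype.card_fun, Fintype.card_fin, Fintype.card_units_int]

/-- The second moment method for the number of configurations of prescribed low energy. -/
theorem measure_few_low_le (d : Fin (G.n + 1)) {s : Fin G.n → ℝ}
    (hs : ∀ k, 0 < gaussianTail (s k)) :
    (stdGaussianPi (Σ k : Fin G.n, G.Prefix N k)).real
      {X | ∑ σ, (G.lowEvent d s σ).indicator 1 X <
        (2 ^ N * ∏ k ∈ G.levels d, gaussianTail (s k)) / 2} ≤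
      4 * ∑ k ∈ G.levels d,
        (2 ^ G.cut N k.succ * ∏ i ∈ G.levels k.succ, gaussianTail (s i))⁻¹ := by
  classical
  set P := ∏ k ∈ G.levels d, gaussianTail (s k) with hP
  have hP0 : 0 < P := Finset.prod_pos fun k _ => hs k
  refine second_moment_bound (fun σ => measurableSet_lowEvent d s σ) (by positivity) ?_ ?_
  · simp only [measure_lowEvent, Finset.sum_const, nsmul_eq_mul, Finset.card_univ,
      card_hammingCube]
    push_cast
    rfl
  -- For fixed `σ`, the number of `τ` sharing its prefix up to level `k` is `2 ^ (N - cut)`.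
  -- Relative to `2 ^ N` this turns each correction into the reciprocal of an expected number of low
  -- prefixes.
  · have hstep : ∀ σ : HammingCube N, ∑ τ, (stdGaussianPi (Σ k : Fin G.n, G.Prefix N k)).real
        (G.lowEvent d s σ ∩ G.lowEvent d s τ) ≤ P ^ 2 * (2 ^ N + ∑ k ∈ G.levels d,
          2 ^ (sitesFrom N (G.cut N k.succ)).card *
            (∏ i ∈ G.levels k.succ, gaussianTail (s i))⁻¹) := by
      intro σ
      refine (Finset.sum_le_sum fun τ _ => measure_lowEvent_inter_le d hs σ τ).trans_eq ?_
      rw [← Finset.mul_sum, Finset.sum_add_distrib, Finset.sum_comm]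
      congr 2
      · rw [Finset.sum_const, Finset.card_univ, card_hammingCube, nsmul_eq_mul, mul_one]
        push_cast
        rfl
      · refine Finset.sum_congr rfl fun k _ => ?_
        rw [← Finset.sum_filter, Finset.sum_const, card_node_eq, nsmul_eq_mul]
        push_cast
        rfl
    refine (Finset.sum_le_sum fun σ _ => hstep σ).trans_eq ?_
    rw [Finset.sum_const, Finset.card_univ, card_hammingCube, nsmul_eq_mul, mul_pow, mul_add,
      mul_add, mul_add, Finset.mul_sum, Finset.mul_sum, Finset.mul_sum]
    push_cast
    congr 1
    · ring
    · refine Finset.sum_congr rfl fun k _ => ?_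
      have h := card_sitesFrom_add N (G.cut N k.succ) (G.cut_le N _)
      have h2 : (2 : ℝ) ^ N = 2 ^ (sitesFrom N (G.cut N k.succ)).card * 2 ^ G.cut N k.succ := by
        rw [← pow_add, h]
      rw [mul_inv]
      rw [h2]
      field_simp

/-! ### Averages of the potential over the last blocks -/

variable (G)

/-- The coefficients of the average over the blocks after the first `d` of the potential of the
levels after the first `d`, as a linear functional of the Gaussian variables. -/
noncomputable def averageCoeff (d : Fin (G.n + 1)) (σ : HammingCube N)
    (c : Σ k : Fin G.n, G.Prefix N k) : ℝ :=
  open Classical in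
  if c.1 ∈ G.levels d then 0 else √(N : ℝ) * √(G.a c.1) *
    (((2 : ℝ) ^ (sitesFrom N (G.cut N d)).card)⁻¹ *
      (Finset.univ.filter fun τ : HammingCube N =>
        (∀ j ∉ sitesFrom N (G.cut N d), σ j = τ j) ∧ c = G.node c.1 τ).card)

theorem spinAverage_potentialOn_compl (d : Fin (G.n + 1)) (σ : HammingCube N)
    (X : (Σ k : Fin G.n, G.Prefix N k) → ℝ) :
    spinAverage (sitesFrom N (G.cut N d)) (G.potentialOn (G.levels d)ᶜ X) σ =
      ∑ c, G.averageCoeff d σ c * X c := by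
  classical
  rw [Fintype.sum_sigma, ← Finset.sum_subset (Finset.subset_univ (G.levels d)ᶜ)]
  · simp only [spinAverage, potentialOn]
    rw [← Finset.sum_filter, Finset.mul_sum]
    simp only [Finset.mul_sum]
    rw [Finset.sum_comm]
    refine Finset.sum_congr rfl fun k hk => ?_
    rw [Finset.mem_compl] at hk
    have hfib := Finset.sum_fiberwise (s := Finset.univ.filter fun τ : HammingCube N =>
      ∀ j ∉ sitesFrom N (G.cut N d), σ j = τ j) (fun τ => (fun i => τ i : G.Prefix N k))
      (fun τ => ((2 : ℝ) ^ (sitesFrom N (G.cut N d)).card)⁻¹ *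
        (√(N : ℝ) * (√(G.a k) * X (G.node k τ))))
    rw [← hfib]
    refine Finset.sum_congr rfl fun p _ => ?_
    have hconst : ∀ τ ∈ (Finset.univ.filter fun τ : HammingCube N =>
        ∀ j ∉ sitesFrom N (G.cut N d), σ j = τ j).filter (fun τ => (fun i => τ i : G.Prefix N k) = p),
        ((2 : ℝ) ^ (sitesFrom N (G.cut N d)).card)⁻¹ *
          (√(N : ℝ) * (√(G.a k) * X (G.node k τ))) =
        ((2 : ℝ) ^ (sitesFrom N (G.cut N d)).card)⁻¹ *
          (√(N : ℝ) * (√(G.a k) * X ⟨k, p⟩)) := by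
      intro τ hτ
      rw [← (Finset.mem_filter.1 hτ).2]
      rfl
    rw [Finset.sum_congr rfl hconst, Finset.sum_const, nsmul_eq_mul, averageCoeff, if_neg hk,
      Finset.filter_filter]
    have hset : (Finset.univ.filter fun τ : HammingCube N =>
        (∀ j ∉ sitesFrom N (G.cut N d), σ j = τ j) ∧ (fun i => τ i : G.Prefix N k) = p) =
        Finset.univ.filter fun τ : HammingCube N =>
        (∀ j ∉ sitesFrom N (G.cut N d), σ j = τ j) ∧
          (⟨k, p⟩ : Σ k : Fin G.n, G.Prefix N k) = G.node k τ := by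
      ext τ
      simp only [Finset.mem_filter, Finset.mem_univ, true_and, node, Sigma.mk.injEq, heq_eq_eq,
        eq_comm (a := p)]
    rw [hset]
    ring
  · intro k _ hk
    rw [Finset.mem_compl, not_not] at hk
    exact Finset.sum_eq_zero fun p _ => by rw [averageCoeff, if_pos hk, zero_mul]

/-- At a level `k` after `d`, the average gives each prefix a weight at most `2 ^ (cut d - cut
k.succ)`, with total weight one. The sum of squared weights is at most the largest weight, so the
variance is exponentially small when the cuts are well separated. -/
theorem sum_averageCoeff_sq_le (d : Fin (G.n + 1)) (σ : HammingCube N) :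
    ∑ c, G.averageCoeff d σ c ^ 2 ≤ ∑ k ∈ (G.levels d)ᶜ,
      N * G.a k * (2 ^ G.cut N d / 2 ^ G.cut N k.succ) := by
  classical
  rw [Fintype.sum_sigma, ← Finset.sum_subset (Finset.subset_univ (G.levels d)ᶜ)]
  · refine Finset.sum_le_sum fun k hk => ?_
    rw [Finset.mem_compl] at hk
    set J := sitesFrom N (G.cut N d) with hJ
    set f : G.Prefix N k → Finset (HammingCube N) := fun p =>
      Finset.univ.filter fun τ => (∀ j ∉ J, σ j = τ j) ∧ ⟨k, p⟩ = G.node k τ with hf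
    have hJN : (2 : ℝ) ^ J.card * 2 ^ G.cut N d = 2 ^ N := by
      rw [← pow_add, card_sitesFrom_add N _ (G.cut_le N _)]
    have hKN : (2 : ℝ) ^ (sitesFrom N (G.cut N k.succ)).card * 2 ^ G.cut N k.succ = 2 ^ N := by
      rw [← pow_add, card_sitesFrom_add N _ (G.cut_le N _)]
    have hfle : ∀ p, ((f p).card : ℝ) ≤ 2 ^ (sitesFrom N (G.cut N k.succ)).card := by
      intro p
      rcases (f p).eq_empty_or_nonempty with h | ⟨τ, hτ⟩
      · rw [h]; simp
      · have hτ' := (Finset.mem_filter.1 hτ).2.2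
        have : f p ⊆ Finset.univ.filter fun τ' => G.node k τ = G.node k τ' := fun τ' h' => by
          rw [Finset.mem_filter]
          exact ⟨Finset.mem_univ _, hτ'.symm.trans (Finset.mem_filter.1 h').2.2⟩
        have := Finset.card_le_card this
        rw [card_node_eq] at this
        exact_mod_cast this
    have hfsum : ∑ p, ((f p).card : ℝ) = 2 ^ J.card := by
      have h := Finset.card_eq_sum_card_fiberwise (f := fun τ => (fun i => τ i : G.Prefix N k))
        (s := Finset.univ.filter fun τ : HammingCube N => ∀ j ∉ J, σ j = τ j)
        (t := Finset.univ) fun _ _ => Finset.mem_univ _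
      rw [card_agree] at h
      have h2 : ∀ p, ((Finset.univ.filter fun τ : HammingCube N => ∀ j ∉ J, σ j = τ j).filter
          fun τ => (fun i => τ i : G.Prefix N k) = p) = f p := fun p => by
        ext τ
        simp only [hf, Finset.mem_filter, Finset.mem_univ, true_and, node, Sigma.mk.injEq,
          heq_eq_eq, eq_comm (a := p)]
      simp only [h2] at h
      exact_mod_cast h.symm
    have hterm : ∀ p, G.averageCoeff d σ ⟨k, p⟩ ^ 2 ≤
        N * G.a k * (((2 : ℝ) ^ J.card)⁻¹ ^ 2 * 2 ^ (sitesFrom N (G.cut N k.succ)).card *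
          (f p).card) := by
      intro p
      rw [averageCoeff, if_neg hk, mul_pow, mul_pow, mul_pow, Real.sq_sqrt (Nat.cast_nonneg _),
        Real.sq_sqrt (G.a_pos k).le]
      have hn : (0 : ℝ) ≤ N * G.a k := mul_nonneg (Nat.cast_nonneg _) (G.a_pos k).le
      refine mul_le_mul_of_nonneg_left ?_ hn
      rw [mul_assoc]
      refine mul_le_mul_of_nonneg_left ?_ (by positivity)
      rw [sq]
      exact mul_le_mul_of_nonneg_right (hfle p) (Nat.cast_nonneg _)
    refine (Finset.sum_le_sum fun p _ => hterm p).trans_eq ?_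
    rw [← Finset.mul_sum, ← Finset.mul_sum, hfsum]
    congr 1
    have h2 : (2 : ℝ) ^ J.card * 2 ^ G.cut N d =
      2 ^ (sitesFrom N (G.cut N k.succ)).card * 2 ^ G.cut N k.succ := hJN.trans hKN.symm
    have hne : (2 : ℝ) ^ J.card ≠ 0 := by positivity
    have hne2 : (2 : ℝ) ^ G.cut N k.succ ≠ 0 := by positivity
    rw [eq_div_iff hne2]
    calc _ = (((2 : ℝ) ^ J.card)⁻¹ ^ 2 * 2 ^ J.card) *
          (2 ^ (sitesFrom N (G.cut N k.succ)).card * 2 ^ G.cut N k.succ) := by ring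
      _ = 2 ^ G.cut N d := by rw [← h2]; field_simp
  · intro k _ hk
    rw [Finset.mem_compl, not_not] at hk
    exact Finset.sum_eq_zero fun p _ => by rw [averageCoeff, if_pos hk]; simp

/-- With high probability the averages of the potential of the last levels over the last blocks are
small. -/
theorem measure_large_average_le (d : Fin (G.n + 1)) {ε : ℝ} (hε : 0 < ε)
    (hN : ∀ k ∈ (G.levels d)ᶜ, (N : ℝ) * (2 ^ G.cut N d / 2 ^ G.cut N k.succ) ≤ 1) :
    (stdGaussianPi (Σ k : Fin G.n, G.Prefix N k)).real {X | ¬ ∀ σ : HammingCube N,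
      spinAverage (sitesFrom N (G.cut N d)) (G.potentialOn (G.levels d)ᶜ X) σ ≤ ε * N} ≤
      2 ^ N * Real.exp ((2 / ε) ^ 2 / 2 - 2 * N) := by
  have hvar : ∀ σ : HammingCube N, ∑ c, G.averageCoeff d σ c ^ 2 ≤ 1 := fun σ => by
    refine (G.sum_averageCoeff_sq_le d σ).trans ?_
    calc _ ≤ ∑ k ∈ (G.levels d)ᶜ, G.a k := Finset.sum_le_sum fun k hk => by
          nlinarith [hN k hk, G.a_pos k]
      _ ≤ ∑ k, G.a k := Finset.sum_le_sum_of_subset_of_nonneg (Finset.subset_univ _)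
          fun k _ _ => (G.a_pos k).le
      _ = 1 := G.sum_a
  have hone : ∀ σ : HammingCube N, (stdGaussianPi (Σ k : Fin G.n, G.Prefix N k)).real
      {X | ε * N < spinAverage (sitesFrom N (G.cut N d)) (G.potentialOn (G.levels d)ᶜ X) σ} ≤
      Real.exp ((2 / ε) ^ 2 / 2 - 2 * N) := fun σ => by
    -- The scaling `2 / ε` makes the threshold `2 N`, and `e^{-2N}` beats the `2 ^ N` terms of the
    -- union bound.
    have h := stdGaussianPi_real_le_linear (fun c => 2 / ε * G.averageCoeff d σ c) (2 * N)
    refine le_trans (measureReal_mono (Set.ofPred_subset_ofPred.2 fun X hX => ?_)) (h.trans ?_)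
    · rw [spinAverage_potentialOn_compl] at hX
      simp only [mul_assoc, ← Finset.mul_sum]
      rw [div_mul_eq_mul_div, le_div_iff₀ hε]
      linarith
    · rw [Real.exp_le_exp]
      simp only [mul_pow, mul_div_right_comm, ← Finset.mul_sum]
      have : 0 ≤ (2 / ε) ^ 2 / 2 := by positivity
      nlinarith [hvar σ]
  have hsub : {X | ¬ ∀ σ : HammingCube N,
      spinAverage (sitesFrom N (G.cut N d)) (G.potentialOn (G.levels d)ᶜ X) σ ≤ ε * N} ⊆
      ⋃ σ : HammingCube N, {X | ε * N <
        spinAverage (sitesFrom N (G.cut N d)) (G.potentialOn (G.levels d)ᶜ X) σ} := by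
    intro X hX
    simpa using hX
  calc _ ≤ _ := measureReal_mono hsub
    _ ≤ _ := measureReal_iUnion_fintype_le _
    _ ≤ _ := Finset.sum_le_sum fun σ _ => hone σ
    _ = _ := by
      rw [Finset.sum_const, Finset.card_univ, card_hammingCube, nsmul_eq_mul]
      push_cast
      rfl

end GREM

/-! ### Bounds on the pressure for typical values of the Gaussian variables -/

section Pressure

open Matrix

variable {N : ℕ}

theorem neg_smul_hamiltonian (β : ℝ) (U : HammingCube N → ℝ) (b : Fin N → ℝ) :
    -(β • hamiltonian U b) =
      diagonal (fun σ => -β * U σ) + fieldOn Finset.univ (fun j => β * b j) := by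
  have h1 : fieldOn Finset.univ (fun j => β * b j) = β • transversalField b := by
    rw [fieldOn, transversalField, Finset.smul_sum]
    exact Finset.sum_congr rfl fun j _ => (smul_smul _ _ _).symm
  have h2 : diagonal (fun σ => -β * U σ) = -(β • diagonal U) := by
    ext σ τ
    by_cases h : σ = τ
    · subst h; simp
    · simp [h]
  rw [hamiltonian, smul_sub, h1, h2]
  abel

theorem prod_cosh_eq_exp (J : Finset (Fin N)) (b : Fin N → ℝ) :
    ∏ j ∈ J, Real.cosh (b j) =
      Real.exp (∑ j ∈ J, Real.log (2 * Real.cosh (b j)) - J.card * Real.log 2) := by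
  have h : ∀ j, Real.cosh (b j) = Real.exp (Real.log (2 * Real.cosh (b j)) - Real.log 2) :=
    fun j => by
      have := Real.cosh_pos (b j)
      rw [Real.exp_sub, Real.exp_log (by positivity), Real.exp_log two_pos]
      field_simp
  rw [Finset.prod_congr rfl fun j _ => h j, ← Real.exp_sum, Finset.sum_sub_distrib,
    Finset.sum_const, nsmul_eq_mul]

theorem exp_nat_mul_log_two (n : ℕ) : Real.exp (n * Real.log 2) = 2 ^ n := by
  rw [← Real.log_pow, Real.exp_log (by positivity)]

theorem spinAverage_of_invariant (J : Finset (Fin N)) {f : HammingCube N → ℝ}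
    (hf : ∀ σ τ, (∀ j ∉ J, σ j = τ j) → f σ = f τ) (σ : HammingCube N) :
    spinAverage J f σ = f σ := by
  have h : ∀ τ, (if ∀ j ∉ J, σ j = τ j then f τ else 0) =
      (if ∀ j ∉ J, σ j = τ j then f σ else 0) := fun τ => by
    split_ifs with h
    · exact (hf σ τ h).symm
    · rfl
  rw [spinAverage, Finset.sum_congr rfl fun τ _ => h τ, ← Finset.sum_filter, Finset.sum_const,
    card_agree, nsmul_eq_mul]
  push_cast
  rw [inv_mul_cancel_left₀ (by positivity)]

theorem spinAverage_add_mul (J : Finset (Fin N)) (c : ℝ) (f g : HammingCube N → ℝ)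
    (σ : HammingCube N) : spinAverage J (fun τ => c * (f τ + g τ)) σ =
      c * (spinAverage J f σ + spinAverage J g σ) := by
  simp only [spinAverage, ← mul_add, ← Finset.sum_add_distrib]
  rw [mul_left_comm c, Finset.mul_sum (a := c)]
  congr 1
  refine Finset.sum_congr rfl fun τ _ => ?_
  split_ifs <;> ring

end Pressure

/-! ### Fractional moments and the pressure for typical Gaussian variables -/

namespace GREM

open Matrix

variable (G : GREM) {N : ℕ}

variable {G} in
/-- Summation by parts. -/
theorem sum_levels_mul_le {c u : Fin G.n → ℝ} {C δ : ℝ} (hδ : 0 ≤ δ)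
    (hc : ∀ i k, i ≤ k → c k ≤ c i) (hC : ∀ k, c k ≤ C)
    (hu : ∀ d, ∑ k ∈ G.levels d, u k ≤ δ) (d : Fin (G.n + 1)) :
    ∀ c' ≤ C, (∀ k ∈ G.levels d, c' ≤ c k) →
      ∑ k ∈ G.levels d, c k * u k ≤ c' * ∑ k ∈ G.levels d, u k + (C - c') * δ := by
  induction d using Fin.induction with
  | zero =>
    intro c' hc' _
    simpa [levels_zero] using mul_nonneg (sub_nonneg.2 hc') hδ
  | succ k ih =>
    intro c' hc' hcc'
    have h1 := ih (c k) (hC k) fun i hi => hc i k (mem_levels.1 hi).le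
    -- The induction hypothesis is used with `c k` as lower bound; descending from `c k` to `c'`
    -- multiplies a partial sum, at most `δ`, by `c k - c'`.
    have h2 : c' ≤ c k := hcc' k (by rw [levels_succ]; exact Finset.mem_insert_self _ _)
    have h3 := hu k.succ
    rw [sum_levels_succ] at h3 ⊢
    rw [sum_levels_succ]
    nlinarith [mul_le_mul_of_nonneg_left h3 (sub_nonneg.2 h2)]

theorem sum_levels_blockLength (d : Fin (G.n + 1)) :
    ∑ k ∈ G.levels d, G.blockLength k = G.x d := by
  induction d using Fin.induction with
  | zero => simp [levels_zero, G.x_zero]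
  | succ k ih => rw [sum_levels_succ, ih, blockLength]; ring

/-- The coefficients of the tilted energies. -/
noncomputable def tiltedWeight (N : ℕ) (β : ℝ) (k : Fin G.n) : ℝ :=
  -(G.tilt β (G.segment k) * β) * (√(N : ℝ) * √(G.a k))

theorem tiltedWeight_sq (β : ℝ) (k : Fin G.n) : G.tiltedWeight N β k ^ 2 / 2 =
    N * ((G.tilt β (G.segment k) * β) ^ 2 * G.a k / 2) := by
  rw [tiltedWeight, mul_pow, mul_pow, Real.sq_sqrt (Nat.cast_nonneg _),
    Real.sq_sqrt (G.a_pos k).le]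
  ring

/-- A bound on the inverse exponents of the fractional moments. -/
noncomputable def tiltBound (β : ℝ) : ℝ := ∑ k, (G.tilt β (G.segment k))⁻¹

theorem tiltBound_nonneg (β : ℝ) : 0 ≤ G.tiltBound β :=
  Finset.sum_nonneg fun k _ => (inv_pos.2 (G.tilt_pos (G.segment_lt k))).le

/-- The property of the Gaussian variables which bounds the classical partition functions. -/
def MomentsBounded (β ε : ℝ) (X : (Σ k : Fin G.n, G.Prefix N k) → ℝ) : Prop :=
  ∀ d, ∑ σ : HammingCube N, Real.exp (∑ k ∈ G.levels d, G.tiltedWeight N β k * X (G.node k σ)) ≤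
    2 ^ N * Real.exp (∑ k ∈ G.levels d, G.tiltedWeight N β k ^ 2 / 2 + ε * N)

variable {G}

/-- The summand of `σ` is repeated for all values of the spins after the cut, so the bound on the
sum also bounds each individual energy. -/
theorem MomentsBounded.tilted_energy_le {β ε : ℝ} {X : (Σ k : Fin G.n, G.Prefix N k) → ℝ}
    (h : G.MomentsBounded β ε X) (d : Fin (G.n + 1)) (σ : HammingCube N) :
    ∑ k ∈ G.levels d, G.tiltedWeight N β k * X (G.node k σ) ≤
      G.cut N d * Real.log 2 + (∑ k ∈ G.levels d, G.tiltedWeight N β k ^ 2 / 2 + ε * N) := by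
  set T : HammingCube N → ℝ := fun σ =>
    ∑ k ∈ G.levels d, G.tiltedWeight N β k * X (G.node k σ) with hT
  have hinv : ∀ τ ∈ (Finset.univ.filter fun τ : HammingCube N =>
      ∀ j ∉ sitesFrom N (G.cut N d), σ j = τ j), Real.exp (T τ) = Real.exp (T σ) := by
    intro τ hτ
    congr 1
    refine Finset.sum_congr rfl fun k hk => ?_
    rw [node_eq_node_iff.2 fun j hj => ?_]
    refine ((Finset.mem_filter.1 hτ).2 j (notMem_sitesFrom.2 (hj.trans_le ?_))).symm
    exact G.cut_mono N (mem_levels_iff_succ_le.1 hk)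
  have h1 : (2 : ℝ) ^ (sitesFrom N (G.cut N d)).card * Real.exp (T σ) ≤
      ∑ τ, Real.exp (T τ) := by
    calc _ = ∑ τ ∈ (Finset.univ.filter fun τ : HammingCube N =>
          ∀ j ∉ sitesFrom N (G.cut N d), σ j = τ j), Real.exp (T τ) := by
          rw [Finset.sum_congr rfl hinv, Finset.sum_const, card_agree, nsmul_eq_mul]
          push_cast
          rfl
      _ ≤ _ := Finset.sum_le_sum_of_subset_of_nonneg (Finset.subset_univ _)
          fun τ _ _ => (Real.exp_pos _).le
  have h2 := h1.trans (h d)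
  have hpow : (2 : ℝ) ^ N = 2 ^ (sitesFrom N (G.cut N d)).card * 2 ^ G.cut N d := by
    rw [← pow_add, card_sitesFrom_add N _ (G.cut_le N d)]
  rw [hpow, mul_assoc] at h2
  have h3 := le_of_mul_le_mul_left h2 (by positivity)
  rw [← exp_nat_mul_log_two, ← Real.exp_add, Real.exp_le_exp] at h3
  exact h3

/-- The classical partition function of the first `d` levels. -/
theorem MomentsBounded.partition_le {β ε : ℝ} (hε : 0 ≤ ε)
    {X : (Σ k : Fin G.n, G.Prefix N k) → ℝ} (h : G.MomentsBounded β ε X) (d : Fin (G.n + 1)) :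
    ∑ σ : HammingCube N, Real.exp (-β * G.potentialOn (G.levels d) X σ) ≤
      2 ^ N * Real.exp (N * (G.momentBound β d - G.x d * Real.log 2) +
        G.tiltBound β * (Real.log 2 + ε * N) + ε * N) := by
  have hlog := Real.log_pos one_lt_two
  set m : Fin G.n → ℝ := fun k => G.tilt β (G.segment k) with hm
  have hm0 : ∀ k, 0 < m k := fun k => G.tilt_pos (G.segment_lt k)
  -- The exponent `-β U` is the sum of the tilted energies plus their combination with coefficients
  -- `c`. The first part is summed over configurations by `MomentsBounded`, the second is bounded
  -- pointwise.
  set c : Fin G.n → ℝ := fun k => (m k)⁻¹ - 1 with hc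
  set g : Fin G.n → ℝ := fun k =>
    N * (G.blockLength k * Real.log 2 + (m k * β) ^ 2 * G.a k / 2) with hg
  have hc0 : ∀ k, 0 ≤ c k := fun k => by
    rw [hc, sub_nonneg, one_le_inv₀ (hm0 k)]
    exact G.tilt_le_one (G.segment_lt k)
  have hcC : ∀ k, c k ≤ G.tiltBound β := fun k => by
    have := Finset.single_le_sum (f := fun k => (m k)⁻¹)
      (fun k _ => (inv_pos.2 (hm0 k)).le) (Finset.mem_univ k)
    change (m k)⁻¹ - 1 ≤ _
    refine le_trans ?_ this
    linarith
  have hcanti : ∀ i k, i ≤ k → c k ≤ c i := fun i k hik => by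
    have := inv_anti₀ (hm0 i) (G.tilt_mono (β := β) (G.segment_mono hik) (G.segment_lt k))
    simp only [hc]
    linarith
  have hδ : 0 ≤ Real.log 2 + ε * N := by positivity
  have hgsum : ∀ d, ∑ k ∈ G.levels d, g k = N * (G.x d * Real.log 2) +
      ∑ k ∈ G.levels d, G.tiltedWeight N β k ^ 2 / 2 := fun d => by
    simp only [tiltedWeight_sq, hg, mul_add, Finset.sum_add_distrib]
    rw [← Finset.mul_sum, ← Finset.sum_mul, sum_levels_blockLength]
  have henergy : ∀ σ : HammingCube N, -β * G.potentialOn (G.levels d) X σ ≤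
      ∑ k ∈ G.levels d, G.tiltedWeight N β k * X (G.node k σ) +
        (∑ k ∈ G.levels d, c k * g k + G.tiltBound β * (Real.log 2 + ε * N)) := by
    intro σ
    set t : Fin G.n → ℝ := fun k => G.tiltedWeight N β k * X (G.node k σ) with ht
    have h1 : -β * G.potentialOn (G.levels d) X σ = ∑ k ∈ G.levels d, (m k)⁻¹ * t k := by
      rw [potentialOn, Finset.mul_sum, Finset.mul_sum]
      refine Finset.sum_congr rfl fun k _ => ?_
      have := (hm0 k).ne'
      simp only [ht, tiltedWeight]
      change _ = (m k)⁻¹ * (-(m k * β) * (√(N : ℝ) * √(G.a k)) * X (G.node k σ))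
      field_simp
    -- The partial sums of energies minus typical values `g` are at most `log 2 + ε N`, where `log
    -- 2` pays for rounding the cut. Since `c` is nonincreasing and nonnegative, summation by parts
    -- with final coefficient zero applies.
    have h2 := sum_levels_mul_le (u := fun k => t k - g k) hδ hcanti hcC (fun d => by
      rw [Finset.sum_sub_distrib, hgsum]
      have := h.tilted_energy_le d σ
      have := G.cut_le_add_one N d
      nlinarith) d 0 (G.tiltBound_nonneg β) fun k _ => hc0 k
    rw [h1]
    have h3 : ∑ k ∈ G.levels d, c k * (t k - g k) = ∑ k ∈ G.levels d, (m k)⁻¹ * t k -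
        ∑ k ∈ G.levels d, t k - ∑ k ∈ G.levels d, c k * g k := by
      rw [← Finset.sum_sub_distrib, ← Finset.sum_sub_distrib]
      exact Finset.sum_congr rfl fun k _ => by simp only [hc]; ring
    rw [h3] at h2
    linarith
  have hmoment : ∑ k ∈ G.levels d, c k * g k + ∑ k ∈ G.levels d, G.tiltedWeight N β k ^ 2 / 2 =
      N * (G.momentBound β d - G.x d * Real.log 2) := by
    have h1 : ∑ k ∈ G.levels d, (m k)⁻¹ * g k = N * G.momentBound β d := by
      rw [momentBound, Finset.mul_sum]
      refine Finset.sum_congr rfl fun k _ => ?_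
      have := (hm0 k).ne'
      simp only [hg]
      change _ = N * (G.blockLength k * (Real.log 2 / m k) + G.a k * (m k * β ^ 2 / 2))
      field_simp
    have h2 : ∑ k ∈ G.levels d, c k * g k =
        ∑ k ∈ G.levels d, (m k)⁻¹ * g k - ∑ k ∈ G.levels d, g k := by
      rw [← Finset.sum_sub_distrib]
      exact Finset.sum_congr rfl fun k _ => by simp only [hc]; ring
    rw [h2, h1, hgsum]
    ring
  calc ∑ σ : HammingCube N, Real.exp (-β * G.potentialOn (G.levels d) X σ)
      ≤ ∑ σ : HammingCube N, Real.exp (∑ k ∈ G.levels d, G.tiltedWeight N β k * X (G.node k σ)) *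
        Real.exp (∑ k ∈ G.levels d, c k * g k + G.tiltBound β * (Real.log 2 + ε * N)) := by
        refine Finset.sum_le_sum fun σ _ => ?_
        rw [← Real.exp_add, Real.exp_le_exp]
        exact henergy σ
    _ ≤ (2 ^ N * Real.exp (∑ k ∈ G.levels d, G.tiltedWeight N β k ^ 2 / 2 + ε * N)) *
        Real.exp (∑ k ∈ G.levels d, c k * g k + G.tiltBound β * (Real.log 2 + ε * N)) := by
        rw [← Finset.sum_mul]
        exact mul_le_mul_of_nonneg_right (h d) (Real.exp_pos _).le
    _ = _ := by
        rw [mul_assoc, ← Real.exp_add, ← hmoment]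
        congr 2
        ring

variable (G)

/-- The upper bound on the pressure. -/
theorem pressure_le {β ε η B D p : ℝ} {r : ℕ} (hβ : 0 ≤ β) (hε : 0 ≤ ε) (hη : 0 < η)
    (hN : 0 < N) {X : (Σ k : Fin G.n, G.Prefix N k) → ℝ}
    (hdeep : ∀ k σ, Set.ncard {j : Fin N | (j : ℕ) < G.cut N k.succ ∧
        G.IsDeep ε X k (flipSpin j σ)} ≤ r)
    (hmom : G.MomentsBounded β ε X) {b : Fin N → ℝ} (hB0 : 0 ≤ B) (hB : ∀ j, |b j| ≤ B * N)
    (hD : ∑ j, |b j| ≤ D * N)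
    (hp : ∀ d, ∑ j ∈ sitesFrom N (G.cut N d), Real.log (2 * Real.cosh (β * b j)) ≤
      N * ((1 - G.x d) * p + ε)) :
    pressure β (G.potential N X) b ≤ G.limitPressure β p +
      ((β * G.n + G.tiltBound β + 2) * ε + G.n * β * D * η + G.n * β * r / η * B +
        (Real.log (2 * (G.n + 1)) + G.tiltBound β * Real.log 2) / N) := by
  have hN' : (0 : ℝ) < N := Nat.cast_pos.2 hN
  -- `Q` dominates the exponent for every `d`: its terms collect the variational maximum, the field
  -- fluctuation, the fractional moment error and the rounding of the cut.
  set Q : ℝ := N * (G.limitPressure β p + ε) + G.tiltBound β * (Real.log 2 + ε * N) + ε * N +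
    Real.log 2 with hQ
  have htr := trace_exp_le_sum_prod_cosh (G.cut_zero N) (E := G.IsDeep ε X)
    (p := G.cut N) (fun k σ τ hστ h => by
      have := node_eq_node_iff.2 hστ
      unfold IsDeep at h ⊢
      rwa [← this]) hdeep (fun j => β * b j) (B := β * (B * N)) (by positivity)
    (fun j => by rw [abs_mul, abs_of_nonneg hβ]; exact mul_le_mul_of_nonneg_left (hB j) hβ) hη
    (fun σ => -β * G.potential N X σ) (fun d σ => -β * G.potentialOn (G.levels d) X σ)
    (c := β * G.n * ε * N)
    (fun d σ τ h => by rw [G.potentialOn_levels_congr X h]) (fun d σ h => by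
      rw [← G.potentialOn_add_compl (G.levels d) X σ, mul_add]
      refine add_le_add le_rfl ?_
      rw [potentialOn, Finset.mul_sum, Finset.mul_sum]
      have hterm : ∀ k ∈ (G.levels d)ᶜ, -β * (√(N : ℝ) * (√(G.a k) * X (G.node k σ))) ≤
          β * (ε * N) := fun k hk => by
        rw [Finset.mem_compl, mem_levels, not_lt] at hk
        have := h k hk
        rw [IsDeep, not_le] at this
        nlinarith
      refine (Finset.sum_le_sum hterm).trans ?_
      rw [Finset.sum_const, nsmul_eq_mul]
      have hcard : ((G.levels d)ᶜ.card : ℝ) ≤ G.n := by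
        exact_mod_cast (Finset.card_le_univ _).trans_eq (Fintype.card_fin _)
      have : 0 ≤ β * (ε * N) := by positivity
      nlinarith)
  have hd : ∀ d, (∏ j ∈ sitesFrom N (G.cut N d), Real.cosh (β * b j)) *
      ∑ σ, Real.exp (-β * G.potentialOn (G.levels d) X σ) ≤ Real.exp Q := by
    intro d
    have h1 := hmom.partition_le hε d
    rw [prod_cosh_eq_exp (sitesFrom N (G.cut N d)) fun j => β * b j]
    refine (mul_le_mul_of_nonneg_left h1 (Real.exp_pos _).le).trans ?_
    rw [← exp_nat_mul_log_two, ← Real.exp_add, ← Real.exp_add, Real.exp_le_exp]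
    have h2 := G.momentBound_add_le_limitPressure β p d
    have h3 := hp d
    have h4 : ((sitesFrom N (G.cut N d)).card : ℝ) + G.cut N d = N := by
      exact_mod_cast card_sitesFrom_add N _ (G.cut_le N d)
    have h5 := mul_le_mul_of_nonneg_right (G.cut_le_add_one N d) (Real.log_pos one_lt_two).le
    have h6 : ((sitesFrom N (G.cut N d)).card : ℝ) * Real.log 2 + G.cut N d * Real.log 2 =
        N * Real.log 2 := by rw [← add_mul, h4]
    have h7 := mul_le_mul_of_nonneg_left h2 hN'.le
    rw [hQ]
    linarith
  have htot : (NormedSpace.exp (-(β • hamiltonian (G.potential N X) b))).trace ≤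
      Real.exp (β * G.n * ε * N + G.n * (η * (β * (D * N)) + r * (β * (B * N)) / η) +
        Real.log (G.n + 1) + Q) := by
    rw [neg_smul_hamiltonian]
    refine htr.trans ?_
    have h1 : ∑ d : Fin (G.n + 1), (∏ j ∈ sitesFrom N (G.cut N d), Real.cosh (β * b j)) *
        ∑ σ, Real.exp (-β * G.potentialOn (G.levels d) X σ) ≤
        Real.exp (Real.log (G.n + 1)) * Real.exp Q := by
      refine (Finset.sum_le_sum fun d _ => hd d).trans_eq ?_
      rw [Finset.sum_const, Finset.card_univ, Fintype.card_fin, nsmul_eq_mul,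
        Real.exp_log (by positivity)]
      push_cast
      rfl
    refine (mul_le_mul_of_nonneg_left h1 (Real.exp_pos _).le).trans ?_
    rw [← mul_assoc, ← Real.exp_add, ← Real.exp_add, Real.exp_le_exp]
    have h2 : ∑ j, |β * b j| ≤ β * (D * N) := by
      simp only [abs_mul, abs_of_nonneg hβ, ← Finset.mul_sum]
      exact mul_le_mul_of_nonneg_left hD hβ
    gcongr
  have hpos : 0 < (NormedSpace.exp (-(β • hamiltonian (G.potential N X) b))).trace := by
    rw [neg_smul_hamiltonian]
    exact trace_exp_pos (diagonal_add_fieldOn_isHermitian _ _ _)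
  have hlog := (Real.log_le_iff_le_exp hpos).2 htot
  rw [pressure, one_div, inv_mul_le_iff₀ hN']
  refine hlog.trans_eq ?_
  rw [Real.log_mul two_ne_zero (by positivity), hQ]
  field_simp
  ring

/-- The lower bound on the pressure. -/
theorem le_pressure {β ε p : ℝ} (hβ : 0 ≤ β) (hN : 0 < N) {d : Fin (G.n + 1)}
    {lam : Fin G.n → ℝ} {X : (Σ k : Fin G.n, G.Prefix N k) → ℝ}
    (htail : ∀ k, Real.exp (-(((lam k * √(G.a k)) ^ 2 / 2 + ε) * N)) ≤
      gaussianTail (-(lam k * √(G.a k) * √(N : ℝ))))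
    (hcount : (2 ^ N * ∏ k ∈ G.levels d, gaussianTail (-(lam k * √(G.a k) * √(N : ℝ)))) / 2 ≤
      ∑ σ, (G.lowEvent d (fun k => -(lam k * √(G.a k) * √(N : ℝ))) σ).indicator 1 X)
    (havg : ∀ σ : HammingCube N,
      spinAverage (sitesFrom N (G.cut N d)) (G.potentialOn (G.levels d)ᶜ X) σ ≤ ε * N)
    {b : Fin N → ℝ} (hp : N * ((1 - G.x d) * p - ε) ≤
      ∑ j ∈ sitesFrom N (G.cut N d), Real.log (2 * Real.cosh (β * b j))) (hε : 0 ≤ ε) :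
    ∑ k ∈ G.levels d, (G.blockLength k * Real.log 2 +
        G.a k * (β * lam k - lam k ^ 2 / 2)) + (1 - G.x d) * p -
      ((G.n + 1 + β) * ε + Real.log 2 / N) ≤ pressure β (G.potential N X) b := by
  have hN' : (0 : ℝ) < N := Nat.cast_pos.2 hN
  set s : Fin G.n → ℝ := fun k => -(lam k * √(G.a k) * √(N : ℝ)) with hs
  set J := sitesFrom N (G.cut N d) with hJ
  -- The averaged exponent guaranteed by the low event, after subtracting the possible contribution
  -- of the later levels.
  set R : ℝ := β * (N * ∑ k ∈ G.levels d, G.a k * lam k) - β * (ε * N) with hR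
  have hsites : ∀ σ τ : HammingCube N, (∀ j ∉ J, σ j = τ j) →
      G.potentialOn (G.levels d) X σ = G.potentialOn (G.levels d) X τ := fun σ τ h =>
    G.potentialOn_levels_congr X fun j hj => h j (notMem_sitesFrom.2 hj)
  have hlow : ∀ σ : HammingCube N, X ∈ G.lowEvent d s σ →
      R ≤ spinAverage J (fun σ => -β * G.potential N X σ) σ := by
    intro σ hσ
    have h1 : (fun σ => -β * G.potential N X σ) = fun σ =>
        -β * (G.potentialOn (G.levels d) X σ + G.potentialOn (G.levels d)ᶜ X σ) := by
      funext σ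
      rw [potentialOn_add_compl]
    rw [h1, spinAverage_add_mul, spinAverage_of_invariant J hsites]
    have h2 : G.potentialOn (G.levels d) X σ ≤ -(N * ∑ k ∈ G.levels d, G.a k * lam k) := by
      rw [potentialOn, Finset.mul_sum, Finset.mul_sum, ← Finset.sum_neg_distrib]
      refine Finset.sum_le_sum fun k hk => ?_
      have h3 : X (G.node k σ) ≤ s k := hσ k hk
      have h4 : √(N : ℝ) * (√(G.a k) * s k) = -(N * (G.a k * lam k)) := by
        have e1 : √(N : ℝ) * √(N : ℝ) = N := Real.mul_self_sqrt hN'.le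
        have e2 : √(G.a k) * √(G.a k) = G.a k := Real.mul_self_sqrt (G.a_pos k).le
        simp only [hs]
        linear_combination (-lam k * (√(G.a k) * √(G.a k))) * e1 - lam k * N * e2
      rw [← h4]
      gcongr
    have h5 := havg σ
    rw [hR]
    nlinarith [mul_le_mul_of_nonneg_left h2 hβ, mul_le_mul_of_nonneg_left h5 hβ]
  have hsum : (∑ σ, (G.lowEvent d s σ).indicator 1 X) * Real.exp R ≤
      ∑ σ, Real.exp (spinAverage J (fun σ => -β * G.potential N X σ) σ) := by
    rw [Finset.sum_mul]
    refine Finset.sum_le_sum fun σ _ => ?_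
    by_cases hσ : X ∈ G.lowEvent d s σ
    · rw [Set.indicator_of_mem hσ, Pi.one_apply, one_mul, Real.exp_le_exp]
      exact hlow σ hσ
    · rw [Set.indicator_of_notMem hσ, zero_mul]
      exact (Real.exp_pos _).le
  have hprod : Real.exp (-(∑ k ∈ G.levels d, ((lam k * √(G.a k)) ^ 2 / 2 + ε) * N)) ≤
      ∏ k ∈ G.levels d, gaussianTail (s k) := by
    rw [← Finset.sum_neg_distrib, Real.exp_sum]
    exact Finset.prod_le_prod (fun k _ => (Real.exp_pos _).le) fun k _ => htail k
  set M : ℝ := ∑ j ∈ J, Real.log (2 * Real.cosh (β * b j)) with hM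
  set V : ℝ := ∑ k ∈ G.levels d, ((lam k * √(G.a k)) ^ 2 / 2 + ε) * N with hV
  have htot : Real.exp (M - J.card * Real.log 2 + (N * Real.log 2 - V - Real.log 2) + R) ≤
      (NormedSpace.exp (-(β • hamiltonian (G.potential N X) b))).trace := by
    rw [neg_smul_hamiltonian]
    refine le_trans ?_ (prod_cosh_mul_sum_exp_spinAverage_le_trace_exp J _ _)
    rw [prod_cosh_eq_exp J fun j => β * b j, add_assoc, Real.exp_add]
    refine mul_le_mul_of_nonneg_left ?_ (Real.exp_pos _).le
    refine le_trans ?_ hsum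
    rw [Real.exp_add]
    refine mul_le_mul_of_nonneg_right ?_ (Real.exp_pos _).le
    refine le_trans ?_ hcount
    rw [Real.exp_sub, Real.exp_log two_pos, sub_eq_add_neg, Real.exp_add, exp_nat_mul_log_two]
    gcongr
  have hlog := Real.log_le_log (Real.exp_pos _) htot
  rw [Real.log_exp] at hlog
  rw [pressure, one_div, le_inv_mul_iff₀ hN']
  refine le_trans ?_ hlog
  have h1 : ((J.card : ℝ) + G.cut N d) = N := by
    exact_mod_cast card_sitesFrom_add N _ (G.cut_le N d)
  have h2 : (J.card : ℝ) * Real.log 2 = N * Real.log 2 - G.cut N d * Real.log 2 := by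
    rw [← h1]; ring
  have h3 := mul_le_mul_of_nonneg_right (G.le_cut N d) (Real.log_pos one_lt_two).le
  have hVle : V ≤ N * (∑ k ∈ G.levels d, G.a k * (lam k ^ 2 / 2)) + G.n * ε * N := by
    have hcard : ((G.levels d).card : ℝ) ≤ G.n := by
      exact_mod_cast (Finset.card_le_univ _).trans_eq (Fintype.card_fin _)
    have e : V = N * (∑ k ∈ G.levels d, G.a k * (lam k ^ 2 / 2)) +
        (G.levels d).card * (ε * N) := by
      rw [hV, Finset.mul_sum, ← nsmul_eq_mul, ← Finset.sum_const, ← Finset.sum_add_distrib]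
      refine Finset.sum_congr rfl fun k _ => ?_
      rw [mul_pow, Real.sq_sqrt (G.a_pos k).le]
      ring
    have : 0 ≤ ε * N := by positivity
    rw [e]
    nlinarith
  have hsplit : ∑ k ∈ G.levels d, (G.blockLength k * Real.log 2 +
      G.a k * (β * lam k - lam k ^ 2 / 2)) = G.x d * Real.log 2 +
      β * (∑ k ∈ G.levels d, G.a k * lam k) - ∑ k ∈ G.levels d, G.a k * (lam k ^ 2 / 2) := by
    rw [← sum_levels_blockLength, Finset.sum_mul, Finset.mul_sum, ← Finset.sum_add_distrib,
      ← Finset.sum_sub_distrib]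
    exact Finset.sum_congr rfl fun k _ => by ring
  rw [hsplit, hR, h2]
  have h4 : N * (Real.log 2 / N) = Real.log 2 := mul_div_cancel₀ _ hN'.ne'
  nlinarith

end GREM

/-! ### Almost sure statements -/

/-- Borel-Cantelli with geometrically small failure probabilities, after shifting past the finitely
many `N` without a bound. -/
theorem ae_eventually_of_measureReal_le {Ω : Type*} [MeasurableSpace Ω] {μ : Measure Ω}
    [IsProbabilityMeasure μ] {p : ℕ → Ω → Prop} {K c : ℝ} (hc : 0 < c)
    (h : ∀ᶠ N : ℕ in atTop, μ.real {ω | ¬ p N ω} ≤ K * Real.exp (-(c * N))) :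
    ∀ᵐ ω ∂μ, ∀ᶠ N in atTop, p N ω := by
  obtain ⟨N₀, hN₀⟩ := eventually_atTop.1 h
  have hsum : Summable fun N : ℕ => K * Real.exp (-(c * ((N + N₀ : ℕ) : ℝ))) := by
    have h1 : Summable fun N : ℕ => Real.exp (-(c * (N : ℝ))) := by
      have := Real.summable_exp_nat_mul_iff.2 (neg_lt_zero.2 hc)
      refine this.congr fun N => ?_
      congr 1
      ring
    exact ((summable_nat_add_iff N₀).2 h1).mul_left K
  have hfin : ∑' N, μ {ω | ¬ p (N + N₀) ω} ≠ ⊤ := by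
    refine ne_top_of_le_ne_top hsum.tsum_ofReal_ne_top (ENNReal.tsum_le_tsum fun N => ?_)
    rw [← ENNReal.ofReal_toReal (measure_ne_top μ {ω | ¬ p (N + N₀) ω})]
    exact ENNReal.ofReal_le_ofReal (hN₀ (N + N₀) (by omega))
  filter_upwards [ae_eventually_notMem hfin] with ω hω
  obtain ⟨N₁, hN₁⟩ := eventually_atTop.1 hω
  refine eventually_atTop.2 ⟨N₁ + N₀, fun N hN => ?_⟩
  have := hN₁ (N - N₀) (by omega)
  rw [Nat.sub_add_cancel (by omega)] at this
  simpa using this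

open scoped Matrix.Norms.Operator in
theorem continuous_pressure {N : ℕ} (β : ℝ) (b : Fin N → ℝ) :
    Continuous fun U : HammingCube N → ℝ => pressure β U b := by
  unfold pressure
  refine continuous_const.mul (Continuous.log ?_ fun U => ?_)
  · refine Continuous.matrix_trace (NormedSpace.exp_continuous.comp ?_)
    refine (Continuous.const_smul ?_ β).neg
    exact (Continuous.matrix_diagonal continuous_id).sub continuous_const
  · rw [neg_smul_hamiltonian]
    exact (trace_exp_pos (diagonal_add_fieldOn_isHermitian _ _ _)).ne'

/-- Uniformity over an arbitrary, possibly uncountable, set of fields keeps the event measurable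
because it is an intersection of closed sets. -/
theorem isClosed_pressure_le {N : ℕ} (β c : ℝ) (S : Set (Fin N → ℝ)) :
    IsClosed {U : HammingCube N → ℝ | ∀ b ∈ S, pressure β U b ≤ c} := by
  have h : {U : HammingCube N → ℝ | ∀ b ∈ S, pressure β U b ≤ c} =
      ⋂ b ∈ S, {U | pressure β U b ≤ c} := by
    ext U; simp
  rw [h]
  exact isClosed_biInter fun b _ => isClosed_le (continuous_pressure β b) continuous_const

theorem isClosed_le_pressure {N : ℕ} (β c : ℝ) (S : Set (Fin N → ℝ)) :
    IsClosed {U : HammingCube N → ℝ | ∀ b ∈ S, c ≤ pressure β U b} := by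
  have h : {U : HammingCube N → ℝ | ∀ b ∈ S, c ≤ pressure β U b} =
      ⋂ b ∈ S, {U | c ≤ pressure β U b} := by
    ext U; simp
  rw [h]
  exact isClosed_biInter fun b _ => isClosed_le continuous_const (continuous_pressure β b)

/-- For nonnegative `c`, the product `c * t` is small for all small positive `t`. -/
theorem exists_pos_mul_le {c κ : ℝ} (hc : 0 ≤ c) (hκ : 0 < κ) {m : ℝ} (hm : 0 < m) :
    ∃ t > 0, t ≤ m ∧ c * t ≤ κ := by
  refine ⟨min m (κ / (c + 1)), lt_min hm (by positivity), min_le_left _ _, ?_⟩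
  have h : min m (κ / (c + 1)) ≤ κ / (c + 1) := min_le_right _ _
  have h0 : 0 ≤ min m (κ / (c + 1)) := (lt_min hm (by positivity)).le
  rw [le_div_iff₀ (by positivity)] at h
  nlinarith

/-! ### The almost sure upper bound, uniformly in the field -/

namespace GREM

variable (G : GREM)

theorem measurable_potential (N : ℕ) : Measurable (G.potential N) := by
  refine measurable_pi_lambda _ fun σ => ?_
  have h : ∀ k, Measurable fun X : (Σ k : Fin G.n, G.Prefix N k) → ℝ =>
      X ⟨k, fun i => σ i⟩ := fun k => measurable_pi_apply _
  exact (Finset.measurable_sum _ fun k _ => (h k).const_mul _).const_mul _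

/-- Events which are implied by events of exponentially high probability for the Gaussian variables
happen almost surely for all large `N`. -/
theorem ae_eventually_mem_of_stdGaussianPi {Ω : Type*} [MeasurableSpace Ω] {μ : Measure Ω}
    [IsProbabilityMeasure μ] {U : (N : ℕ) → Ω → HammingCube N → ℝ}
    (hU : ∀ N, HasLaw (U N) (G.law N) μ) {R : (N : ℕ) → Set (HammingCube N → ℝ)}
    (hR : ∀ N, IsClosed (R N)) {good : (N : ℕ) → ((Σ k : Fin G.n, G.Prefix N k) → ℝ) → Prop}
    (hgood : ∀ᶠ N in atTop, ∀ X, good N X → G.potential N X ∈ R N) {K c : ℝ} (hc : 0 < c)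
    (hprob : ∀ᶠ N : ℕ in atTop, (stdGaussianPi (Σ k : Fin G.n, G.Prefix N k)).real
      {X | ¬ good N X} ≤ K * Real.exp (-(c * N))) :
    ∀ᵐ ω ∂μ, ∀ᶠ N in atTop, U N ω ∈ R N := by
  refine ae_eventually_of_measureReal_le (K := K) hc ?_
  filter_upwards [hgood, hprob] with N hgood hprob
  refine le_trans ?_ hprob
  have hmeas : MeasurableSet (R N)ᶜ := (hR N).measurableSet.compl
  have h1 : μ {ω | ¬ U N ω ∈ R N} =
      stdGaussianPi (Σ k : Fin G.n, G.Prefix N k) (G.potential N ⁻¹' (R N)ᶜ) := by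
    rw [← Measure.map_apply (G.measurable_potential N) hmeas]
    change μ (U N ⁻¹' (R N)ᶜ) = G.law N (R N)ᶜ
    rw [← (hU N).map_eq, Measure.map_apply_of_aemeasurable (hU N).aemeasurable hmeas]
  rw [measureReal_def, h1, ← measureReal_def]
  refine measureReal_mono fun X hX => ?_
  simp only [Set.mem_preimage, Set.mem_compl_iff] at hX
  exact fun h => hX (hgood X h)

/-- The choice of `r` makes `r ε² / 2` at least `1 + 2 log 2`, which beats the `4 ^ N` of the union
bound and leaves `e^{-N} ≤ e^{-εN}`. -/
theorem measure_not_upper_good_le {N : ℕ} (hN : 0 < N) (β : ℝ) {ε : ℝ} (hε : 0 < ε) (hε1 : ε ≤ 1)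
    {r : ℕ} (hr : 2 * (1 + 2 * Real.log 2) / ε ^ 2 ≤ r) :
    (stdGaussianPi (Σ k : Fin G.n, G.Prefix N k)).real
      {X | ¬ ((∀ k σ, Set.ncard {j : Fin N | (j : ℕ) < G.cut N k.succ ∧
        G.IsDeep ε X k (flipSpin j σ)} ≤ r) ∧ G.MomentsBounded β ε X)} ≤
      (2 * G.n + 1) * Real.exp (-(ε * N)) := by
  have hN' : (0 : ℝ) < N := Nat.cast_pos.2 hN
  have h1 := G.measure_many_deep_le hε hN r
  have h1' : G.n * ((2 : ℝ) ^ N * 2 ^ N) * Real.exp (-((ε * √(N : ℝ)) ^ 2 / 2)) ^ (r + 1) ≤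
      G.n * Real.exp (-(ε * N)) := by
    rw [mul_assoc]
    refine mul_le_mul_of_nonneg_left ?_ (Nat.cast_nonneg _)
    rw [← exp_nat_mul_log_two, ← Real.exp_nat_mul, ← Real.exp_add, ← Real.exp_add,
      Real.exp_le_exp, mul_pow, Real.sq_sqrt hN'.le]
    rw [div_le_iff₀ (by positivity)] at hr
    push_cast
    have h3 : (1 + 2 * Real.log 2) * N ≤ (r * ε ^ 2 / 2) * N :=
      mul_le_mul_of_nonneg_right (by linarith) hN'.le
    nlinarith [mul_pos (sq_pos_of_pos hε) hN']
  have h2 : (stdGaussianPi (Σ k : Fin G.n, G.Prefix N k)).real {X | ¬ G.MomentsBounded β ε X} ≤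
      (G.n + 1) * Real.exp (-(ε * N)) := by
    have hsub : {X | ¬ G.MomentsBounded (N := N) β ε X} ⊆ ⋃ d : Fin (G.n + 1),
        {X | 2 ^ N * Real.exp (∑ k ∈ G.levels d, G.tiltedWeight N β k ^ 2 / 2 + ε * N) <
          ∑ σ : HammingCube N,
            Real.exp (∑ k ∈ G.levels d, G.tiltedWeight N β k * X (G.node k σ))} := by
      intro X hX
      simpa [MomentsBounded] using hX
    calc _ ≤ _ := measureReal_mono hsub
      _ ≤ _ := measureReal_iUnion_fintype_le _
      _ ≤ ∑ _d : Fin (G.n + 1), Real.exp (-(ε * N)) :=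
        Finset.sum_le_sum fun d _ => G.measure_sum_exp_path_gt_le _ _ _
      _ = _ := by simp
  have hsub : {X | ¬ ((∀ k σ, Set.ncard {j : Fin N | (j : ℕ) < G.cut N k.succ ∧
        G.IsDeep ε X k (flipSpin j σ)} ≤ r) ∧ G.MomentsBounded β ε X)} ⊆
      {X | ¬ ∀ k σ, Set.ncard {j : Fin N | (j : ℕ) < G.cut N k.succ ∧
        G.IsDeep ε X k (flipSpin j σ)} ≤ r} ∪ {X | ¬ G.MomentsBounded β ε X} := by
    intro X hX
    rwa [Set.mem_ofPred_eq, not_and_or] at hX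
  calc _ ≤ _ := measureReal_mono hsub
    _ ≤ _ := measureReal_union_le _ _
    _ ≤ G.n * Real.exp (-(ε * N)) + (G.n + 1) * Real.exp (-(ε * N)) :=
      add_le_add (h1.trans h1') h2
    _ = _ := by ring

/-- Almost surely, the pressure is eventually bounded from above for all fields of moderate size. -/
theorem ae_eventually_pressure_le {Ω : Type*} [MeasurableSpace Ω] {μ : Measure Ω}
    [IsProbabilityMeasure μ] {U : (N : ℕ) → Ω → HammingCube N → ℝ}
    (hU : ∀ N, HasLaw (U N) (G.law N) μ) {β : ℝ} (hβ : 0 ≤ β) (p : ℝ) {D κ : ℝ} (hD : 0 ≤ D)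
    (hκ : 0 < κ) :
    ∃ δ > 0, ∀ᵐ ω ∂μ, ∀ᶠ N in atTop, ∀ b : Fin N → ℝ, (∀ j, |b j| ≤ δ * N) →
      ∑ j, |b j| ≤ D * N → (∀ d, ∑ j ∈ sitesFrom N (G.cut N d),
        Real.log (2 * Real.cosh (β * b j)) ≤ N * ((1 - G.x d) * p + δ)) →
      pressure β (U N ω) b ≤ G.limitPressure β p + κ := by
  have hC := G.tiltBound_nonneg β
  have hκ4 : 0 < κ / 4 := by positivity
  -- The constants are chosen in the order `ε`, `r`, `η`, `δ`: the bound on a single field value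
  -- must be small relative to `η / r`. Three error terms and the vanishing one each receive `κ /
  -- 4`.
  obtain ⟨ε, hε, hε1, hεκ⟩ :=
    exists_pos_mul_le (c := β * G.n + G.tiltBound β + 2) (by positivity) hκ4 one_pos
  obtain ⟨r, hr⟩ := exists_nat_ge (2 * (1 + 2 * Real.log 2) / ε ^ 2)
  obtain ⟨η, hη0, -, hηκ⟩ := exists_pos_mul_le (c := G.n * β * D) (by positivity) hκ4 one_pos
  obtain ⟨δ, hδ0, hδε, hδκ⟩ :=
    exists_pos_mul_le (c := G.n * β * r / η) (by positivity) hκ4 hε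
  refine ⟨δ, hδ0, ?_⟩
  have key := G.ae_eventually_mem_of_stdGaussianPi hU (K := 2 * G.n + 1) (c := ε)
    (fun N => isClosed_pressure_le β (G.limitPressure β p + κ) {b : Fin N → ℝ |
      (∀ j, |b j| ≤ δ * N) ∧ ∑ j, |b j| ≤ D * N ∧ (∀ d, ∑ j ∈ sitesFrom N (G.cut N d),
        Real.log (2 * Real.cosh (β * b j)) ≤ N * ((1 - G.x d) * p + δ))})
    (good := fun N X => (∀ k σ, Set.ncard {j : Fin N | (j : ℕ) < G.cut N k.succ ∧
        G.IsDeep ε X k (flipSpin j σ)} ≤ r) ∧ G.MomentsBounded β ε X) ?_ hε ?_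
  · filter_upwards [key] with ω hω
    filter_upwards [hω] with N hN b h1 h2 h3
    exact hN b ⟨h1, h2, h3⟩
  · have hlim : Tendsto (fun N : ℕ => (Real.log (2 * (G.n + 1)) + G.tiltBound β * Real.log 2) /
        (N : ℝ)) atTop (𝓝 0) := tendsto_const_nhds.div_atTop tendsto_natCast_atTop_atTop
    filter_upwards [hlim.eventually (gt_mem_nhds (show (0 : ℝ) < κ / 4 by positivity)),
      eventually_gt_atTop 0] with N hN hN0 X hX
    rintro b ⟨h1, h2, h3⟩
    have := G.pressure_le hβ hε.le hη0 hN0 hX.1 hX.2 hδ0.le h1 h2 (p := p) fun d =>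
      (h3 d).trans (by gcongr)
    linarith
  · filter_upwards [eventually_gt_atTop 0] with N hN0
    exact G.measure_not_upper_good_le hN0 β hε hε1 hr

end GREM

/-! ### The almost sure lower bound, uniformly in the field -/

namespace GREM

variable (G : GREM)

/-- The expected number of low prefixes grows at least at the rate `s - n ε ≥ s / 2`; the tail
errors use at most half of the entropy. -/
theorem inv_expected_count_le {N : ℕ} {ε s : ℝ} {lam : Fin G.n → ℝ} (d : Fin (G.n + 1))
    (hε : G.n * ε ≤ s / 2) (hε0 : 0 ≤ ε)
    (hs : s ≤ ∑ k ∈ G.levels d, (G.blockLength k * Real.log 2 - G.a k * (lam k ^ 2 / 2)))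
    (htail : ∀ k, Real.exp (-(((lam k * √(G.a k)) ^ 2 / 2 + ε) * N)) ≤
      gaussianTail (-(lam k * √(G.a k) * √(N : ℝ)))) :
    (2 ^ G.cut N d * ∏ k ∈ G.levels d, gaussianTail (-(lam k * √(G.a k) * √(N : ℝ))))⁻¹ ≤
      Real.exp (-(s / 2 * N)) := by
  rw [Real.exp_neg]
  refine inv_anti₀ (Real.exp_pos _) ?_
  have hprod : Real.exp (-(∑ k ∈ G.levels d, ((lam k * √(G.a k)) ^ 2 / 2 + ε) * N)) ≤
      ∏ k ∈ G.levels d, gaussianTail (-(lam k * √(G.a k) * √(N : ℝ))) := by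
    rw [← Finset.sum_neg_distrib, Real.exp_sum]
    exact Finset.prod_le_prod (fun k _ => (Real.exp_pos _).le) fun k _ => htail k
  refine le_trans ?_ (mul_le_mul_of_nonneg_left hprod (by positivity))
  rw [← exp_nat_mul_log_two, ← Real.exp_add, Real.exp_le_exp]
  have h3 := mul_le_mul_of_nonneg_right (G.le_cut N d) (Real.log_pos one_lt_two).le
  have hcard : ((G.levels d).card : ℝ) * ε ≤ G.n * ε := by
    refine mul_le_mul_of_nonneg_right ?_ hε0
    exact_mod_cast (Finset.card_le_univ _).trans_eq (Fintype.card_fin _)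
  rw [Finset.sum_sub_distrib, ← Finset.sum_mul, sum_levels_blockLength] at hs
  have e : ∑ k ∈ G.levels d, ((lam k * √(G.a k)) ^ 2 / 2 + ε) * N =
      (∑ k ∈ G.levels d, G.a k * (lam k ^ 2 / 2) + (G.levels d).card * ε) * N := by
    rw [← Finset.sum_mul, Finset.sum_add_distrib, Finset.sum_const, nsmul_eq_mul]
    congr 2
    refine Finset.sum_congr rfl fun k _ => ?_
    rw [mul_pow, Real.sq_sqrt (G.a_pos k).le]
    ring
  rw [e]
  have hN : (0 : ℝ) ≤ N := Nat.cast_nonneg N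
  have h4 := mul_le_mul_of_nonneg_right
    (show s / 2 ≤ G.x d * Real.log 2 - (∑ k ∈ G.levels d, G.a k * (lam k ^ 2 / 2) +
      (G.levels d).card * ε) by linarith) hN
  linarith

/-- The cut positions separate fast enough for the averages over later blocks to concentrate. -/
theorem eventually_average_condition (d : Fin (G.n + 1)) :
    ∀ᶠ N : ℕ in atTop, ∀ k ∈ (G.levels d)ᶜ,
      (N : ℝ) * ((2 : ℝ) ^ G.cut N d / 2 ^ G.cut N k.succ) ≤ 1 := by
  refine (eventually_all (ι := Fin G.n)).2 fun k => ?_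
  by_cases hk : k ∈ (G.levels d)ᶜ
  swap
  · exact .of_forall fun N h => absurd h hk
  have hlt : G.x d < G.x k.succ := by
    refine G.x_strictMono (lt_of_not_ge fun h => ?_)
    exact (Finset.mem_compl.1 hk) (G.mem_levels_iff_succ_le.2 h)
  set c := (G.x k.succ - G.x d) * Real.log 2 with hc
  have hc0 : 0 < c := mul_pos (sub_pos.2 hlt) (Real.log_pos one_lt_two)
  have hlim : Tendsto (fun N : ℕ => 2 * ((N : ℝ) ^ (1 : ℝ) * Real.exp (-c * N))) atTop (𝓝 (2 * 0)) := by
    refine Tendsto.const_mul _ ?_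
    exact (tendsto_rpow_mul_exp_neg_mul_atTop_nhds_zero 1 c hc0).comp tendsto_natCast_atTop_atTop
  rw [mul_zero] at hlim
  filter_upwards [hlim.eventually (ge_mem_nhds one_pos)] with N hN _
  refine le_trans ?_ hN
  rw [Real.rpow_one, mul_left_comm]
  refine mul_le_mul_of_nonneg_left ?_ (Nat.cast_nonneg N)
  rw [← exp_nat_mul_log_two, ← exp_nat_mul_log_two, ← Real.exp_sub]
  rw [show (2 : ℝ) * Real.exp (-c * N) = Real.exp (Real.log 2 + -c * N) by
    rw [Real.exp_add, Real.exp_log two_pos], Real.exp_le_exp, hc]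
  have h1 := mul_le_mul_of_nonneg_right (G.cut_le_add_one N d) (Real.log_pos one_lt_two).le
  have h2 := mul_le_mul_of_nonneg_right (G.le_cut N k.succ) (Real.log_pos one_lt_two).le
  linarith

/-- The minimum over the finitely many prefixes. The second moment method needs positive entropy at
every intermediate level, not only in total. -/
theorem exists_uniform_entropy {β ρ : ℝ} (hβ : 0 ≤ β) (hρ0 : 0 ≤ ρ) (hρ1 : ρ < 1) :
    ∃ s > 0, ∀ k : Fin G.n, s ≤ ∑ i ∈ G.levels k.succ, (G.blockLength i * Real.log 2 -
      G.a i * ((ρ * G.energyRate β (G.segment i)) ^ 2 / 2)) := by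
  have : Nonempty (Fin G.n) := ⟨⟨0, G.n_pos⟩⟩
  obtain ⟨k₀, hk₀⟩ := Finite.exists_min fun k : Fin G.n => ∑ i ∈ G.levels k.succ,
    (G.blockLength i * Real.log 2 - G.a i * ((ρ * G.energyRate β (G.segment i)) ^ 2 / 2))
  exact ⟨_, G.entropy_pos hβ hρ0 hρ1 (Fin.succ_ne_zero k₀), hk₀⟩

theorem eventually_le_gaussianTail {lam : Fin G.n → ℝ} (hlam : ∀ k, 0 ≤ lam k) {ε : ℝ}
    (hε : 0 < ε) : ∀ᶠ N : ℕ in atTop, ∀ k,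
      Real.exp (-(((lam k * √(G.a k)) ^ 2 / 2 + ε) * N)) ≤
        gaussianTail (-(lam k * √(G.a k) * √(N : ℝ))) :=
  eventually_all.2 fun k => eventually_le_gaussianReal_real_Iic
    (mul_nonneg (hlam k) (Real.sqrt_nonneg _)) hε

theorem eventually_measure_not_lower_good_le {β ρ ε : ℝ} (hβ : 0 ≤ β) (hρ0 : 0 ≤ ρ) (hρ1 : ρ < 1)
    (hε : 0 < ε) (d : Fin (G.n + 1)) {lam : Fin G.n → ℝ}
    (hlam : ∀ k, lam k = ρ * G.energyRate β (G.segment k)) :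
    ∃ K, ∃ c > 0, ∀ᶠ N : ℕ in atTop, (stdGaussianPi (Σ k : Fin G.n, G.Prefix N k)).real
      {X | ¬ ((2 ^ N * ∏ k ∈ G.levels d, gaussianTail (-(lam k * √(G.a k) * √(N : ℝ)))) / 2 ≤
          ∑ σ, (G.lowEvent d (fun k => -(lam k * √(G.a k) * √(N : ℝ))) σ).indicator 1 X ∧
        ∀ σ : HammingCube N,
          spinAverage (sitesFrom N (G.cut N d)) (G.potentialOn (G.levels d)ᶜ X) σ ≤ ε * N)} ≤
      K * Real.exp (-(c * N)) := by
  obtain ⟨s, hs, hsk⟩ := G.exists_uniform_entropy hβ hρ0 hρ1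
  -- The tail error `ε'` is tied to the entropy gap `s` and is independent of the tolerance `ε` for
  -- the averages.
  obtain ⟨ε', hε', -, hε's⟩ :=
    exists_pos_mul_le (c := (G.n : ℝ)) (Nat.cast_nonneg _) (half_pos hs) one_pos
  have hlam0 : ∀ k, 0 ≤ lam k := fun k => by
    rw [hlam]; exact mul_nonneg hρ0 (G.energyRate_nonneg hβ _)
  refine ⟨4 * G.n + Real.exp ((2 / ε) ^ 2 / 2), min (s / 2) 1,
    lt_min (half_pos hs) one_pos, ?_⟩
  filter_upwards [G.eventually_le_gaussianTail hlam0 hε', G.eventually_average_condition d]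
    with N htail havg
  have hN : (0 : ℝ) ≤ N := Nat.cast_nonneg N
  have hc1 : Real.exp (-(s / 2 * N)) ≤ Real.exp (-(min (s / 2) 1 * N)) := by
    rw [Real.exp_le_exp, neg_le_neg_iff]
    exact mul_le_mul_of_nonneg_right (min_le_left _ _) hN
  have hc2 : Real.exp (-(N : ℝ)) ≤ Real.exp (-(min (s / 2) 1 * N)) := by
    rw [Real.exp_le_exp, neg_le_neg_iff]
    nlinarith [min_le_right (s / 2) 1]
  have h1 := G.measure_few_low_le d (N := N)
    (s := fun k => -(lam k * √(G.a k) * √(N : ℝ)))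
    fun k => (Real.exp_pos _).trans_le (htail k)
  have h2 := G.measure_large_average_le d hε havg
  have h1' : 4 * ∑ k ∈ G.levels d, ((2 : ℝ) ^ G.cut N k.succ *
      ∏ i ∈ G.levels k.succ, gaussianTail (-(lam i * √(G.a i) * √(N : ℝ))))⁻¹ ≤
      4 * (G.n * Real.exp (-(min (s / 2) 1 * N))) := by
    refine mul_le_mul_of_nonneg_left ?_ (by norm_num)
    refine (Finset.sum_le_sum fun k _ => (G.inv_expected_count_le k.succ hε's hε'.le ?_
      htail).trans hc1).trans ?_
    · simp only [hlam]
      exact hsk k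
    · rw [Finset.sum_const, nsmul_eq_mul]
      refine mul_le_mul_of_nonneg_right ?_ (Real.exp_pos _).le
      exact_mod_cast (Finset.card_le_univ _).trans_eq (Fintype.card_fin _)
  have h2' : (2 : ℝ) ^ N * Real.exp ((2 / ε) ^ 2 / 2 - 2 * N) ≤
      Real.exp ((2 / ε) ^ 2 / 2) * Real.exp (-(min (s / 2) 1 * N)) := by
    refine le_trans ?_ (mul_le_mul_of_nonneg_left hc2 (Real.exp_pos _).le)
    rw [← exp_nat_mul_log_two, ← Real.exp_add, ← Real.exp_add, Real.exp_le_exp]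
    have := mul_le_mul_of_nonneg_left Real.log_two_lt_d9.le hN
    linarith
  refine (measureReal_mono (fun X hX => ?_)).trans
    ((measureReal_union_le _ _).trans ((add_le_add (h1.trans h1') (h2.trans h2')).trans_eq ?_))
  · rwa [Set.mem_ofPred_eq, not_and_or, not_le] at hX
  · ring

/-- Almost surely, the pressure is eventually bounded from below. -/
theorem ae_eventually_le_pressure {Ω : Type*} [MeasurableSpace Ω] {μ : Measure Ω}
    [IsProbabilityMeasure μ] {U : (N : ℕ) → Ω → HammingCube N → ℝ}
    (hU : ∀ N, HasLaw (U N) (G.law N) μ) {β : ℝ} (hβ : 0 ≤ β) (p : ℝ) {κ : ℝ} (hκ : 0 < κ) :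
    ∃ δ > 0, ∀ᵐ ω ∂μ, ∀ᶠ N in atTop, ∀ b : Fin N → ℝ,
      (∀ d, N * ((1 - G.x d) * p - δ) ≤ ∑ j ∈ sitesFrom N (G.cut N d),
        Real.log (2 * Real.cosh (β * b j))) →
      G.limitPressure β p - κ ≤ pressure β (U N ω) b := by
  have hκ3 : 0 < κ / 3 := by positivity
  -- The spins are frozen up to the vertex that realizes the maximum; `1 - t` plays the role of `ρ`,
  -- and its energy cost is at most `t β² ≤ κ / 3`.
  obtain ⟨K, hK, hlimit⟩ := G.exists_limitPressure_eq β p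
  obtain ⟨d, hd⟩ := G.exists_x_eq_y hK
  obtain ⟨t, ht, ht1, htκ⟩ := exists_pos_mul_le (sq_nonneg β) hκ3 one_half_pos
  obtain ⟨ε, hε, -, hεκ⟩ :=
    exists_pos_mul_le (c := G.n + 1 + β) (by positivity) hκ3 one_pos
  have hρ0 : 0 ≤ 1 - t := by linarith
  have hρ1 : 1 - t < 1 := by linarith
  obtain ⟨lam, hlam⟩ : ∃ lam : Fin G.n → ℝ,
    ∀ k, lam k = (1 - t) * G.energyRate β (G.segment k) := ⟨_, fun _ => rfl⟩
  have hlam0 : ∀ k, 0 ≤ lam k := fun k => by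
    rw [hlam]; exact mul_nonneg hρ0 (G.energyRate_nonneg hβ _)
  obtain ⟨C, c, hc, hprob⟩ := G.eventually_measure_not_lower_good_le hβ hρ0 hρ1 hε d hlam
  refine ⟨ε, hε, ?_⟩
  have key := G.ae_eventually_mem_of_stdGaussianPi hU
    (fun N => isClosed_le_pressure β (G.limitPressure β p - κ) {b : Fin N → ℝ |
      ∀ d, N * ((1 - G.x d) * p - ε) ≤ ∑ j ∈ sitesFrom N (G.cut N d),
        Real.log (2 * Real.cosh (β * b j))}) ?_ hc hprob
  · exact key
  · have hlim : Tendsto (fun N : ℕ => Real.log 2 / (N : ℝ)) atTop (𝓝 0) :=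
      tendsto_const_nhds.div_atTop tendsto_natCast_atTop_atTop
    filter_upwards [hlim.eventually (gt_mem_nhds hκ3), eventually_gt_atTop 0,
      G.eventually_le_gaussianTail hlam0 hε] with N hN hN0 htail X hX
    intro b hb
    have h1 := G.le_pressure hβ hN0 htail hX.1 hX.2 (hb d) hε.le
    have h2 := G.sum_levels_energyRate_ge hβ hρ0 hρ1.le hK hd
    simp only [← hlam] at h2
    rw [Finset.sum_add_distrib] at h1 h2
    rw [hlimit, ← hd]
    linarith

end GREM

/-! ### Averages of the field -/

theorem ae_tendsto_average_comp {Ω Ω' : Type*} [MeasurableSpace Ω] [MeasurableSpace Ω']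
    {μ : Measure Ω} {ν : Measure Ω'} {X : Ω' → ℝ} {b : ℕ → Ω → ℝ} (hb_indep : iIndepFun b μ)
    (hb_law : ∀ j, IdentDistrib (b j) X μ ν) {f : ℝ → ℝ} (hf : Measurable f)
    (hint : Integrable (fun ω => f (X ω)) ν) :
    ∀ᵐ ω ∂μ, Tendsto (fun N : ℕ => (∑ i ∈ Finset.range N, f (b i ω)) / N) atTop
      (𝓝 (∫ ω, f (X ω) ∂ν)) := by
  have hid : ∀ j, IdentDistrib (fun ω => f (b j ω)) (fun ω => f (X ω)) μ ν :=
    fun j => (hb_law j).comp hf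
  have h := strong_law_ae_real (μ := μ) (fun j ω => f (b j ω)) ((hid 0).integrable_iff.2 hint)
    (fun i j hij => (hb_indep.indepFun hij).comp hf hf) fun j => (hid j).trans (hid 0).symm
  rwa [(hid 0).integral_eq] at h

/-- The quotient is `(1 + 1 / N)` times the average up to `N + 1` minus the average up to `N`, and
both have the same limit. -/
theorem tendsto_div_of_tendsto_average {u : ℕ → ℝ} {l : ℝ}
    (h : Tendsto (fun N : ℕ => (∑ i ∈ Finset.range N, u i) / N) atTop (𝓝 l)) :
    Tendsto (fun N : ℕ => u N / N) atTop (𝓝 0) := by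
  have h1 := h.comp (tendsto_add_atTop_nat 1)
  have h2 : Tendsto (fun N : ℕ => 1 + 1 / (N : ℝ)) atTop (𝓝 (1 + 0)) :=
    tendsto_const_nhds.add tendsto_one_div_atTop_nhds_zero_nat
  have h3 := (h1.mul h2).sub h
  rw [add_zero, mul_one, sub_self] at h3
  refine h3.congr' ?_
  filter_upwards [eventually_gt_atTop 0] with N hN
  have hN' : (0 : ℝ) < N := Nat.cast_pos.2 hN
  simp only [Function.comp_apply, Finset.sum_range_succ]
  push_cast
  field_simp
  ring

/-- Late terms satisfy `|u j| ≤ δ j ≤ δ N`, and the finitely many early ones are dominated once `N`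
is large. -/
theorem eventually_forall_abs_le_mul {u : ℕ → ℝ}
    (h : Tendsto (fun N : ℕ => u N / N) atTop (𝓝 0)) {δ : ℝ} (hδ : 0 < δ) :
    ∀ᶠ N : ℕ in atTop, ∀ j < N, |u j| ≤ δ * N := by
  have h1 := h.abs
  rw [abs_zero] at h1
  obtain ⟨M, hM⟩ := eventually_atTop.1
    ((h1.eventually (ge_mem_nhds hδ)).and (eventually_gt_atTop 0))
  have h2 : Tendsto (fun N : ℕ => δ * (N : ℝ)) atTop atTop :=
    tendsto_natCast_atTop_atTop.const_mul_atTop hδ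
  filter_upwards [h2.eventually_ge_atTop (∑ i ∈ Finset.range M, |u i|)] with N hN j hj
  rcases lt_or_ge j M with hjM | hjM
  · exact (Finset.single_le_sum (f := fun i => |u i|) (fun i _ => abs_nonneg _)
      (Finset.mem_range.2 hjM)).trans hN
  · obtain ⟨h3, h4⟩ := hM j hjM
    have hj' : (0 : ℝ) < j := Nat.cast_pos.2 h4
    rw [abs_div, abs_of_pos hj', div_le_iff₀ hj'] at h3
    refine h3.trans ?_
    gcongr

theorem sum_sitesFrom {N q : ℕ} (hq : q ≤ N) (u : ℕ → ℝ) :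
    ∑ j ∈ sitesFrom N q, u j = ∑ i ∈ Finset.range N, u i - ∑ i ∈ Finset.range q, u i := by
  rw [sitesFrom, Finset.sum_filter, Fin.sum_univ_eq_sum_range (fun i => if q ≤ i then u i else 0) N,
    ← Finset.sum_filter, eq_sub_iff_add_eq, ← Finset.sum_filter_add_sum_filter_not (Finset.range N)
      (fun i => q ≤ i)]
  congr 2
  ext i
  simp only [Finset.mem_range, Finset.mem_filter, not_le]
  omega

theorem integrable_log_two_mul_cosh {Ω : Type*} [MeasurableSpace Ω] {ν : Measure Ω}
    [IsFiniteMeasure ν] {X : Ω → ℝ} (hX : Integrable X ν) (β : ℝ) :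
    Integrable (fun ω => Real.log (2 * Real.cosh (β * X ω))) ν := by
  have hm : Measurable fun t : ℝ => Real.log (2 * Real.cosh (β * t)) :=
    Real.measurable_log.comp
      ((Real.continuous_cosh.measurable.comp (measurable_const.mul measurable_id)).const_mul 2)
  refine Integrable.mono' ((integrable_const (Real.log 2)).add (hX.const_mul β).abs)
    (hm.comp_aemeasurable hX.aestronglyMeasurable.aemeasurable).aestronglyMeasurable
    (.of_forall fun ω => ?_)
  have h1 : 1 ≤ Real.cosh (β * X ω) := Real.one_le_cosh _
  have h2 : Real.cosh (β * X ω) ≤ Real.exp |β * X ω| := by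
    rw [← Real.cosh_abs, Real.cosh_eq]
    have : Real.exp (-|β * X ω|) ≤ Real.exp |β * X ω| :=
      Real.exp_le_exp.2 (by linarith [abs_nonneg (β * X ω)])
    linarith
  rw [Real.norm_of_nonneg (Real.log_nonneg (by linarith)),
    Real.log_mul two_ne_zero (by positivity), Pi.add_apply]
  refine add_le_add le_rfl ?_
  rw [Real.log_le_iff_le_exp (by positivity)]
  exact h2

/-! ### Law of large numbers for the fields on the last blocks -/

namespace GREM

variable (G : GREM)

theorem tendsto_cut_div (d : Fin (G.n + 1)) :
    Tendsto (fun N : ℕ => (G.cut N d : ℝ) / N) atTop (𝓝 (G.x d)) := by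
  have h0 : 0 ≤ G.x d := by
    rw [← G.x_zero]; exact G.x_strictMono.monotone (Fin.zero_le d)
  exact (tendsto_nat_ceil_mul_div_atTop h0).comp tendsto_natCast_atTop_atTop

theorem tendsto_average_sitesFrom {u : ℕ → ℝ} {p : ℝ}
    (h : Tendsto (fun N : ℕ => (∑ i ∈ Finset.range N, u i) / N) atTop (𝓝 p))
    (d : Fin (G.n + 1)) :
    Tendsto (fun N : ℕ => (∑ j ∈ sitesFrom N (G.cut N d), u j) / N) atTop
      (𝓝 ((1 - G.x d) * p)) := by
  have hprefix : Tendsto (fun N : ℕ => (∑ i ∈ Finset.range (G.cut N d), u i) / N) atTop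
      (𝓝 (G.x d * p)) := by
    rcases eq_or_ne d 0 with rfl | hd
    -- For `d = 0` the prefix is empty, so its length does not tend to infinity and the averages
    -- cannot be composed with it.
    · simp [cut_zero, G.x_zero]
    · have hx : 0 < G.x d := by
        rw [← G.x_zero]; exact G.x_strictMono (Fin.pos_of_ne_zero hd)
      have hcut : Tendsto (fun N : ℕ => G.cut N d) atTop atTop := by
        refine (tendsto_natCast_atTop_iff (R := ℝ)).1 (tendsto_atTop_mono (fun N => G.le_cut N d) ?_)
        exact tendsto_natCast_atTop_atTop.const_mul_atTop hx
      refine ((G.tendsto_cut_div d).mul (h.comp hcut)).congr' ?_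
      filter_upwards [hcut.eventually_gt_atTop 0] with N hN
      have hN' : (0 : ℝ) < G.cut N d := Nat.cast_pos.2 hN
      simp only [Function.comp_apply]
      field_simp
  have := h.sub hprefix
  rw [show p - G.x d * p = (1 - G.x d) * p by ring] at this
  refine this.congr fun N => ?_
  rw [sum_sitesFrom (G.cut_le N d), sub_div]

theorem eventually_abs_sum_sitesFrom_sub_le {u : ℕ → ℝ} {p : ℝ}
    (h : Tendsto (fun N : ℕ => (∑ i ∈ Finset.range N, u i) / N) atTop (𝓝 p)) {δ : ℝ} (hδ : 0 < δ) :
    ∀ᶠ N : ℕ in atTop, ∀ d,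
      |∑ j ∈ sitesFrom N (G.cut N d), u j - N * ((1 - G.x d) * p)| ≤ N * δ := by
  refine eventually_all.2 fun d => ?_
  have h1 := Metric.tendsto_nhds.1 (G.tendsto_average_sitesFrom h d) δ hδ
  filter_upwards [h1, eventually_gt_atTop 0] with N hN hN0
  have hN' : (0 : ℝ) < N := Nat.cast_pos.2 hN0
  rw [Real.dist_eq] at hN
  have : ∑ j ∈ sitesFrom N (G.cut N d), u j - N * ((1 - G.x d) * p) =
      N * ((∑ j ∈ sitesFrom N (G.cut N d), u j) / N - (1 - G.x d) * p) := by
    field_simp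
  rw [this, abs_mul, abs_of_pos hN']
  gcongr

end GREM

/-! ### Combining the two bounds -/

theorem mainTheorem1 (G : GREM) (β : ℝ) (hβ : 0 ≤ β)
    {Ω Ω' : Type*} [MeasurableSpace Ω] [MeasurableSpace Ω']
    (μ : Measure Ω) [IsProbabilityMeasure μ] (ν : Measure Ω') [IsProbabilityMeasure ν]
    (𝔟 : Ω' → ℝ) (h𝔟 : Integrable 𝔟 ν)
    (b : ℕ → Ω → ℝ) (hb_indep : iIndepFun b μ) (hb_law : ∀ j, IdentDistrib (b j) 𝔟 μ ν)
    (U : (N : ℕ) → Ω → HammingCube N → ℝ) (hU : ∀ N, HasLaw (U N) (G.law N) μ)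
    (hUb : ∀ N, IndepFun (U N) (fun ω j => b j ω) μ) :
    ∀ᵐ ω ∂μ, Tendsto (fun N : ℕ => pressure β (U N ω) (fun j : Fin N => b j ω)) atTop
      (𝓝 (G.limitPressure β (∫ ω', Real.log (2 * Real.cosh (β * 𝔟 ω')) ∂ν))) := by
  set p := ∫ ω', Real.log (2 * Real.cosh (β * 𝔟 ω')) ∂ν
  have hD : 0 ≤ ∫ ω', |𝔟 ω'| ∂ν := integral_nonneg fun _ => abs_nonneg _
  -- Countably many accuracies `1 / (q + 1)` suffice for the limit, so that one null set serves all
  -- of them.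
  have hκ : ∀ q : ℕ, (0 : ℝ) < 1 / (q + 1) := fun q => Nat.one_div_pos_of_nat
  -- The constant `D` is the mean of `|𝔟|` plus one, so the empirical mean eventually lies below it.
  choose δ hδ hupper using fun q : ℕ =>
    G.ae_eventually_pressure_le hU hβ p (add_nonneg hD zero_le_one) (hκ q)
  choose δ' hδ' hlower using fun q : ℕ => G.ae_eventually_le_pressure hU hβ p (hκ q)
  have hm : Measurable fun t : ℝ => Real.log (2 * Real.cosh (β * t)) :=
    Real.measurable_log.comp
      ((Real.continuous_cosh.measurable.comp (measurable_const.mul measurable_id)).const_mul 2)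
  filter_upwards [ae_all_iff.2 hupper, ae_all_iff.2 hlower,
    ae_tendsto_average_comp hb_indep hb_law hm (integrable_log_two_mul_cosh h𝔟 β),
    ae_tendsto_average_comp hb_indep hb_law measurable_norm h𝔟.norm] with ω hu hl hlog habs
  simp only [Real.norm_eq_abs] at habs
  refine Metric.tendsto_nhds.2 fun ε hε => ?_
  obtain ⟨q, hq⟩ := exists_nat_one_div_lt hε
  filter_upwards [hu q, hl q, G.eventually_abs_sum_sitesFrom_sub_le hlog (hδ q),
    G.eventually_abs_sum_sitesFrom_sub_le hlog (hδ' q),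
    eventually_forall_abs_le_mul (tendsto_div_of_tendsto_average habs) (hδ q),
    habs.eventually (ge_mem_nhds (lt_add_one _)), eventually_gt_atTop 0]
    with N h1 h2 h3 h4 h5 h6 hN
  have hN' : (0 : ℝ) < N := Nat.cast_pos.2 hN
  have hle := h1 (fun j => b j ω) (fun j => by simpa using h5 j j.2)
    (by rwa [div_le_iff₀ hN', ← Fin.sum_univ_eq_sum_range (fun i => |b i ω|)] at h6)
    fun d => by linarith [(abs_le.1 (h3 d)).2]
  have hge := h2 (fun j => b j ω) fun d => by linarith [(abs_le.1 (h4 d)).1]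
  rw [Real.dist_eq]
  refine lt_of_le_of_lt (abs_le.2 ⟨?_, ?_⟩) hq <;> linarith
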